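/- Let $\Omega\subseteq\mathbb R^n$ be open and let $\mathcal F u=\sum_{i,k}a^{ik}\partial_i\partial_k u+\sum_i B^i\partial_i u+Cu$ have real-analytic real coefficients on $\Omega$, where the matrix $(a^{ik}(x))$ is symmetric and invertible for every $x\in\Omega$ (any signature). Let $\xi\in\Omega$ and $m=\frac n2-1$. A geodesic from $\xi$ is a solution on $[0,1]$ of $\dot x^i=\frac12\sum_j a^{ij}p_j$, $\dot p_i=-\frac14\sum_{j,k}\partial_i a^{jk}p_jp_k$ with $x(0)=\xi$. Then $\xi$ has an open neighbourhood $N\subseteq\Omega$ in which every point is joined to $\xi$ by exactly one geodesic lying in $N$, and such that the following holds. Let the world function $\Gamma$ on $N$ be the (signed) squared geodesic distance from $\xi$, i.e. $\Gamma(x)=\frac14\sum a^{ij}(\xi)\theta_i\theta_j$, where $\theta$ is the initial momentum of the geodesic in $N$ with $x(0)=\xi$, $x(1)=x$. Then $\Gamma$ is real-analytic on $N$ and $\sum a^{ij}\partial_i\Gamma\,\partial_j\Gamma=4\Gamma$ there. Put $D=\frac14\sum a^{ij}\partial_i\partial_j\Gamma+\frac14\sum B^i\partial_i\Gamma$, and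 let $s\frac d{ds}$ be taken along the geodesics from $\xi$ in $N$. For real-analytic $U,V,W$ near $\xi$ with $U(\xi)\ne0$, call $U\Gamma^{-m}+V\log\Gamma+W$ a local fundamental solution if $\mathcal F$ annihilates it at all points with $\Gamma\neq0$ of a neighbourhood of $\xi$ (principal branches where $\Gamma<0$). Let $P\neq0$ be a real constant. (Odd $n$.) There are unique real-analytic functions $U_l$ ($l\ge0$) on $N$ with $U_0(\xi)=P$ and $$\Big[s\tfrac{d}{ds}+D-m-1\Big]U_0=0,\qquad \Big[s\tfrac{d}{ds}+D+l-m-1\Big]U_l=-\frac{\mathcal F[U_{l-1}]}{4(l-m)}\quad(l\ge1).$$ The series $\sum_l U_l\Gamma^l$ converges absolutely and uniformly on a neighbourhood of $\xi$ to a real-analytic function $U$, and $$R=\frac{U}{\Gamma^m}=\sum_{l=0}^\infty U_l\,\Gamma^{\,l-\frac n2+1}$$ is a local fundamental solution (with $V=W=0$). (Even $n\ge4$.) The same equations have unique real-analytic solutions $U_0,\dots,U_{m-1}$ on $N$ with $U_0(\xi)=P$. There are unique real-analytic $V_l$ ($l\ge 0$) on $N$ with $$\Big[s\tfrac{d}{ds}+D-1\Big]V_0=-\tfrac14\mathcal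 F[U_{m-1}],\qquad \Big[s\tfrac{d}{ds}+D+l-1\Big]V_l=-\frac{\mathcal F[V_{l-1}]}{4l}\quad(l\ge1),$$ and there are real-analytic $W_l$ ($l\ge1$) on $N$, such that on a neighbourhood of $\xi$ the series $V=\sum_{l\ge0}V_l\Gamma^l$ and $W=\sum_{l\ge1}W_l\Gamma^l$ converge absolutely and uniformly to real-analytic functions, and $$R=\sum_{l=0}^{m-1}U_l\Gamma^{l-m}+V\log\Gamma+W$$ is a local fundamental solution. The function $V$ solves the characteristic initial-value problem $\mathcal F[V]=0$ near $\xi$, $V=V_0$ on the conoid $\Gamma=0$ (moreover $V-V_0$ is divisible by $\Gamma$ among analytic germs at $\xi$). Among germs of real-analytic functions at $\xi$, $V$ is the only solution $v$ of $\mathcal F[v]=0$ for which $v-V_0$ is divisible by $\Gamma$; if $(a^{ij}(\xi))$ is indefinite, it is also the only one with $v=V_0$ on $\{\Gamma=0\}$ near $\xi$. The logarithmic term is forced: if $\tilde U\Gamma^{-m}+\tilde V\log\Gamma+\tilde W$ is any local fundamental solution, then $\tilde V=\frac{\tilde U(\xi)}{P}V$ near $\xi$, so the logarithm can be absent only when $V\equiv0$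 near $\xi$. -/

import Mathlib

open Set Filter Topology

noncomputable section

namespace HadamardFS

/-- Coordinate partial derivative `∂f/∂xⁱ`. -/
def pd {n : ℕ} {G : Type*} [NormedAddCommGroup G] [NormedSpace ℝ G]
    (i : Fin n) (f : (Fin n → ℝ) → G) (x : Fin n → ℝ) : G :=
  fderiv ℝ f x (Pi.single i 1)

/-- Coefficients `aⁱᵏ, Bⁱ, C` of a second-order linear differential operator in `n` variables. -/
structure LinOp (n : ℕ) where
  a : (Fin n → ℝ) → Matrix (Fin n) (Fin n) ℝ
  B : (Fin n → ℝ) → Fin n → ℝ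
  C : (Fin n → ℝ) → ℝ

/-- The operator `∑ aⁱᵏ ∂ᵢ∂ₖ u + ∑ Bⁱ ∂ᵢ u + C u`, acting on real or complex valued functions. -/
def LinOp.app {n : ℕ} (F : LinOp n) {G : Type*} [NormedAddCommGroup G] [NormedSpace ℝ G]
    (u : (Fin n → ℝ) → G) (x : Fin n → ℝ) : G :=
  ∑ i, ∑ k, F.a x i k • pd i (pd k u) x + ∑ i, F.B x i • pd i u x + F.C x • u x

/-- Real-analytic coefficients on `Ω`, with symmetric non-degenerate principal part
(of any signature). -/
structure LinOp.IsAnalyticOn {n : ℕ} (F : LinOp n) (Ω : Set (Fin n → ℝ)) : Prop where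
  analytic_a : ∀ i k, AnalyticOnNhd ℝ (fun x => F.a x i k) Ω
  analytic_B : ∀ i, AnalyticOnNhd ℝ (fun x => F.B x i) Ω
  analytic_C : AnalyticOnNhd ℝ F.C Ω
  symm : ∀ x ∈ Ω, (F.a x).IsSymm
  nondegenerate : ∀ x ∈ Ω, (F.a x).det ≠ 0

/-- The Hamiltonian `H(x, p) = ¼ ∑ aⁱʲ(x) pᵢ pⱼ`.  With `dx/ds = ½ a p` it equals
`∑ Aᵢⱼ (dxⁱ/ds) (dxʲ/ds)`, where `A = a⁻¹` is the metric. -/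
def LinOp.H {n : ℕ} (F : LinOp n) (x p : Fin n → ℝ) : ℝ :=
  (1 / 4) * ∑ i, ∑ j, F.a x i j * p i * p j

/-- `(γ, p)` is a geodesic of the metric `a⁻¹` in Hamiltonian form, over the affine parameter
interval `[0, 1]`, issuing from `ξ` and staying in `N`. -/
structure LinOp.IsGeodesic {n : ℕ} (F : LinOp n) (ξ : Fin n → ℝ) (N : Set (Fin n → ℝ))
    (γ p : ℝ → Fin n → ℝ) : Prop where
  start : γ 0 = ξ
  mem : ∀ s ∈ Icc (0 : ℝ) 1, γ s ∈ N
  position : ∀ s ∈ Icc (0 : ℝ) 1, HasDerivWithinAt γ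
    (fun i => (1 / 2) * ∑ j, F.a (γ s) i j * p s j) (Icc 0 1) s
  momentum : ∀ s ∈ Icc (0 : ℝ) 1, HasDerivWithinAt p
    (fun i => -(1 / 4) * ∑ j, ∑ k, pd i (fun y => F.a y j k) (γ s) * p s j * p s k) (Icc 0 1) s

/-- The geodesic from `ξ` with initial momentum `θ` reaches `x` at parameter value `1` inside `N`
(so that `θ` is the normal coordinate of `x`). -/
def LinOp.Reaches {n : ℕ} (F : LinOp n) (ξ : Fin n → ℝ) (N : Set (Fin n → ℝ))
    (θ x : Fin n → ℝ) : Prop :=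
  ∃ γ p : ℝ → Fin n → ℝ, F.IsGeodesic ξ N γ p ∧ p 0 = θ ∧ γ 1 = x

/-- `N` is an open neighbourhood of `ξ` each point of which is joined to `ξ` by exactly one
geodesic in `N`. -/
structure LinOp.IsNormalNhd {n : ℕ} (F : LinOp n) (ξ : Fin n → ℝ)
    (N : Set (Fin n → ℝ)) : Prop where
  isOpen : IsOpen N
  mem : ξ ∈ N
  unique : ∀ x ∈ N, ∃! θ : Fin n → ℝ, F.Reaches ξ N θ x

open Classical in
/-- The world function with pole `ξ`: the (signed) squared geodesic distance from `ξ` within `N`.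
Since `H` is constant along a geodesic and the parameter runs over `[0, 1]`, the squared length of
the geodesic with initial momentum `θ` is `H(ξ, θ)`. -/
def LinOp.world {n : ℕ} (F : LinOp n) (ξ : Fin n → ℝ) (N : Set (Fin n → ℝ))
    (x : Fin n → ℝ) : ℝ :=
  if h : ∃ θ, F.Reaches ξ N θ x then F.H ξ h.choose else 0

/-- `D = ¼ ∑ aⁱʲ ∂ᵢ∂ⱼ Γ + ¼ ∑ Bⁱ ∂ᵢ Γ`. -/
def LinOp.D {n : ℕ} (F : LinOp n) (ξ : Fin n → ℝ) (N : Set (Fin n → ℝ))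
    (x : Fin n → ℝ) : ℝ :=
  (1 / 4) * ∑ i, ∑ j, F.a x i j * pd i (pd j (F.world ξ N)) x
    + (1 / 4) * ∑ i, F.B x i * pd i (F.world ξ N) x

/-- The exponent `m = n/2 - 1`. -/
def expo (n : ℕ) : ℝ := (n : ℝ) / 2 - 1

/-- `u` solves `s du/ds + (D + k) u = f` along every geodesic in `N` issuing from `ξ`. -/
def LinOp.Transport {n : ℕ} (F : LinOp n) (ξ : Fin n → ℝ) (N : Set (Fin n → ℝ)) (k : ℝ)
    (u f : (Fin n → ℝ) → ℝ) : Prop :=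
  ∀ γ p : ℝ → Fin n → ℝ, F.IsGeodesic ξ N γ p → ∀ s ∈ Icc (0 : ℝ) 1,
    s * derivWithin (fun τ => u (γ τ)) (Icc 0 1) s + (F.D ξ N (γ s) + k) * u (γ s) = f (γ s)

/-- The `l`-th transport equation of the recursion
`[s d/ds + (D - m - 1)] U₀ = 0`,
`[s d/ds + (D + l - m - 1)] U_l = - F[U_{l-1}] / (4 (l - m))` for `l ≥ 1`. -/
def LinOp.EqU {n : ℕ} (F : LinOp n) (ξ : Fin n → ℝ) (N : Set (Fin n → ℝ))
    (U : ℕ → (Fin n → ℝ) → ℝ) : ℕ → Prop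
  | 0 => F.Transport ξ N (-expo n - 1) (U 0) (fun _ => 0)
  | l + 1 => F.Transport ξ N (((l + 1 : ℕ) : ℝ) - expo n - 1) (U (l + 1))
      (fun x => -(1 / (4 * (((l + 1 : ℕ) : ℝ) - expo n))) * F.app (U l) x)

/-- The `l`-th transport equation of the recursion for the logarithmic coefficient,
`[s d/ds + (D - 1)] V₀ = - F[u] / 4`,
`[s d/ds + (D + l - 1)] V_l = - F[V_{l-1}] / (4 l)` for `l ≥ 1`. -/
def LinOp.EqV {n : ℕ} (F : LinOp n) (ξ : Fin n → ℝ) (N : Set (Fin n → ℝ))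
    (u : (Fin n → ℝ) → ℝ) (V : ℕ → (Fin n → ℝ) → ℝ) : ℕ → Prop
  | 0 => F.Transport ξ N (-1) (V 0) (fun x => -(1 / 4) * F.app u x)
  | l + 1 => F.Transport ξ N (((l + 1 : ℕ) : ℝ) - 1) (V (l + 1))
      (fun x => -(1 / (4 * ((l + 1 : ℕ) : ℝ))) * F.app (V l) x)

/-- `∑ f_l Γ^l` converges absolutely and uniformly on `N₀`, with sum `S`. -/
def LinOp.SeriesOn {n : ℕ} (F : LinOp n) (ξ : Fin n → ℝ) (N N₀ : Set (Fin n → ℝ))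
    (f : ℕ → (Fin n → ℝ) → ℝ) (S : (Fin n → ℝ) → ℝ) : Prop :=
  (∀ x ∈ N₀, Summable fun l => |f l x * F.world ξ N x ^ l|) ∧
  TendstoUniformlyOn (fun L x => ∑ l ∈ Finset.range L, f l x * F.world ξ N x ^ l) S atTop N₀

/-- `U Γ^(-m) + V log Γ + W`.  Where `Γ < 0` the principal branches are used, whence the
complex values. -/
def LinOp.split {n : ℕ} (F : LinOp n) (ξ : Fin n → ℝ) (N : Set (Fin n → ℝ))
    (U V W : (Fin n → ℝ) → ℝ) (x : Fin n → ℝ) : ℂ :=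
  (U x : ℂ) * (F.world ξ N x : ℂ) ^ (-(expo n : ℂ))
    + (V x : ℂ) * Complex.log (F.world ξ N x : ℂ) + (W x : ℂ)

/-- `U Γ^(-m) + V log Γ + W` is a local fundamental solution with pole `ξ`: `U, V, W` are
regular (real-analytic) on the neighbourhood `N₀` of `ξ`, `U(ξ) ≠ 0`, and the operator annihilates
it at all points of `N₀` off the conoid `Γ = 0`. -/
structure LinOp.IsFundSol {n : ℕ} (F : LinOp n) (ξ : Fin n → ℝ) (N N₀ : Set (Fin n → ℝ))
    (U V W : (Fin n → ℝ) → ℝ) : Prop where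
  isOpen : IsOpen N₀
  mem : ξ ∈ N₀
  subset : N₀ ⊆ N
  analytic_U : AnalyticOnNhd ℝ U N₀
  analytic_V : AnalyticOnNhd ℝ V N₀
  analytic_W : AnalyticOnNhd ℝ W N₀
  ne_zero : U ξ ≠ 0
  solves : ∀ x ∈ N₀, F.world ξ N x ≠ 0 → F.app (F.split ξ N U V W) x = 0

/-- `v = v₀` on the conoid `Γ = 0` near `ξ`, in the sense that `v - v₀` is divisible by `Γ` among
analytic germs at `ξ` (equality on the complexified conoid; for a definite metric the real conoid
is the single point `ξ`). -/
def LinOp.EqOnConoid {n : ℕ} (F : LinOp n) (ξ : Fin n → ℝ) (N : Set (Fin n → ℝ))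
    (v v₀ : (Fin n → ℝ) → ℝ) : Prop :=
  ∃ E : (Fin n → ℝ) → ℝ, AnalyticAt ℝ E ξ ∧ ∀ᶠ x in 𝓝 ξ, v x = v₀ x + F.world ξ N x * E x

/-- The principal part at `ξ` is indefinite. -/
def LinOp.Indefinite {n : ℕ} (F : LinOp n) (ξ : Fin n → ℝ) : Prop :=
  (∃ p, F.H ξ p < 0) ∧ (∃ p, 0 < F.H ξ p)

end HadamardFS

end

open Set Filter Topology HadamardFS

open Set Filter Topology

noncomputable section

namespace HadamardFS

open MvPowerSeries Metric

variable {n : ℕ}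

/-! Write Γ for the world function, L = ½ ∑ aⁱʲ ∂ⱼΓ ∂ᵢ and T_k = L + D + k. The eikonal equation
gives LΓ = 2Γ, and the product rule then gives F[Γ^μ u] = Γ^μ F[u] + 4μ Γ^(μ-1) T_(μ-1) u and F[v
log Γ] = F[v] log Γ + 4 Γ⁻¹ T_(-1) v. The first is used for formal powers
(`FormalOp.app_world_pow_mul`), both for functions off the conoid (`PowLog.app_comb`). Inserting
series in Γ and matching powers yields the transport equations; along a geodesic from ξ the field L
is s d/ds.

The analysis is carried out on power series at ξ. There L is the Euler field plus terms of order
two, and D = n/2 plus terms of order one, so T_(κ - n/2) multiplies the degree-k part by k + κ up to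
a perturbation that raises the order. It is inverted by a fixed point in a weighted ℓ¹ norm
(`NearEuler.exists_solution`); for κ = 0 the value at ξ is free, which is the role of U₀(ξ) = P. The
eikonal equation is solved by a nonlinear version of the same scheme (`FormalOp.exists_eikonal`).

Each recursion step costs two derivatives and gains (l + 1)⁻²: one factor from the coefficient 1/(l
- μ), one from inverting the transport operator. With weights (R - r)^(-2l) the two balance
(`Bdd.app_nagumo`, `Bdd.recursion_bound`), so the coefficients grow geometrically and ∑ u_l Γ^l
converges near ξ, because Γ = O(r²). For even n the remainder F[U_(m-1)] of the finite sum is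
absorbed by V log Γ; V obeys the Frobenius recursion of exponent 0, whence Γ F[V] = 0 and F[V] = 0,
and W compensates the regular terms left over.

Normal coordinates Z with L Z = Z make Γ a quadratic form. Along a geodesic from ξ the difference s
p - dΓ solves a linear system with a singular point at s = 0 and vanishes; hence Z is linear in s,
and conversely the rays of Z lift to geodesics. This yields the normal neighbourhood and identifies
the formal Γ with the signed squared distance.

Uniqueness is divisibility by Γ: if T u is divisible by Γ then so is u, for positive exponents
(`Normal.dvd_of_transport`). A solution of F[d] = 0 divisible by Γ is divisible by every power,
hence zero (`Normal.eq_zero_of_dvd`). The same descent, applied to a fundamental solution with U(ξ)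
= 0, removes its logarithm (`Normal.log_eq_zero`); by linearity the logarithmic term is forced, once
powers and logarithm are separated by `eq_zero_of_log_relation`. In the indefinite case a leading
form vanishing on the real null cone is divisible by the quadratic form (`quadPoly_dvd`), and
uniqueness for the operator frozen at ξ removes it. -/

/-- Formal power series in the coordinates `x - ξ`. -/
abbrev PS (n : ℕ) := MvPowerSeries (Fin n) ℝ

variable {n : ℕ}

/-! ### Majorants, orders of vanishing and a fixed-point principle -/

/-- The weighted `ℓ¹` norm `∑ |c_α| r^|α|` of `c` is at most `M`. -/
def Maj (r M : ℝ) (c : PS n) : Prop :=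
  ∀ s : Finset (Fin n →₀ ℕ), ∑ α ∈ s, |coeff α c| * r ^ α.degree ≤ M

/-- All coefficients of `c` of degree less than `d` vanish. -/
def OrdGE (d : ℕ) (c : PS n) : Prop := ∀ α : Fin n →₀ ℕ, α.degree < d → coeff α c = 0

/-- The operator multiplying the homogeneous part of degree `k` by `φ k`. -/
def diag (φ : ℕ → ℝ) : PS n →ₗ[ℝ] PS n where
  toFun c := fun α => φ α.degree * coeff α c
  map_add' c d := by
    ext α
    show φ α.degree * coeff α (c + d) = φ α.degree * coeff α c + φ α.degree * coeff α d
    rw [map_add, mul_add]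
  map_smul' t c := by
    ext α
    show φ α.degree * coeff α (t • c) = t * (φ α.degree * coeff α c)
    rw [map_smul, smul_eq_mul]; ring

@[simp] theorem coeff_diag (φ : ℕ → ℝ) (c : PS n) (α : Fin n →₀ ℕ) :
    coeff α (diag φ c) = φ α.degree * coeff α c := rfl

/-- The numerical core of Cauchy's estimate: the degree lost in differentiating is paid for by the
gap between the two radii. -/
theorem mul_pow_mul_sub_le {r r' : ℝ} (hr : 0 ≤ r) (hrr : r ≤ r') (k : ℕ) :
    (k + 1 : ℝ) * r ^ k * (r' - r) ≤ r' ^ (k + 1) := by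
  have h0 : 0 ≤ r' - r := sub_nonneg.2 hrr
  induction k with
  | zero => simpa using hr
  | succ k ih =>
    have e1 : r ^ (k + 1) ≤ r' ^ (k + 1) := by gcongr
    have e2 : 0 ≤ r ^ (k + 1) := by positivity
    push_cast
    calc ((k : ℝ) + 1 + 1) * r ^ (k + 1) * (r' - r)
        = ((k + 1 : ℝ) * r ^ k * (r' - r)) * r + r ^ (k + 1) * (r' - r) := by ring
      _ ≤ r' ^ (k + 1) * r + r' ^ (k + 1) * (r' - r) := by gcongr
      _ = _ := by ring

namespace Maj

variable {r M M' : ℝ} {c d : PS n}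

theorem nonneg (h : Maj r M c) : 0 ≤ M := by simpa using h ∅

theorem mono (h : Maj r M c) (hM : M ≤ M') : Maj r M' c := fun s => (h s).trans hM

theorem of_le {r' : ℝ} (hr : 0 ≤ r) (hrr : r ≤ r') (h : Maj r' M c) : Maj r M c := fun s =>
  (Finset.sum_le_sum fun _ _ => by gcongr).trans (h s)

theorem summable (hr : 0 ≤ r) (h : Maj r M c) :
    Summable fun α : Fin n →₀ ℕ => |coeff α c| * r ^ α.degree :=
  summable_of_sum_le (fun _ => by positivity) h

theorem zero : Maj r 0 (0 : PS n) := fun s => by simp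

theorem add (hr : 0 ≤ r) (hc : Maj r M c) (hd : Maj r M' d) : Maj r (M + M') (c + d) := fun s => by
  refine le_trans (Finset.sum_le_sum fun α _ => ?_) ((Finset.sum_add_distrib (s := s)).le.trans
    (add_le_add (hc s) (hd s)))
  rw [map_add, ← add_mul]
  gcongr
  exact abs_add_le _ _

theorem neg (hc : Maj r M c) : Maj r M (-c) := fun s => by
  simpa [map_neg, abs_neg] using hc s

theorem sub (hr : 0 ≤ r) (hc : Maj r M c) (hd : Maj r M' d) : Maj r (M + M') (c - d) := by
  rw [sub_eq_add_neg]; exact hc.add hr hd.neg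

theorem smul (t : ℝ) (hc : Maj r M c) : Maj r (|t| * M) (t • c) := fun s => by
  have : ∑ α ∈ s, |coeff α (t • c)| * r ^ α.degree = |t| * ∑ α ∈ s, |coeff α c| * r ^ α.degree := by
    rw [Finset.mul_sum]
    exact Finset.sum_congr rfl fun α _ => by rw [map_smul, smul_eq_mul, abs_mul, mul_assoc]
  rw [this]
  exact mul_le_mul_of_nonneg_left (hc s) (abs_nonneg _)

theorem sum (hr : 0 ≤ r) {ι : Type*} (s : Finset ι) {M : ι → ℝ} {c : ι → PS n}
    (h : ∀ i ∈ s, Maj r (M i) (c i)) : Maj r (∑ i ∈ s, M i) (∑ i ∈ s, c i) := by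
  classical
  induction s using Finset.induction_on with
  | empty => simpa using zero
  | insert i s hi ih =>
    rw [Finset.sum_insert hi, Finset.sum_insert hi]
    exact (h i (by simp)).add hr (ih fun j hj => h j (by simp [hj]))

theorem mul (hr : 0 ≤ r) (hc : Maj r M c) (hd : Maj r M' d) : Maj r (M * M') (c * d) := fun s => by
  classical
  have h1 : ∀ α ∈ s, |coeff α (c * d)| * r ^ α.degree ≤ ∑ p ∈ Finset.HasAntidiagonal.antidiagonal α,
      (|coeff p.1 c| * r ^ p.1.degree) * (|coeff p.2 d| * r ^ p.2.degree) := fun α _ => by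
    rw [coeff_mul]
    refine (mul_le_mul_of_nonneg_right (Finset.abs_sum_le_sum_abs _ _) (by positivity)).trans ?_
    rw [Finset.sum_mul]
    refine Finset.sum_le_sum fun p hp => le_of_eq ?_
    rw [Finset.HasAntidiagonal.mem_antidiagonal] at hp
    rw [← hp, map_add, pow_add, abs_mul]; ring
  refine (Finset.sum_le_sum h1).trans ?_
  rw [Finset.sum_sigma']
  -- Antidiagonals of different exponents are disjoint, so the double sum runs over a set of pairs;
  -- that set lies in a rectangle, where the sum factors.
  let u : Finset ((Fin n →₀ ℕ) × (Fin n →₀ ℕ)) :=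
    (s.sigma fun α => Finset.HasAntidiagonal.antidiagonal α).image Sigma.snd
  have hu : u ⊆ (u.image Prod.fst) ×ˢ (u.image Prod.snd) := Finset.subset_product
  have h2 : ∑ x ∈ s.sigma fun α => Finset.HasAntidiagonal.antidiagonal α,
      (|coeff x.2.1 c| * r ^ x.2.1.degree) * (|coeff x.2.2 d| * r ^ x.2.2.degree)
      = ∑ p ∈ u, (|coeff p.1 c| * r ^ p.1.degree) * (|coeff p.2 d| * r ^ p.2.degree) := by
    rw [Finset.sum_image]
    rintro ⟨α, p⟩ hp ⟨β, q⟩ hq (h : p = q)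
    subst h
    simp only [Finset.coe_sigma, Set.mem_sigma_iff, Finset.mem_coe,
      Finset.HasAntidiagonal.mem_antidiagonal] at hp hq
    rw [Sigma.mk.injEq]
    exact ⟨hp.2.symm.trans hq.2, HEq.rfl⟩
  rw [h2]
  refine (Finset.sum_le_sum_of_subset_of_nonneg hu fun _ _ _ => by positivity).trans ?_
  rw [Finset.sum_product]
  dsimp only
  rw [← Finset.sum_mul_sum]
  exact mul_le_mul (hc _) (hd _) (Finset.sum_nonneg fun _ _ => by positivity) hc.nonneg

theorem const (t : ℝ) : Maj r |t| (C t : PS n) := fun s => by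
  classical
  have : ∀ α ∈ s, |coeff α (C t : PS n)| * r ^ α.degree = if α = 0 then |t| else 0 := fun α _ => by
    rw [coeff_C]; split_ifs with h <;> simp [h]
  rw [Finset.sum_congr rfl this, Finset.sum_ite_eq']
  split_ifs <;> simp

theorem one : Maj r 1 (1 : PS n) := by
  simpa using const (n := n) (r := r) 1

theorem pow (hr : 0 ≤ r) (hc : Maj r M c) (k : ℕ) : Maj r (M ^ k) (c ^ k) := by
  induction k with
  | zero => simpa using one
  | succ k ih => rw [pow_succ, pow_succ]; exact ih.mul hr hc

theorem X (hr : 0 ≤ r) (i : Fin n) : Maj r r (X i : PS n) := fun s => by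
  classical
  have : ∀ α ∈ s, |coeff α (MvPowerSeries.X i : PS n)| * r ^ α.degree
      = if α = Finsupp.single i 1 then r else 0 := fun α _ => by
    rw [coeff_X]; split_ifs with h <;> simp [h]
  rw [Finset.sum_congr rfl this, Finset.sum_ite_eq']
  split_ifs <;> simp [hr]

theorem diag (hr : 0 ≤ r) {φ : ℕ → ℝ} {k : ℕ} {K : ℝ} (hφ : ∀ j, k ≤ j → |φ j| ≤ K)
    (ho : OrdGE k c) (hc : Maj r M c) : Maj r (K * M) (diag φ c) := fun s => by
  have hK : 0 ≤ K := (abs_nonneg _).trans (hφ k le_rfl)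
  refine (Finset.sum_le_sum (g := fun α => K * (|coeff α c| * r ^ α.degree)) fun α _ => ?_).trans ?_
  · rw [coeff_diag, abs_mul, mul_assoc]
    by_cases h : α.degree < k
    · simp [ho α h]
    · exact mul_le_mul_of_nonneg_right (hφ _ (not_lt.1 h)) (by positivity)
  · rw [← Finset.mul_sum]; exact mul_le_mul_of_nonneg_left (hc s) hK

/-- Every surviving term has degree at least k, and on shrinking the radius each term loses at least
k factors r / R. -/
theorem scale {R : ℝ} {k : ℕ} (hr : 0 ≤ r) (hR : 0 < R) (hrR : r ≤ R) (ho : OrdGE k c)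
    (hc : Maj R M c) : Maj r (M * (r / R) ^ k) c := fun s => by
  refine (Finset.sum_le_sum (g := fun α => (|coeff α c| * R ^ α.degree) * (r / R) ^ k)
    fun α _ => ?_).trans ?_
  · by_cases h : α.degree < k
    · simp [ho α h]
    · rw [mul_assoc]
      gcongr
      have h1 : r ^ α.degree = R ^ α.degree * (r / R) ^ α.degree := by
        rw [← mul_pow, mul_div_cancel₀ _ hR.ne']
      rw [h1]
      gcongr ?_ * ?_
      exact pow_le_pow_of_le_one (by positivity) ((div_le_one hR).2 hrR) (not_lt.1 h)
  · rw [← Finset.sum_mul]; exact mul_le_mul_of_nonneg_right (hc s) (by positivity)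

/-- Reindexing along `α ↦ α + eᵢ`. -/
theorem pderiv_of_le {r' N : ℝ} {i : Fin n} {d : PS n} (hd : Maj r' N d)
    (K : ℝ) (hK : 0 ≤ K)
    (h : ∀ α : Fin n →₀ ℕ, 0 < α i → |coeff α c| * α i * r ^ (α.degree - 1)
      ≤ K * (|coeff α d| * r' ^ α.degree)) :
    Maj r (K * N) (pderiv ℝ i c) := fun s => by
  classical
  have h1 : ∑ α ∈ s, |coeff α (pderiv ℝ i c)| * r ^ α.degree ≤
      ∑ α ∈ s.image (· + Finsupp.single i 1), K * (|coeff α d| * r' ^ α.degree) := by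
    rw [Finset.sum_image fun a _ b _ h => add_right_cancel h]
    refine Finset.sum_le_sum fun α _ => ?_
    refine le_trans (le_of_eq ?_) (h (α + Finsupp.single i 1) (by simp))
    rw [coeff_pderiv, abs_mul, map_add, Finsupp.degree_single, Nat.add_sub_cancel]
    simp only [Finsupp.add_apply, Finsupp.single_eq_same, Nat.cast_add, Nat.cast_one]
    rw [abs_of_nonneg (by positivity : (0 : ℝ) ≤ (α i : ℝ) + 1)]
  refine h1.trans ?_
  rw [← Finset.mul_sum]
  exact mul_le_mul_of_nonneg_left (hd _) hK

/-- A derivative estimate without loss of radius: differentiation costs a factor of the degree,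
which `diag φ` already contains when φ grows linearly. This is what makes the transport and eikonal
fixed points close up on a fixed polydisc. -/
theorem pderiv_of_diag (hr : 0 < r) {φ : ℕ → ℝ} {K : ℝ} {k : ℕ} (ho : OrdGE k c)
    (hφ : ∀ j, k ≤ j → (j : ℝ) ≤ K * |φ j|) (hK : 0 ≤ K) (i : Fin n)
    (hc : Maj r M (HadamardFS.diag φ c)) : Maj r (K / r * M) (pderiv ℝ i c) := by
  refine pderiv_of_le hc (K / r) (by positivity) fun α hα => ?_
  by_cases h : α.degree < k
  · simp [ho α h]
  · have h2 := hφ _ (not_lt.1 h)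
    have h3 : (α i : ℝ) ≤ α.degree := by exact_mod_cast Finsupp.le_degree i α
    have h4 : 1 ≤ α.degree := hα.trans_le (Finsupp.le_degree i α)
    rw [coeff_diag, abs_mul]
    have h5 : r ^ α.degree = r ^ (α.degree - 1) * r := by
      rw [← pow_succ, Nat.sub_add_cancel h4]
    rw [h5]
    calc |coeff α c| * α i * r ^ (α.degree - 1)
        ≤ |coeff α c| * (K * |φ α.degree|) * r ^ (α.degree - 1) := by
          gcongr; exact h3.trans h2
      _ = _ := by field_simp

/-- Cauchy's estimate. -/
theorem pderiv {r' : ℝ} (hr : 0 ≤ r) (hrr : r < r') (i : Fin n) (hc : Maj r' M c) :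
    Maj r ((r' - r)⁻¹ * M) (pderiv ℝ i c) := by
  have h0 : 0 < r' - r := sub_pos.2 hrr
  refine pderiv_of_le hc _ (by positivity) fun α hα => ?_
  have h3 : (α i : ℝ) ≤ α.degree := by exact_mod_cast Finsupp.le_degree i α
  have h4 : 1 ≤ α.degree := hα.trans_le (Finsupp.le_degree i α)
  obtain ⟨k, hk⟩ := Nat.exists_eq_add_of_le' h4
  rw [hk] at h3 ⊢
  rw [Nat.add_sub_cancel, ← div_eq_inv_mul, le_div_iff₀ h0]
  have := mul_pow_mul_sub_le hr hrr.le k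
  push_cast at h3
  calc |coeff α c| * α i * r ^ k * (r' - r)
      ≤ |coeff α c| * (k + 1) * r ^ k * (r' - r) := by gcongr
    _ = |coeff α c| * ((k + 1) * r ^ k * (r' - r)) := by ring
    _ ≤ _ := by gcongr

end Maj

namespace OrdGE

variable {k l : ℕ} {c d : PS n}

theorem mono (h : OrdGE k c) (hl : l ≤ k) : OrdGE l c := fun α hα => h α (hα.trans_le hl)

theorem zero_left (c : PS n) : OrdGE 0 c := fun _ h => absurd h (Nat.not_lt_zero _)

theorem zero : OrdGE k (0 : PS n) := fun _ _ => map_zero _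

theorem add (hc : OrdGE k c) (hd : OrdGE k d) : OrdGE k (c + d) := fun α h => by
  rw [map_add, hc α h, hd α h, add_zero]

theorem neg (hc : OrdGE k c) : OrdGE k (-c) := fun α h => by rw [map_neg, hc α h, neg_zero]

theorem sub (hc : OrdGE k c) (hd : OrdGE k d) : OrdGE k (c - d) := fun α h => by
  rw [map_sub, hc α h, hd α h, sub_zero]

theorem smul (t : ℝ) (hc : OrdGE k c) : OrdGE k (t • c) := fun α h => by
  rw [map_smul, hc α h, smul_zero]

theorem sum {ι : Type*} (s : Finset ι) {c : ι → PS n} (h : ∀ i ∈ s, OrdGE k (c i)) :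
    OrdGE k (∑ i ∈ s, c i) := fun α hα => by
  rw [map_sum]; exact Finset.sum_eq_zero fun i hi => h i hi α hα

theorem mul (hc : OrdGE k c) (hd : OrdGE l d) : OrdGE (k + l) (c * d) := fun α h => by
  classical
  rw [coeff_mul]
  refine Finset.sum_eq_zero fun p hp => ?_
  rw [Finset.HasAntidiagonal.mem_antidiagonal] at hp
  have : p.1.degree + p.2.degree = α.degree := by rw [← hp, map_add]
  rcases lt_or_ge p.1.degree k with h1 | h1
  · rw [hc _ h1, zero_mul]
  · rw [hd _ (by omega), mul_zero]

theorem mul_left (c : PS n) (hd : OrdGE l d) : OrdGE l (c * d) := by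
  simpa using (zero_left c).mul hd

theorem pow (hc : OrdGE k c) (j : ℕ) : OrdGE (j * k) (c ^ j) := by
  induction j with
  | zero => simpa using zero_left _
  | succ j ih => rw [pow_succ, Nat.succ_mul]; exact ih.mul hc

theorem pderiv (i : Fin n) (hc : OrdGE (k + 1) c) : OrdGE k (pderiv ℝ i c) := fun α h => by
  rw [coeff_pderiv, hc _ (by rw [map_add, Finsupp.degree_single]; omega), zero_mul]

theorem pderiv_sub_one (i : Fin n) (hc : OrdGE k c) : OrdGE (k - 1) (MvPowerSeries.pderiv ℝ i c) := by
  rcases k with _ | k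
  · exact zero_left _
  · exact hc.pderiv i

theorem diag (φ : ℕ → ℝ) (hc : OrdGE k c) : OrdGE k (diag φ c) := fun α h => by
  rw [coeff_diag, hc α h, mul_zero]

theorem X (i : Fin n) : OrdGE 1 (X i : PS n) := fun α h => by
  classical
  rw [coeff_X, if_neg]
  rintro rfl
  simp at h

theorem eq_zero (h : ∀ k, OrdGE k c) : c = 0 := by
  ext α; exact h (α.degree + 1) α (Nat.lt_succ_self _)

theorem one_iff : OrdGE 1 c ↔ constantCoeff c = 0 := by
  refine ⟨fun h => by simpa using h 0 (by simp), fun h α hα => ?_⟩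
  have : α = 0 := by rwa [Nat.lt_one_iff, Finsupp.degree_eq_zero_iff] at hα
  rw [this]; simpa using h

end OrdGE

/-- `c - C (c(0))` has no constant term. -/
theorem OrdGE.sub_const (c : PS n) : OrdGE 1 (c - C (constantCoeff c)) := by
  rw [OrdGE.one_iff]; simp

/-- The Euler operator `∑ zᵢ ∂ᵢ`. -/
def euler : PS n →ₗ[ℝ] PS n := diag fun k => (k : ℝ)

theorem euler_eq (c : PS n) : euler c = ∑ i, X i * pderiv ℝ i c := by
  classical
  ext α
  rw [euler, coeff_diag, map_sum, Finsupp.degree_eq_sum, Nat.cast_sum, Finset.sum_mul]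
  refine Finset.sum_congr rfl fun i _ => ?_
  by_cases h : Finsupp.single i 1 ≤ α
  · obtain ⟨β, rfl⟩ := exists_add_of_le h
    rw [X, coeff_add_monomial_mul, one_mul, coeff_pderiv, add_comm β]
    simp [mul_comm, add_comm]
  · have h0 : α i = 0 := by
      by_contra h1
      exact h (by rw [Finsupp.single_le_iff]; omega)
    rw [X, coeff_monomial_mul, if_neg h, h0]; simp

/-- A map which increases by one the degree up to which two series agree has a fixed point,
which inherits the majorants common to the iterates. -/
theorem exists_fixedPoint {k : ℕ} (Φ : PS n → PS n) (hk : ∀ g, OrdGE k g → OrdGE k (Φ g))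
    (hΦ : ∀ j g g', OrdGE k g → OrdGE k g' → OrdGE j (g - g') → OrdGE (j + 1) (Φ g - Φ g')) :
    ∃ g, OrdGE k g ∧ Φ g = g ∧
      ∀ r M, 0 ≤ M → (∀ g, OrdGE k g → Maj r M g → Maj r M (Φ g)) → Maj r M g := by
  let it : ℕ → PS n := fun j => Φ^[j] 0
  have hit : ∀ j, it (j + 1) = Φ (it j) := fun j => Function.iterate_succ_apply' _ _ _
  have hko : ∀ j, OrdGE k (it j) := fun j => by
    induction j with
    | zero => exact OrdGE.zero
    | succ j ih => rw [hit]; exact hk _ ih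
  have h1 : ∀ j, OrdGE j (it (j + 1) - it j) := fun j => by
    induction j with
    | zero => exact OrdGE.zero_left _
    | succ j ih => rw [hit (j + 1), hit j]; exact hΦ _ _ _ (hit j ▸ hko (j + 1)) (hko j) (hit j ▸ ih)
  have h2 : ∀ j l, OrdGE j (it (j + l) - it j) := fun j l => by
    induction l with
    | zero => simpa using OrdGE.zero
    | succ l ih =>
      have := ((h1 (j + l)).mono (Nat.le_add_right j l)).add ih
      simpa [add_assoc] using this
  -- From step j on the iterates agree in degrees below j, so the coefficient at α is stationary
  -- from step |α| + 1 on.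
  let g : PS n := fun α => coeff α (it (α.degree + 1))
  have hg : ∀ j, OrdGE j (g - it j) := fun j α hα => by
    obtain ⟨l, rfl⟩ := Nat.exists_eq_add_of_le (Nat.succ_le_of_lt hα)
    have := h2 (α.degree + 1) l α (Nat.lt_succ_self _)
    rw [map_sub, sub_eq_zero] at this ⊢
    exact this.symm
  have hgk : OrdGE k g := by
    have := (hg k).add (hko k); simpa using this
  refine ⟨g, hgk, ?_, fun r M hM hMaj => ?_⟩
  · rw [← sub_eq_zero]
    refine OrdGE.eq_zero fun j => ?_
    have e1 := hΦ j g (it j) hgk (hko j) (hg j)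
    have e2 := hg (j + 1)
    rw [hit] at e2
    have := (e1.sub e2).mono (Nat.le_succ j)
    simpa using this
  · have hm : ∀ j, Maj r M (it j) := fun j => by
      induction j with
      | zero => exact Maj.zero.mono hM
      | succ j ih => rw [hit]; exact hMaj _ (hko j) ih
    -- A finite set of coefficients of the limit coincides with that of a sufficiently late iterate.
    intro s
    have := hm (s.sup Finsupp.degree + 1) s
    refine le_trans (le_of_eq (Finset.sum_congr rfl fun α hα => ?_)) this
    have h3 := hg (s.sup Finsupp.degree + 1) α (Nat.lt_succ_of_le (Finset.le_sup hα))
    rw [map_sub, sub_eq_zero] at h3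
    rw [h3]

/-- The sum of a family of series whose `l`-th member has order at least `l`. -/
def fsum (u : ℕ → PS n) : PS n := fun α => ∑ l ∈ Finset.range (α.degree + 1), coeff α (u l)

theorem coeff_fsum (u : ℕ → PS n) (α : Fin n →₀ ℕ) :
    coeff α (fsum u) = ∑ l ∈ Finset.range (α.degree + 1), coeff α (u l) := rfl

theorem fsum_sub_range {u : ℕ → PS n} (hu : ∀ l, OrdGE l (u l)) (L : ℕ) :
    OrdGE L (fsum u - ∑ l ∈ Finset.range L, u l) := fun α hα => by
  rw [map_sub, coeff_fsum, map_sum, sub_eq_zero]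
  refine Finset.sum_subset (fun l => by simp only [Finset.mem_range]; omega) fun l _ hl => ?_
  exact hu l α (by simpa using hl)

theorem Maj.fsum {r : ℝ} (hr : 0 ≤ r) {u : ℕ → PS n} {M : ℕ → ℝ} (hu : ∀ l, Maj r (M l) (u l))
    (hM : Summable M) : Maj r (∑' l, M l) (fsum u) := fun s => by
  have h1 : ∀ α ∈ s, |coeff α (HadamardFS.fsum u)| * r ^ α.degree ≤
      ∑ l ∈ Finset.range (s.sup Finsupp.degree + 1), |coeff α (u l)| * r ^ α.degree := fun α hα => by
    rw [coeff_fsum, ← Finset.sum_mul]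
    gcongr
    refine (Finset.abs_sum_le_sum_abs _ _).trans (Finset.sum_le_sum_of_subset_of_nonneg
      (fun l => ?_) fun _ _ _ => abs_nonneg _)
    have := Finset.le_sup (f := Finsupp.degree) hα
    simp only [Finset.mem_range]; omega
  refine (Finset.sum_le_sum h1).trans ?_
  rw [Finset.sum_comm]
  exact (Finset.sum_le_sum fun l _ => hu l s).trans (hM.sum_le_tsum _ fun l _ => (hu l).nonneg)

/-! ### Sums of power series: values, analyticity, derivatives -/

/-- The monomial `z ^ α`. -/
def mon (α : Fin n →₀ ℕ) (z : Fin n → ℝ) : ℝ := ∏ i, z i ^ α i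

theorem mon_add (α β : Fin n →₀ ℕ) (z : Fin n → ℝ) : mon (α + β) z = mon α z * mon β z := by
  simp [mon, pow_add, Finset.prod_mul_distrib]

theorem mon_single (i : Fin n) (z : Fin n → ℝ) : mon (Finsupp.single i 1) z = z i := by
  classical
  simp [mon, Finsupp.single_apply, Finset.prod_ite_eq]

theorem abs_mon_le (α : Fin n →₀ ℕ) {z : Fin n → ℝ} {r : ℝ} (hz : ‖z‖ ≤ r) :
    |mon α z| ≤ r ^ α.degree := by
  rw [mon, Finset.abs_prod, Finsupp.degree_eq_sum, ← Finset.prod_pow_eq_pow_sum]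
  refine Finset.prod_le_prod (fun _ _ => abs_nonneg _) fun i _ => ?_
  rw [abs_pow]
  exact pow_le_pow_left₀ (abs_nonneg _) ((norm_le_pi_norm z i).trans hz) _

/-- The sum of the power series `c` at `z`. -/
def ev (c : PS n) (z : Fin n → ℝ) : ℝ := ∑' α, coeff α c * mon α z

theorem Maj.summable_abs {r M : ℝ} {c : PS n} (hc : Maj r M c) {z : Fin n → ℝ} (hz : ‖z‖ ≤ r) :
    Summable fun α => |coeff α c * mon α z| := by
  refine Summable.of_nonneg_of_le (fun _ => abs_nonneg _) (fun α => ?_)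
    (hc.summable ((norm_nonneg z).trans hz))
  rw [abs_mul]
  exact mul_le_mul_of_nonneg_left (abs_mon_le α hz) (abs_nonneg _)

theorem Maj.hasSum {r M : ℝ} {c : PS n} (hc : Maj r M c) {z : Fin n → ℝ} (hz : ‖z‖ ≤ r) :
    HasSum (fun α => coeff α c * mon α z) (ev c z) :=
  (hc.summable_abs hz).of_abs.hasSum

theorem Maj.abs_ev_le {r M : ℝ} {c : PS n} (hc : Maj r M c) {z : Fin n → ℝ} (hz : ‖z‖ ≤ r) :
    |ev c z| ≤ M := by
  refine le_of_tendsto (hc.hasSum hz).abs (Eventually.of_forall fun s => ?_)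
  refine (Finset.abs_sum_le_sum_abs _ _).trans (le_trans (Finset.sum_le_sum fun α _ => ?_) (hc s))
  rw [abs_mul]
  exact mul_le_mul_of_nonneg_left (abs_mon_le α hz) (abs_nonneg _)

theorem ev_add {r M M' : ℝ} {c d : PS n} (hc : Maj r M c) (hd : Maj r M' d) {z : Fin n → ℝ}
    (hz : ‖z‖ ≤ r) : ev (c + d) z = ev c z + ev d z := by
  rw [← ((hc.hasSum hz).add (hd.hasSum hz)).tsum_eq, ev]
  exact tsum_congr fun α => by rw [map_add, add_mul]

theorem ev_smul (t : ℝ) (c : PS n) (z : Fin n → ℝ) : ev (t • c) z = t * ev c z := by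
  rw [ev, ev, ← tsum_mul_left]
  exact tsum_congr fun α => by rw [map_smul, smul_eq_mul, mul_assoc]

theorem ev_neg (c : PS n) (z : Fin n → ℝ) : ev (-c) z = -ev c z := by
  simpa using ev_smul (-1) c z

theorem ev_zero (z : Fin n → ℝ) : ev (0 : PS n) z = 0 := by simp [ev]

theorem ev_C (t : ℝ) (z : Fin n → ℝ) : ev (C t : PS n) z = t := by
  classical
  rw [ev, tsum_eq_single 0]
  · simp [mon]
  · intro α hα; rw [coeff_C, if_neg hα, zero_mul]

theorem ev_at_zero (c : PS n) : ev c 0 = constantCoeff c := by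
  rw [ev, tsum_eq_single 0]
  · simp [mon]
  · intro α hα
    obtain ⟨i, hi⟩ := Finsupp.ne_iff.1 hα
    rw [mon, Finset.prod_eq_zero (Finset.mem_univ i), mul_zero]
    simpa using hi

theorem ev_mul {r M M' : ℝ} {c d : PS n} (hc : Maj r M c) (hd : Maj r M' d) {z : Fin n → ℝ}
    (hz : ‖z‖ ≤ r) : ev (c * d) z = ev c z * ev d z := by
  have h1 : Summable fun α => ‖coeff α c * mon α z‖ := hc.summable_abs hz
  have h2 : Summable fun α => ‖coeff α d * mon α z‖ := hd.summable_abs hz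
  have h3 := summable_mul_of_summable_norm h1 h2
  have h4 := Summable.tsum_mul_tsum_eq_tsum_sum_antidiagonal h1.of_norm h2.of_norm h3
  unfold ev
  rw [h4]
  refine tsum_congr fun α => ?_
  rw [coeff_mul, Finset.sum_mul]
  refine Finset.sum_congr rfl fun p hp => ?_
  rw [← Finset.HasAntidiagonal.mem_antidiagonal.1 hp, mon_add]; ring

/-- The monomial of exponent `α`, as a multilinear form in `|α|` variables. -/
def monForm (α : Fin n →₀ ℕ) (k : ℕ) (h : (Finsupp.toMultiset α).toList.length = k) :
    ContinuousMultilinearMap ℝ (fun _ : Fin k => Fin n → ℝ) ℝ :=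
  (ContinuousMultilinearMap.mkPiAlgebraFin ℝ k ℝ).compContinuousLinearMap
    fun j => ContinuousLinearMap.proj ((Finsupp.toMultiset α).toList.get (j.cast h.symm))

theorem norm_monForm_le (α : Fin n →₀ ℕ) (k : ℕ) (h) : ‖monForm α k h‖ ≤ 1 := by
  refine ContinuousMultilinearMap.opNorm_le_bound zero_le_one fun v => ?_
  rw [monForm, ContinuousMultilinearMap.compContinuousLinearMap_apply,
    ContinuousMultilinearMap.mkPiAlgebraFin_apply, List.prod_ofFn, norm_prod, one_mul]
  exact Finset.prod_le_prod (fun _ _ => norm_nonneg _) fun j _ =>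
    norm_le_pi_norm (v j) _

theorem monForm_apply (α : Fin n →₀ ℕ) (k : ℕ) (h) (z : Fin n → ℝ) :
    monForm α k h (fun _ => z) = mon α z := by
  subst h
  rw [monForm, ContinuousMultilinearMap.compContinuousLinearMap_apply,
    ContinuousMultilinearMap.mkPiAlgebraFin_apply]
  have h1 : (List.ofFn fun j => (ContinuousLinearMap.proj (R := ℝ) (φ := fun _ : Fin n => ℝ)
      ((Finsupp.toMultiset α).toList.get (j.cast rfl))) z)
      = (Finsupp.toMultiset α).toList.map z := by
    rw [← List.ofFn_get (List.map z _)]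
    apply List.ext_get <;> simp
  rw [h1, ← Multiset.prod_coe, ← Multiset.map_coe, Multiset.coe_toList, Finsupp.toMultiset_map,
    Finsupp.prod_toMultiset, Finsupp.prod_mapDomain_index (by simp) (by simp [pow_add]), mon,
    Finsupp.prod_fintype _ _ (by simp)]

theorem length_toList (α : Fin n →₀ ℕ) : (Finsupp.toMultiset α).toList.length = α.degree := by
  rw [Multiset.length_toList, Finsupp.card_toMultiset, Finsupp.degree, Finsupp.sum]
  rfl

open Classical in
/-- The Taylor series at the origin of the sum of `c`. -/
def taylor (c : PS n) : FormalMultilinearSeries ℝ (Fin n → ℝ) ℝ := fun k =>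
  ∑ α ∈ (Finsupp.finite_of_degree_eq (σ := Fin n) k).toFinset,
    coeff α c • (if h : _ then monForm α k h else 0)

/-- Grouping the absolutely convergent sum by degree produces a power series of multilinear forms.
It is the source of the differentiability and analyticity of `ev c`. -/
theorem Maj.hasFPowerSeries {r M : ℝ} {c : PS n} (hr : 0 < r) (hc : Maj r M c) :
    HasFPowerSeriesOnBall (ev c) (taylor c) 0 (ENNReal.ofReal r) := by
  have hsum : ∀ {z : Fin n → ℝ} {k : ℕ}, taylor c k (fun _ => z) =
      ∑ α ∈ (Finsupp.finite_of_degree_eq (σ := Fin n) k).toFinset, coeff α c * mon α z := by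
    intro z k
    rw [taylor, sum_apply]
    refine Finset.sum_congr rfl fun α hα => ?_
    have hk : α.degree = k := by simpa using hα
    rw [dif_pos ((length_toList α).trans hk), smul_apply,
      monForm_apply, smul_eq_mul]
  refine ⟨?_, by simpa using hr, fun {y} hy => ?_⟩
  · refine FormalMultilinearSeries.le_radius_of_bound _ M fun k => ?_
    rw [Real.coe_toNNReal _ hr.le]
    refine le_trans ?_ (hc (Finsupp.finite_of_degree_eq (σ := Fin n) k).toFinset)
    rw [taylor]
    refine (mul_le_mul_of_nonneg_right (norm_sum_le _ _) (by positivity)).trans ?_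
    rw [Finset.sum_mul]
    refine Finset.sum_le_sum fun α hα => ?_
    have hk : α.degree = k := by simpa using hα
    subst hk
    rw [dif_pos (length_toList α), norm_smul, Real.norm_eq_abs]
    gcongr
    exact mul_le_of_le_one_right (abs_nonneg _) (norm_monForm_le _ _ _)
  · rw [zero_add]
    have hy' : ‖y‖ ≤ r := by
      rw [Metric.eball_ofReal, mem_ball_zero_iff] at hy
      exact hy.le
    have := (hc.hasSum hy').tsum_fiberwise (fun α => Finsupp.degree α)
    refine (congrArg (fun F : ℕ → ℝ => HasSum F (ev c y)) (funext fun k => ?_)).mp this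
    rw [hsum, ← Finset.tsum_subtype']
    have : (fun α : Fin n →₀ ℕ => α.degree) ⁻¹' {k}
        = ((Finsupp.finite_of_degree_eq (σ := Fin n) k).toFinset : Set (Fin n →₀ ℕ)) := by
      ext α; simp
    rw [this]

theorem hasDerivAt_mon (α : Fin n →₀ ℕ) (i : Fin n) (z : Fin n → ℝ) (t : ℝ) :
    HasDerivAt (fun t : ℝ => mon α (z + t • Pi.single i 1))
      (α i * mon (α - Finsupp.single i 1) (z + t • Pi.single i 1)) t := by
  classical
  have h1 : ∀ (β : Fin n →₀ ℕ) (t : ℝ), mon β (z + t • Pi.single i 1)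
      = (z i + t) ^ β i * ∏ j ∈ Finset.univ.erase i, z j ^ β j := fun β t => by
    rw [mon, ← Finset.mul_prod_erase _ _ (Finset.mem_univ i)]
    congr 1
    · simp
    · refine Finset.prod_congr rfl fun j hj => ?_
      simp [Pi.single_eq_of_ne (Finset.ne_of_mem_erase hj)]
  simp only [h1]
  have h2 : ∏ j ∈ Finset.univ.erase i, z j ^ ((α - Finsupp.single i 1 : Fin n →₀ ℕ) j)
      = ∏ j ∈ Finset.univ.erase i, z j ^ α j := Finset.prod_congr rfl fun j hj => by
    simp [(Finset.ne_of_mem_erase hj).symm]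
  rw [h2]
  have h3 := (((hasDerivAt_id t).const_add (z i)).pow (α i)).mul_const
    (∏ j ∈ Finset.univ.erase i, z j ^ α j)
  refine h3.congr_deriv ?_
  simp; ring

/-- Termwise differentiation along the line z + t eᵢ. An intermediate radius R' leaves room for
Cauchy's bound to dominate the differentiated terms; terms with αᵢ = 0 drop out, which allows the
shift of index by eᵢ. -/
theorem Maj.pd_ev {R M : ℝ} {c : PS n} (hc : Maj R M c) {z : Fin n → ℝ} (hz : ‖z‖ < R)
    (i : Fin n) : pd i (ev c) z = ev (MvPowerSeries.pderiv ℝ i c) z := by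
  classical
  have hR : 0 < R := (norm_nonneg z).trans_lt hz
  obtain ⟨R', hzR, hR'⟩ := exists_between hz
  have hR0 : 0 < R' := (norm_nonneg z).trans_lt hzR
  have hd : DifferentiableAt ℝ (ev c) z :=
    ((hc.hasFPowerSeries hR).analyticAt_of_mem (by
      rw [Metric.eball_ofReal, mem_ball_zero_iff]; exact hz)).differentiableAt
  have hA : HasDerivAt (fun t : ℝ => ev c (z + t • Pi.single i 1)) (pd i (ev c) z) 0 :=
    hd.hasFDerivAt.hasLineDerivAt _
  let T : Set ℝ := Ioo (-(R' - ‖z‖)) (R' - ‖z‖)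
  have h0T : (0 : ℝ) ∈ T := by constructor <;> linarith
  have hT : ∀ t ∈ T, ‖z + t • (Pi.single i 1 : Fin n → ℝ)‖ ≤ R' := fun t ht => by
    refine (norm_add_le _ _).trans ?_
    rw [norm_smul, Pi.norm_single, norm_one, mul_one, Real.norm_eq_abs]
    have := abs_lt.2 ht; linarith
  have hB := hasDerivAt_tsum_of_isPreconnected
    (u := fun α => (R - R')⁻¹ * (|coeff α c| * R ^ α.degree))
    (g := fun α (t : ℝ) => coeff α c * mon α (z + t • Pi.single i 1))
    (g' := fun α (t : ℝ) => coeff α c *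
      (α i * mon (α - Finsupp.single i 1) (z + t • Pi.single i 1)))
    (y₀ := 0) (y := 0) ((hc.summable hR.le).mul_left _) isOpen_Ioo isPreconnected_Ioo
    (fun α t _ => (hasDerivAt_mon α i z t).const_mul _) (fun α t ht => ?_) h0T
    (by simpa using (hc.hasSum hz.le).summable) h0T
  · rw [hA.unique hB, ev]
    have h1 := Function.Injective.tsum_eq
      (f := fun α => coeff α c * (α i * mon (α - Finsupp.single i 1) z))
      (add_left_injective (Finsupp.single i 1)) (fun α hα => ?_)
    · simp only [zero_smul, add_zero]
      rw [← h1]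
      refine tsum_congr fun β => ?_
      rw [coeff_pderiv, add_tsub_cancel_right]
      simp; ring
    · have : α i ≠ 0 := by
        rintro h; simp [h] at hα
      refine ⟨α - Finsupp.single i 1, tsub_add_cancel_of_le ?_⟩
      rw [Finsupp.single_le_iff]; omega
  · rcases Nat.eq_zero_or_pos (α i) with h | h
    · simp only [h, Nat.cast_zero, zero_mul, mul_zero, norm_zero]
      have := sub_pos.2 hR'
      positivity
    · have h3 : (α i : ℝ) ≤ α.degree := by exact_mod_cast Finsupp.le_degree i α
      obtain ⟨k, hk⟩ := Nat.exists_eq_add_of_le' (h.trans_le (Finsupp.le_degree i α))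
      have h5 : (α - Finsupp.single i 1).degree = k := by
        have e : α - Finsupp.single i 1 + Finsupp.single i 1 = α :=
          tsub_add_cancel_of_le (by rw [Finsupp.single_le_iff]; omega)
        have := congrArg Finsupp.degree e
        rw [map_add, Finsupp.degree_single] at this; omega
      have h4 := abs_mon_le (α - Finsupp.single i 1) (hT t ht)
      rw [h5] at h4
      rw [hk] at h3 ⊢
      push_cast at h3
      rw [Real.norm_eq_abs, abs_mul, abs_mul, Nat.abs_cast, ← div_eq_inv_mul,
        le_div_iff₀ (sub_pos.2 hR')]
      have h6 := sub_pos.2 hR'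
      calc |coeff α c| * (α i * |mon (α - Finsupp.single i 1) (z + t • Pi.single i 1)|) * (R - R')
          ≤ |coeff α c| * ((k + 1) * R' ^ k) * (R - R') := by gcongr
        _ = |coeff α c| * ((k + 1) * R' ^ k * (R - R')) := by ring
        _ ≤ _ := by gcongr; exact mul_pow_mul_sub_le hR0.le hR'.le k

/-! ### Convergent series centred at ξ and analytic germs -/

/-- `c` converges on the open polydisc of radius `ρ`. -/
def Conv (ρ : ℝ) (c : PS n) : Prop := ∀ r, 0 ≤ r → r < ρ → ∃ M, Maj r M c

/-- The sum of the series `c` in powers of `x - ξ`. -/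
def fn (ξ : Fin n → ℝ) (c : PS n) (x : Fin n → ℝ) : ℝ := ev c (x - ξ)

namespace Conv

variable {ρ : ℝ} {c d : PS n}

theorem of_maj {M : ℝ} (hc : Maj ρ M c) : Conv ρ c := fun _ h0 h => ⟨M, hc.of_le h0 h.le⟩

theorem mono {ρ' : ℝ} (hc : Conv ρ c) (h : ρ' ≤ ρ) : Conv ρ' c :=
  fun r h0 hr => hc r h0 (hr.trans_le h)

theorem zero : Conv ρ (0 : PS n) := fun _ _ _ => ⟨0, Maj.zero⟩

theorem const (t : ℝ) : Conv ρ (C t : PS n) := fun _ _ _ => ⟨_, Maj.const t⟩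

theorem X (i : Fin n) : Conv ρ (X i : PS n) := fun _ h _ => ⟨_, Maj.X h i⟩

theorem add (hc : Conv ρ c) (hd : Conv ρ d) : Conv ρ (c + d) := fun r h0 h => by
  obtain ⟨M, hM⟩ := hc r h0 h
  obtain ⟨M', hM'⟩ := hd r h0 h
  exact ⟨_, hM.add h0 hM'⟩

theorem neg (hc : Conv ρ c) : Conv ρ (-c) := fun r h0 h => (hc r h0 h).imp fun _ h => h.neg

theorem sub (hc : Conv ρ c) (hd : Conv ρ d) : Conv ρ (c - d) := by
  rw [sub_eq_add_neg]; exact hc.add hd.neg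

theorem smul (t : ℝ) (hc : Conv ρ c) : Conv ρ (t • c) := fun r h0 h => by
  obtain ⟨M, hM⟩ := hc r h0 h
  exact ⟨_, hM.smul t⟩

theorem mul (hc : Conv ρ c) (hd : Conv ρ d) : Conv ρ (c * d) := fun r h0 h => by
  obtain ⟨M, hM⟩ := hc r h0 h
  obtain ⟨M', hM'⟩ := hd r h0 h
  exact ⟨_, hM.mul h0 hM'⟩

theorem pow (hc : Conv ρ c) (k : ℕ) : Conv ρ (c ^ k) := fun r h0 h => by
  obtain ⟨M, hM⟩ := hc r h0 h
  exact ⟨_, hM.pow h0 k⟩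

theorem sum {ι : Type*} (s : Finset ι) {c : ι → PS n} (h : ∀ i ∈ s, Conv ρ (c i)) :
    Conv ρ (∑ i ∈ s, c i) := by
  classical
  induction s using Finset.induction_on with
  | empty => simpa using zero
  | insert i s hi ih =>
    rw [Finset.sum_insert hi]
    exact (h i (by simp)).add (ih fun j hj => h j (by simp [hj]))

theorem pderiv (hc : Conv ρ c) (i : Fin n) : Conv ρ (pderiv ℝ i c) := fun r h0 h => by
  obtain ⟨r', h1, h2⟩ := exists_between h
  obtain ⟨M, hM⟩ := hc r' (h0.trans h1.le) h2
  exact ⟨_, hM.pderiv h0 h1 i⟩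

variable {ξ x : Fin n → ℝ}

theorem maj_at (hc : Conv ρ c) (hx : x ∈ ball ξ ρ) : ∃ M, Maj ‖x - ξ‖ M c :=
  hc _ (norm_nonneg _) (by rwa [mem_ball_iff_norm] at hx)

theorem fn_add (hc : Conv ρ c) (hd : Conv ρ d) (hx : x ∈ ball ξ ρ) :
    fn ξ (c + d) x = fn ξ c x + fn ξ d x := by
  obtain ⟨M, hM⟩ := hc.maj_at hx
  obtain ⟨M', hM'⟩ := hd.maj_at hx
  exact ev_add hM hM' le_rfl

theorem fn_mul (hc : Conv ρ c) (hd : Conv ρ d) (hx : x ∈ ball ξ ρ) :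
    fn ξ (c * d) x = fn ξ c x * fn ξ d x := by
  obtain ⟨M, hM⟩ := hc.maj_at hx
  obtain ⟨M', hM'⟩ := hd.maj_at hx
  exact ev_mul hM hM' le_rfl

theorem fn_sub (hc : Conv ρ c) (hd : Conv ρ d) (hx : x ∈ ball ξ ρ) :
    fn ξ (c - d) x = fn ξ c x - fn ξ d x := by
  rw [sub_eq_add_neg, hc.fn_add hd.neg hx, sub_eq_add_neg]
  exact congrArg _ (ev_neg _ _)

theorem fn_pow (hc : Conv ρ c) (k : ℕ) (hx : x ∈ ball ξ ρ) : fn ξ (c ^ k) x = fn ξ c x ^ k := by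
  induction k with
  | zero =>
    rw [pow_zero, pow_zero, ← map_one (C (σ := Fin n) (R := ℝ))]; exact ev_C _ _
  | succ k ih => rw [pow_succ, pow_succ, (hc.pow k).fn_mul hc hx, ih]

theorem fn_sum {ι : Type*} (s : Finset ι) {c : ι → PS n} (h : ∀ i ∈ s, Conv ρ (c i))
    (hx : x ∈ ball ξ ρ) : fn ξ (∑ i ∈ s, c i) x = ∑ i ∈ s, fn ξ (c i) x := by
  classical
  induction s using Finset.induction_on with
  | empty => simp [fn, ev_zero]
  | insert i s hi ih =>
    rw [Finset.sum_insert hi, Finset.sum_insert hi, fn_add (h i (by simp))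
      (sum s fun j hj => h j (by simp [hj])) hx, ih fun j hj => h j (by simp [hj])]

theorem analyticOnNhd (hc : Conv ρ c) (ξ : Fin n → ℝ) : AnalyticOnNhd ℝ (fn ξ c) (ball ξ ρ) :=
  fun x hx => by
    rw [mem_ball_iff_norm] at hx
    obtain ⟨r, h1, h2⟩ := exists_between hx
    have h0 := (norm_nonneg _).trans_lt h1
    obtain ⟨M, hM⟩ := hc r h0.le h2
    have h3 : AnalyticAt ℝ (ev c) (x - ξ) := (hM.hasFPowerSeries h0).analyticAt_of_mem (by
      rw [Metric.eball_ofReal, mem_ball_zero_iff]; exact h1)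
    exact h3.comp (f := fun x => x - ξ) (by fun_prop)

theorem pd_fn (hc : Conv ρ c) (i : Fin n) (hx : x ∈ ball ξ ρ) :
    pd i (fn ξ c) x = fn ξ (MvPowerSeries.pderiv ℝ i c) x := by
  rw [mem_ball_iff_norm] at hx
  obtain ⟨r, h1, h2⟩ := exists_between hx
  have h0 := (norm_nonneg _).trans_lt h1
  obtain ⟨M, hM⟩ := hc r h0.le h2
  rw [fn, ← hM.pd_ev h1 i, pd, pd]
  congr 1
  exact fderiv_comp_sub ξ

end Conv

theorem fn_smul (ξ : Fin n → ℝ) (t : ℝ) (c : PS n) (x : Fin n → ℝ) :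
    fn ξ (t • c) x = t * fn ξ c x := ev_smul _ _ _

theorem fn_zero (ξ x : Fin n → ℝ) : fn ξ (0 : PS n) x = 0 := ev_zero _

theorem fn_C (ξ : Fin n → ℝ) (t : ℝ) (x : Fin n → ℝ) : fn ξ (C t) x = t := ev_C _ _

theorem fn_self (ξ : Fin n → ℝ) (c : PS n) : fn ξ c ξ = constantCoeff c := by
  rw [fn, sub_self, ev_at_zero]

theorem pd_congr {G : Type*} [NormedAddCommGroup G] [NormedSpace ℝ G]
    {f g : (Fin n → ℝ) → G} {x : Fin n → ℝ} (h : f =ᶠ[𝓝 x] g) (i : Fin n) : pd i f x = pd i g x := by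
  rw [pd, pd, h.fderiv_eq]

/-- A convergent series whose sum vanishes near the centre is zero. -/
theorem Conv.eq_zero {ρ : ℝ} (hρ : 0 < ρ) {c : PS n} (hc : Conv ρ c) {ξ : Fin n → ℝ}
    (h : ∀ᶠ x in 𝓝 ξ, fn ξ c x = 0) : c = 0 := by
  suffices H : ∀ k (c : PS n), Conv ρ c → (∀ᶠ x in 𝓝 ξ, fn ξ c x = 0) → ∀ α : Fin n →₀ ℕ,
      α.degree = k → coeff α c = 0 by
    ext α; exact H _ c hc h α rfl
  intro k
  induction k with
  | zero =>
    intro c hc h α hα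
    rw [Finsupp.degree_eq_zero_iff] at hα
    rw [hα, coeff_zero_eq_constantCoeff_apply, ← fn_self ξ, h.self_of_nhds]
  | succ k ih =>
    intro c hc h α hα
    obtain ⟨i, hi⟩ : ∃ i, α i ≠ 0 := by
      by_contra! h0
      rw [Finsupp.degree_eq_sum] at hα
      simp [h0] at hα
    have e : α - Finsupp.single i 1 + Finsupp.single i 1 = α :=
      tsub_add_cancel_of_le (by rw [Finsupp.single_le_iff]; omega)
    have hd : (α - Finsupp.single i 1).degree = k := by
      have := congrArg Finsupp.degree e
      rw [map_add, Finsupp.degree_single] at this; omega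
    have h1 : ∀ᶠ x in 𝓝 ξ, fn ξ (MvPowerSeries.pderiv ℝ i c) x = 0 := by
      filter_upwards [h.eventually_nhds, ball_mem_nhds ξ hρ] with x hx hxρ
      rw [← hc.pd_fn i hxρ, pd_congr (g := fun _ => 0) hx, pd]; simp
    have := ih _ (hc.pderiv i) h1 _ hd
    rw [coeff_pderiv, e] at this
    exact (mul_eq_zero.1 this).resolve_right (by positivity)

/-- The exponent of the monomial `∏ z_{w j}`. -/
def content (w : Σ k, Fin k → Fin n) : Fin n →₀ ℕ := ∑ j, Finsupp.single (w.2 j) 1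

theorem degree_content (w : Σ k, Fin k → Fin n) : (content w).degree = w.1 := by
  rw [content, map_sum]
  simp [Finsupp.degree_single]

theorem mon_content (w : Σ k, Fin k → Fin n) (z : Fin n → ℝ) :
    mon (content w) z = ∏ j, z (w.2 j) := by
  classical
  have : ∀ s : Finset (Fin w.1), mon (∑ j ∈ s, Finsupp.single (w.2 j) 1) z = ∏ j ∈ s, z (w.2 j) := by
    intro s
    induction s using Finset.induction_on with
    | empty => simp [mon]
    | insert i s hi ih => rw [Finset.sum_insert hi, mon_add, mon_single, ih, Finset.prod_insert hi]
  exact this Finset.univ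

/-- A function analytic at `ξ` is near `ξ` the sum of a convergent power series. -/
theorem exists_conv_of_analyticAt {f : (Fin n → ℝ) → ℝ} {ξ : Fin n → ℝ} (hf : AnalyticAt ℝ f ξ) :
    ∃ ρ > 0, ∃ c : PS n, Conv ρ c ∧ ∀ x ∈ ball ξ ρ, f x = fn ξ c x := by
  classical
  obtain ⟨p, ρ₀, hp⟩ := hf
  obtain ⟨r, hr0, hr⟩ := ENNReal.lt_iff_exists_nnreal_btwn.1 hp.r_pos
  have hr0' : (0 : ℝ) < r := by exact_mod_cast hr0
  obtain ⟨C₀, hC₀, hC⟩ := p.norm_mul_pow_le_of_lt_radius (hr.trans_le hp.r_le)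
  -- There are n^k words of length k in the basis vectors; the factor n + 1 absorbs their number and
  -- the factor 2 leaves a geometric series.
  set ρ : ℝ := r / (2 * (n + 1)) with hρ
  have hρ0 : 0 < ρ := by positivity
  let A : (Σ k, Fin k → Fin n) → ℝ := fun w => p w.1 fun j => Pi.single (w.2 j) 1
  have hA : ∀ w, |A w| ≤ ‖p w.1‖ := fun w => by
    refine ((p w.1).le_opNorm _).trans (le_of_eq ?_)
    simp [Pi.norm_single]
  have hS : Summable fun w => |A w| * ρ ^ w.1 := by
    rw [summable_sigma_of_nonneg fun w => by positivity]
    refine ⟨fun k => Summable.of_finite, ?_⟩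
    refine Summable.of_nonneg_of_le (fun k => tsum_nonneg fun w => by positivity) (fun k => ?_)
      (summable_geometric_two.mul_left C₀)
    rw [tsum_fintype]
    refine (Finset.sum_le_sum (g := fun _ => ‖p k‖ * ρ ^ k) fun w _ => ?_).trans ?_
    · exact mul_le_mul_of_nonneg_right (hA ⟨k, w⟩) (by positivity)
    · rw [Finset.sum_const, Finset.card_univ, Fintype.card_fun, Fintype.card_fin, Fintype.card_fin,
        nsmul_eq_mul]
      push_cast
      have e1 : (n : ℝ) ^ k * (‖p k‖ * ρ ^ k)
          = ((n : ℝ) / (n + 1)) ^ k * (‖p k‖ * r ^ k * (1 / 2) ^ k) := by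
        rw [hρ, div_pow, div_pow, div_pow, mul_pow, one_pow]; field_simp
      have e2 : ((n : ℝ) / (n + 1)) ^ k ≤ 1 :=
        pow_le_one₀ (by positivity) (div_le_one_of_le₀ (by linarith) (by positivity))
      rw [e1]
      refine (mul_le_of_le_one_left (by positivity) e2).trans ?_
      gcongr
      exact hC k
  have hsum : ∀ z : Fin n → ℝ, ‖z‖ < ρ → HasSum (fun w => A w * mon (content w) z) (f (ξ + z)) := by
    intro z hz
    have hs : Summable fun w => A w * mon (content w) z := by
      refine Summable.of_norm_bounded hS fun w => ?_
      rw [Real.norm_eq_abs, abs_mul]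
      have := abs_mon_le (content w) hz.le
      rw [degree_content] at this
      gcongr
    have hzr : z ∈ eball (0 : Fin n → ℝ) ρ₀ := by
      refine eball_subset_eball hr.le ?_
      rw [Metric.eball_coe, mem_ball_zero_iff]
      refine hz.trans_le ?_
      rw [hρ]
      exact div_le_self r.2 (by linarith [(Nat.cast_nonneg n : (0 : ℝ) ≤ n)])
    refine (hp.hasSum hzr).sigma_of_hasSum (fun k => ?_) hs
    have e : z = ∑ i, z i • (Pi.single i 1 : Fin n → ℝ) := by
      ext j; simp [Finset.sum_apply, Pi.single_apply]
    have : (p k fun _ => z) = ∑ w : Fin k → Fin n, A ⟨k, w⟩ * mon (content ⟨k, w⟩) z := by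
      conv_lhs => rw [e]
      rw [ContinuousMultilinearMap.map_sum]
      refine Finset.sum_congr rfl fun w _ => ?_
      rw [ContinuousMultilinearMap.map_smul_univ, smul_eq_mul, mon_content, mul_comm]
    rw [this]
    exact hasSum_fintype _
  -- The expansion over words in the basis vectors is regrouped by commutative content. The
  -- multilinear coefficients are not assumed symmetric, so all words with the same content have to
  -- be added.
  let c : PS n := fun α => ∑' w : content ⁻¹' {α}, A w
  have hcoef : ∀ α, coeff α c = ∑' w : content ⁻¹' {α}, A w := fun α => rfl
  refine ⟨ρ, hρ0, c, Conv.of_maj (M := ∑' w, |A w| * ρ ^ w.1) ?_, fun x hx => ?_⟩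
  · intro s
    have h1 := hS.hasSum.tsum_fiberwise content
    refine (Finset.sum_le_sum fun α _ => ?_).trans (sum_le_hasSum s (fun α _ =>
      tsum_nonneg fun w => by positivity) h1)
    have h2 : ∀ w : content (n := n) ⁻¹' {α}, w.1.1 = α.degree := fun w => by
      have := w.2
      rw [mem_preimage, mem_singleton_iff] at this
      rw [← degree_content w.1, this]
    have h3 : Summable fun w : content (n := n) ⁻¹' {α} => |A w| := by
      have := (hS.subtype (content ⁻¹' {α})).mul_right (ρ ^ α.degree)⁻¹
      refine this.congr fun w => ?_
      simp only [Function.comp, h2 w]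
      rw [mul_inv_cancel_right₀ (by positivity)]
    simp only [h2]
    rw [tsum_mul_right, hcoef]
    gcongr
    have := norm_tsum_le_tsum_norm (f := fun w : content (n := n) ⁻¹' {α} => A w) h3
    exact this
  · have h1 := (hsum (x - ξ) (by rwa [mem_ball_iff_norm] at hx)).tsum_fiberwise content
    rw [add_sub_cancel] at h1
    rw [fn, ev, ← h1.tsum_eq]
    refine tsum_congr fun α => ?_
    rw [hcoef, ← tsum_mul_right]
    refine tsum_congr fun w => ?_
    have := w.2
    rw [mem_preimage, mem_singleton_iff] at this
    rw [this]

/-- A function which is analytic at `ξ` agrees near `ξ` with the sum of `c`. -/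
def Rep (ξ : Fin n → ℝ) (f : (Fin n → ℝ) → ℝ) (c : PS n) : Prop :=
  ∃ ρ > 0, Conv ρ c ∧ ∀ x ∈ ball ξ ρ, f x = fn ξ c x

namespace Rep

variable {ξ : Fin n → ℝ} {f g : (Fin n → ℝ) → ℝ} {c d : PS n}

theorem of_analyticAt (hf : AnalyticAt ℝ f ξ) : ∃ c, Rep ξ f c := by
  obtain ⟨ρ, hρ, c, h1, h2⟩ := exists_conv_of_analyticAt hf
  exact ⟨c, ρ, hρ, h1, h2⟩

theorem of_conv {ρ : ℝ} (hρ : 0 < ρ) (hc : Conv ρ c) : Rep ξ (fn ξ c) c :=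
  ⟨ρ, hρ, hc, fun _ _ => rfl⟩

theorem eventuallyEq (hf : Rep ξ f c) : f =ᶠ[𝓝 ξ] fn ξ c := by
  obtain ⟨ρ, hρ, _, h⟩ := hf
  filter_upwards [ball_mem_nhds ξ hρ] with x hx using h x hx

theorem congr (hf : Rep ξ f c) (h : f =ᶠ[𝓝 ξ] g) : Rep ξ g c := by
  obtain ⟨ρ, hρ, hc, h1⟩ := hf
  obtain ⟨ε, hε, h2⟩ := Metric.eventually_nhds_iff_ball.1 h
  refine ⟨min ρ ε, lt_min hρ hε, hc.mono (min_le_left _ _), fun x hx => ?_⟩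
  rw [← h2 x (ball_subset_ball (min_le_right _ _) hx),
    h1 x (ball_subset_ball (min_le_left _ _) hx)]

theorem zero_iff (hf : Rep ξ f c) : c = 0 ↔ ∀ᶠ x in 𝓝 ξ, f x = 0 := by
  refine ⟨fun h => ?_, fun h => ?_⟩
  · filter_upwards [hf.eventuallyEq] with x hx
    rw [hx, h, fn_zero]
  · have h' := hf.eventuallyEq
    obtain ⟨ρ, hρ, hc, h1⟩ := hf
    refine hc.eq_zero hρ (ξ := ξ) ?_
    filter_upwards [h, h'] with x hx hx'
    rw [← hx', hx]

theorem binop (op : PS n → PS n → PS n) (op' : ℝ → ℝ → ℝ)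
    (h1 : ∀ {ρ : ℝ} {c d : PS n}, Conv ρ c → Conv ρ d → Conv ρ (op c d))
    (h2 : ∀ {ρ : ℝ} {c d : PS n} {x : Fin n → ℝ}, Conv ρ c → Conv ρ d → x ∈ ball ξ ρ →
      fn ξ (op c d) x = op' (fn ξ c x) (fn ξ d x))
    (hf : Rep ξ f c) (hg : Rep ξ g d) : Rep ξ (fun x => op' (f x) (g x)) (op c d) := by
  obtain ⟨ρ, hρ, hc, hf⟩ := hf
  obtain ⟨ρ', hρ', hd, hg⟩ := hg
  have hc' := hc.mono (min_le_left ρ ρ')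
  have hd' := hd.mono (min_le_right ρ ρ')
  refine ⟨min ρ ρ', lt_min hρ hρ', h1 hc' hd', fun x hx => ?_⟩
  beta_reduce
  rw [h2 hc' hd' hx, hf x (ball_subset_ball (min_le_left _ _) hx),
    hg x (ball_subset_ball (min_le_right _ _) hx)]

theorem sub (hf : Rep ξ f c) (hg : Rep ξ g d) : Rep ξ (fun x => f x - g x) (c - d) :=
  binop (· - ·) (· - ·) Conv.sub Conv.fn_sub hf hg

theorem mul (hf : Rep ξ f c) (hg : Rep ξ g d) : Rep ξ (fun x => f x * g x) (c * d) :=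
  binop (· * ·) (· * ·) Conv.mul Conv.fn_mul hf hg

theorem unique (hf : Rep ξ f c) (hg : Rep ξ f d) : c = d := by
  rw [← sub_eq_zero, (hf.sub hg).zero_iff]; simp

end Rep

/-! ### Operators on formal series and the algebra of powers of Γ -/

/-- A second-order differential operator whose coefficients are formal power series. -/
structure FormalOp (n : ℕ) where
  a : Fin n → Fin n → PS n
  b : Fin n → PS n
  c : PS n

namespace FormalOp

variable (F : FormalOp n) (G : PS n)

/-- `∑ aⁱᵏ ∂ᵢ∂ₖ u + ∑ bⁱ ∂ᵢ u + c u`. -/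
def app (u : PS n) : PS n :=
  ∑ i, ∑ k, F.a i k * pderiv ℝ i (pderiv ℝ k u) + ∑ i, F.b i * pderiv ℝ i u + F.c * u

/-- The vector field `½ ∑ aⁱʲ ∂ⱼ G`. -/
def field (i : Fin n) : PS n := (1 / 2 : ℝ) • ∑ j, F.a i j * pderiv ℝ j G

/-- The derivative along `½ ∑ aⁱʲ ∂ⱼ G`. -/
def L (u : PS n) : PS n := ∑ i, F.field G i * pderiv ℝ i u

/-- `¼ ∑ aⁱʲ ∂ᵢ∂ⱼ G + ¼ ∑ bⁱ ∂ᵢ G`. -/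
def D : PS n :=
  (1 / 4 : ℝ) • ∑ i, ∑ j, F.a i j * pderiv ℝ i (pderiv ℝ j G)
    + (1 / 4 : ℝ) • ∑ i, F.b i * pderiv ℝ i G

/-- `∑ aⁱʲ ∂ᵢG ∂ⱼG = 4 G`, with symmetric coefficients. -/
structure Eikonal : Prop where
  symm : ∀ i j, F.a i j = F.a j i
  eq : ∑ i, ∑ j, F.a i j * pderiv ℝ i G * pderiv ℝ j G = 4 * G

variable {F G}

theorem app_add (u v : PS n) : F.app (u + v) = F.app u + F.app v := by
  simp only [app, map_add, mul_add, Finset.sum_add_distrib]; ring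

theorem app_smul (t : ℝ) (u : PS n) : F.app (t • u) = t • F.app u := by
  simp only [app, Derivation.map_smul, mul_smul_comm, ← Finset.smul_sum, smul_add]

theorem app_zero : F.app 0 = 0 := by simp [app]

theorem app_neg (u : PS n) : F.app (-u) = -F.app u := by
  simpa using F.app_smul (-1) u

theorem app_sub (u v : PS n) : F.app (u - v) = F.app u - F.app v := by
  rw [sub_eq_add_neg, app_add, app_neg, sub_eq_add_neg]

theorem L_add (u v : PS n) : F.L G (u + v) = F.L G u + F.L G v := by
  simp only [L, map_add, mul_add, Finset.sum_add_distrib]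

theorem L_smul (t : ℝ) (u : PS n) : F.L G (t • u) = t • F.L G u := by
  simp only [L, Derivation.map_smul, mul_smul_comm, ← Finset.smul_sum]

theorem L_neg (u : PS n) : F.L G (-u) = -F.L G u := by simpa using F.L_smul (G := G) (-1) u

theorem L_sub (u v : PS n) : F.L G (u - v) = F.L G u - F.L G v := by
  rw [sub_eq_add_neg, L_add, L_neg, sub_eq_add_neg]

theorem L_sum {ι : Type*} (s : Finset ι) (u : ι → PS n) :
    F.L G (∑ i ∈ s, u i) = ∑ i ∈ s, F.L G (u i) := by
  simp only [L, map_sum, Finset.mul_sum]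
  exact Finset.sum_comm

theorem L_mul (u v : PS n) : F.L G (u * v) = u * F.L G v + v * F.L G u := by
  simp only [L, Derivation.leibniz, smul_eq_mul, Finset.mul_sum, ← Finset.sum_add_distrib]
  exact Finset.sum_congr rfl fun i _ => by ring

theorem L_C (t : ℝ) : F.L G (C t) = 0 := by
  simp [L]

theorem two_smul_half (u : PS n) : 2 * ((1 / 2 : ℝ) • u) = u := by
  rw [smul_eq_C_mul, ← mul_assoc, ← map_ofNat (MvPowerSeries.C (σ := Fin n) (R := ℝ)) 2, ← map_mul]
  norm_num

theorem two_mul_cancel {u v : PS n} (h : 2 * u = 2 * v) : u = v := by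
  have := congrArg (fun w : PS n => (1 / 2 : ℝ) • w) h
  simpa only [← mul_smul_comm, two_smul_half] using this

theorem four_smul_quarter (u : PS n) : 4 * ((1 / 4 : ℝ) • u) = u := by
  rw [smul_eq_C_mul, ← mul_assoc, ← map_ofNat (MvPowerSeries.C (σ := Fin n) (R := ℝ)) 4, ← map_mul]
  norm_num

theorem two_mul_L (u : PS n) :
    2 * F.L G u = ∑ i, ∑ j, F.a i j * pderiv ℝ j G * pderiv ℝ i u := by
  simp only [L, field, Finset.mul_sum, ← mul_assoc, two_smul_half, Finset.sum_mul]

theorem four_mul_D : 4 * F.D G = ∑ i, ∑ j, F.a i j * pderiv ℝ i (pderiv ℝ j G)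
    + ∑ i, F.b i * pderiv ℝ i G := by
  rw [D, mul_add, four_smul_quarter, four_smul_quarter]

theorem app_mul (hs : ∀ i j, F.a i j = F.a j i) (u v : PS n) :
    F.app (u * v) = u * F.app v + v * F.app u - F.c * u * v
      + 2 * ∑ i, ∑ k, F.a i k * pderiv ℝ k u * pderiv ℝ i v := by
  have h1 : ∑ i, ∑ k, F.a i k * pderiv ℝ i u * pderiv ℝ k v
      = ∑ i, ∑ k, F.a i k * pderiv ℝ k u * pderiv ℝ i v := by
    rw [Finset.sum_comm]
    exact Finset.sum_congr rfl fun i _ => Finset.sum_congr rfl fun k _ => by rw [hs i k]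
  have h2 : ∑ i, ∑ k, F.a i k * pderiv ℝ i (pderiv ℝ k (u * v))
      = u * ∑ i, ∑ k, F.a i k * pderiv ℝ i (pderiv ℝ k v)
        + v * ∑ i, ∑ k, F.a i k * pderiv ℝ i (pderiv ℝ k u)
        + (∑ i, ∑ k, F.a i k * pderiv ℝ i u * pderiv ℝ k v
          + ∑ i, ∑ k, F.a i k * pderiv ℝ k u * pderiv ℝ i v) := by
    simp only [Finset.mul_sum, ← Finset.sum_add_distrib]
    refine Finset.sum_congr rfl fun i _ => Finset.sum_congr rfl fun k _ => ?_
    simp only [Derivation.leibniz, map_add, smul_eq_mul]; ring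
  have h3 : ∑ i, F.b i * pderiv ℝ i (u * v)
      = u * ∑ i, F.b i * pderiv ℝ i v + v * ∑ i, F.b i * pderiv ℝ i u := by
    simp only [Finset.mul_sum, ← Finset.sum_add_distrib]
    refine Finset.sum_congr rfl fun i _ => ?_
    simp only [Derivation.leibniz, smul_eq_mul]; ring
  rw [app, app, app, h2, h1, h3]; ring

theorem Eikonal.L_self (h : F.Eikonal G) : F.L G G = 2 * G := by
  have h1 := F.two_mul_L (G := G) G
  have h2 := h.eq
  have h3 : ∑ i, ∑ j, F.a i j * pderiv ℝ i G * pderiv ℝ j G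
      = ∑ i, ∑ j, F.a i j * pderiv ℝ j G * pderiv ℝ i G :=
    Finset.sum_congr rfl fun i _ => Finset.sum_congr rfl fun j _ => by ring
  rw [← h3, h2] at h1
  exact two_mul_cancel (h1.trans (by ring))

/-- The mixed second-order terms of the product rule are 4 L h, and the terms in which G alone is
differentiated are 4 D h; the zeroth-order coefficient is counted once, in G F[h]. -/
theorem app_world_mul (hs : ∀ i j, F.a i j = F.a j i) (h : PS n) :
    F.app (G * h) = G * F.app h + 4 * (F.L G h + F.D G * h) := by
  have e1 := F.two_mul_L (G := G) h
  have e2 := F.four_mul_D (G := G)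
  have e3 : F.app G = ∑ i, ∑ j, F.a i j * pderiv ℝ i (pderiv ℝ j G)
    + ∑ i, F.b i * pderiv ℝ i G + F.c * G := rfl
  rw [app_mul hs]
  linear_combination (-2) * e1 + h * e3 - h * e2

theorem L_world_pow (h : F.Eikonal G) (j : ℕ) : F.L G (G ^ j) = 2 * j * G ^ j := by
  induction j with
  | zero =>
    have := F.L_C (G := G) 1
    rw [map_one] at this
    simpa using this
  | succ j ih => rw [pow_succ, L_mul, ih, h.L_self]; push_cast; ring

theorem L_world_pow_mul (h : F.Eikonal G) (j : ℕ) (u : PS n) :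
    F.L G (G ^ j * u) = G ^ j * (F.L G u + 2 * j * u) := by
  rw [L_mul, L_world_pow h]; ring

/-- The identity behind all the recursions. Induction on the power multiplies by one more G; each
step moves L past a power of G, which adds twice the exponent, and the contributions combine to the
factor j + 1 and the shift j. -/
theorem app_world_pow_mul (h : F.Eikonal G) (j : ℕ) (u : PS n) :
    F.app (G ^ (j + 1) * u) = G ^ (j + 1) * F.app u
      + 4 * (j + 1) * G ^ j * (F.L G u + F.D G * u + j * u) := by
  induction j with
  | zero => rw [zero_add, pow_one, app_world_mul h.symm]; push_cast; ring
  | succ j ih =>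
    rw [pow_succ' G (j + 1), mul_assoc, app_world_mul h.symm, ih, L_world_pow_mul h]
    push_cast; ring

theorem app_sub_order (k : ℕ) {u : PS n} (hu : OrdGE (k + 2) u) : OrdGE k (F.app u) := by
  refine OrdGE.add (OrdGE.add ?_ ?_) ?_
  · exact OrdGE.sum _ fun i _ => OrdGE.sum _ fun j _ => OrdGE.mul_left _ ((hu.pderiv j).pderiv i)
  · exact OrdGE.sum _ fun i _ => OrdGE.mul_left _ ((hu.pderiv i).mono (Nat.le_succ k))
  · exact OrdGE.mul_left _ (hu.mono (by omega))

theorem L_order (hG : ∀ i, OrdGE 1 (F.field G i)) (k : ℕ) {u : PS n} (hu : OrdGE k u) :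
    OrdGE k (F.L G u) := by
  refine OrdGE.sum _ fun i _ => ?_
  exact ((hG i).mul (hu.pderiv_sub_one i)).mono (by omega)

end FormalOp

/-! ### Transport equations as perturbations of the Euler operator -/

theorem smul_half_two (u : PS n) : (1 / 2 : ℝ) • (2 * u) = u := by
  rw [← mul_smul_comm, FormalOp.two_smul_half]

theorem diag_sub_diag_inv {φ : ℕ → ℝ} {k : ℕ} (hφ : ∀ j, k ≤ j → φ j ≠ 0) {g : PS n}
    (hg : OrdGE k g) : diag φ (diag (fun j => (φ j)⁻¹) g) = g := by
  ext α
  rw [coeff_diag, coeff_diag]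
  by_cases h : α.degree < k
  · rw [hg α h]; simp
  · rw [mul_inv_cancel_left₀ (hφ _ (not_lt.1 h))]

theorem diag_add_const (κ : ℝ) (u : PS n) : diag (fun k => (k : ℝ) + κ) u = euler u + C κ * u := by
  ext α
  rw [map_add, euler, coeff_diag, coeff_diag, ← smul_eq_C_mul, map_smul, smul_eq_mul]; ring

/-- Bounds under which `∑ ℓᵢ ∂ᵢ + δ` is a small perturbation of the Euler operator. -/
structure NearEuler (ℓ : Fin n → PS n) (δ : PS n) (R : ℝ) : Prop where
  order : ∀ i, OrdGE 2 (ℓ i - X i)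
  order' : OrdGE 1 δ
  maj : ∀ r, 0 < r → r ≤ R → ∀ i, Maj r (r / (12 * (n + 1))) (ℓ i - X i)
  maj' : ∀ r, 0 < r → r ≤ R → Maj r (1 / 4) δ

/-- The perturbation `∑ ℓᵢ ∂ᵢ + δ - ∑ zᵢ ∂ᵢ` of the Euler operator. -/
def pert (ℓ : Fin n → PS n) (δ u : PS n) : PS n := ∑ i, (ℓ i - X i) * pderiv ℝ i u + δ * u

theorem pert_sub (ℓ : Fin n → PS n) (δ u v : PS n) : pert ℓ δ (u - v) = pert ℓ δ u - pert ℓ δ v := by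
  simp only [pert, map_sub, mul_sub, Finset.sum_sub_distrib]; ring

theorem diag_add_pert (ℓ : Fin n → PS n) (δ : PS n) (κ : ℝ) (u : PS n) :
    diag (fun k => (k : ℝ) + κ) u + pert ℓ δ u = ∑ i, ℓ i * pderiv ℝ i u + (δ + C κ) * u := by
  simp only [pert, diag_add_const, euler_eq, sub_mul, Finset.sum_sub_distrib]
  ring

namespace NearEuler

variable {ℓ : Fin n → PS n} {δ : PS n} {R : ℝ}

theorem pert_order (h : NearEuler ℓ δ R) {k : ℕ} {u : PS n} (hu : OrdGE k u) :
    OrdGE (k + 1) (pert ℓ δ u) := by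
  refine OrdGE.add (OrdGE.sum _ fun i _ => ?_) ?_
  · exact ((h.order i).mul (hu.pderiv_sub_one i)).mono (by omega)
  · exact (h.order'.mul hu).mono (by omega)

/-- With g = (Euler + κ) u the equation reads g = f - pert ((Euler + κ)⁻¹ g). The inverse gains one
derivative, by the hypothesis k ≤ 3 (k + κ), so the right-hand side involves no loss of radius and
raises the order of differences by one. -/
theorem exists_solution (h : NearEuler ℓ δ R) {κ : ℝ} {d : ℕ}
    (h1 : 1 ≤ d + κ) (h3 : ∀ k : ℕ, d ≤ k → (k : ℝ) ≤ 3 * (k + κ)) {f : PS n} (hf : OrdGE d f) :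
    ∃ u, OrdGE d u ∧ ∑ i, ℓ i * pderiv ℝ i u + (δ + C κ) * u = f ∧
      ∀ r M, 0 < r → r ≤ R → Maj r M f → Maj r (2 * M / (d + κ)) u := by
  have hk : ∀ k : ℕ, d ≤ k → d + κ ≤ k + κ := fun k hk => by
    have : (d : ℝ) ≤ k := by exact_mod_cast hk
    linarith
  have hpos : ∀ k : ℕ, d ≤ k → (0 : ℝ) < k + κ := fun k hkd => by linarith [hk k hkd]
  set φ : ℕ → ℝ := fun k => k + κ with hφ
  have hinv : ∀ {g : PS n}, OrdGE d g → diag φ (diag (fun j => (φ j)⁻¹) g) = g := fun hg =>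
    diag_sub_diag_inv (fun j hj => (hpos j hj).ne') hg
  obtain ⟨g, hgd, hg, hgM⟩ := exists_fixedPoint (n := n) (k := d)
    (fun g => f - pert ℓ δ (diag (fun j => (φ j)⁻¹) g))
    (fun g hg => hf.sub ((h.pert_order (hg.diag _)).mono (Nat.le_succ d)))
    (fun j g g' _ _ hgg => by
      have : f - pert ℓ δ (diag (fun j => (φ j)⁻¹) g) - (f - pert ℓ δ (diag (fun j => (φ j)⁻¹) g'))
          = -pert ℓ δ (diag (fun j => (φ j)⁻¹) (g - g')) := by
        rw [map_sub, pert_sub]; ring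
      rw [this]
      exact (h.pert_order (hgg.diag _)).neg)
  refine ⟨diag (fun j => (φ j)⁻¹) g, hgd.diag _, ?_, fun r M hr hrR hM => ?_⟩
  · rw [← diag_add_pert, hinv hgd]
    nth_rewrite 1 [← hg]
    ring
  · have hM0 := hM.nonneg
    have e1 : ∀ {N : ℝ} {g : PS n}, OrdGE d g → Maj r N g →
        Maj r ((d + κ)⁻¹ * N) (diag (fun j => (φ j)⁻¹) g) := fun hgo hN =>
      hN.diag hr.le (fun j hj => by
        rw [abs_inv, abs_of_pos (hpos j hj)]
        exact inv_anti₀ (by linarith) (hk j hj)) hgo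
    -- The ball of radius 2M is invariant: the first-order part of the perturbation contributes at
    -- most n · (r / (12 (n + 1))) · (3 / r) · 2M ≤ M/2, and the part with δ at most ¼ · 2M = M/2,
    -- in addition to M from f.
    have e2 : Maj r (2 * M) g := by
      refine hgM r (2 * M) (by positivity) fun g hgo hgM => ?_
      have e3 : ∀ i, Maj r (3 / r * (2 * M)) (pderiv ℝ i (diag (fun j => (φ j)⁻¹) g)) := fun i =>
        Maj.pderiv_of_diag hr (φ := φ) (hgo.diag _) (fun j hj => by
          rw [abs_of_pos (hpos j hj)]; exact h3 j hj) (by norm_num) i (by rwa [hinv hgo])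
      have e4 := (Maj.sum hr.le Finset.univ fun i _ =>
        (h.maj r hr hrR i).mul hr.le (e3 i)).add hr.le
          ((h.maj' r hr hrR).mul hr.le (e1 hgo hgM))
      refine (hM.sub hr.le e4).mono ?_
      rw [Finset.sum_const, Finset.card_univ, Fintype.card_fin, nsmul_eq_mul]
      have e5 : (n : ℝ) * (r / (12 * (n + 1)) * (3 / r * (2 * M))) ≤ M / 2 := by
        have : (n : ℝ) * (r / (12 * (n + 1)) * (3 / r * (2 * M))) = (n / (n + 1)) * (M / 2) := by
          field_simp; ring
        rw [this]
        exact mul_le_of_le_one_left (by positivity)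
          (div_le_one_of_le₀ (by linarith) (by positivity))
      have e6 : (d + κ)⁻¹ * (2 * M) ≤ 2 * M :=
        mul_le_of_le_one_left (by positivity) (inv_le_one_of_one_le₀ h1)
      linarith
    refine (e1 hgd e2).mono (le_of_eq ?_)
    rw [div_eq_inv_mul]

/-- The perturbation raises the order, so the lowest homogeneous part of a solution is multiplied by
k + κ ≠ 0 and must vanish. -/
theorem unique (h : NearEuler ℓ δ R) {κ : ℝ} {d : ℕ} (h1 : 0 < d + κ)
    {u : PS n} (hu : OrdGE d u) 
    (hT : ∑ i, ℓ i * pderiv ℝ i u + (δ + C κ) * u = 0) : u = 0 := by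
  refine OrdGE.eq_zero fun k => ?_
  induction k with
  | zero => exact OrdGE.zero_left _
  | succ k ih =>
    rw [← diag_add_pert, add_eq_zero_iff_eq_neg] at hT
    have h2 : OrdGE (k + 1) (diag (fun k => (k : ℝ) + κ) u) := by
      rw [hT]; exact (h.pert_order ih).neg
    intro α hα
    by_cases hd : α.degree < d
    · exact hu α hd
    · have h3 := h2 α hα
      rw [coeff_diag] at h3
      have : (d : ℝ) ≤ α.degree := by exact_mod_cast not_lt.1 hd
      exact (mul_eq_zero.1 h3).resolve_left (by linarith)

end NearEuler

namespace FormalOp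

variable (F : FormalOp n) (G : PS n)

/-- The transport operator `L + D + k`. -/
def T (k : ℝ) (u : PS n) : PS n := F.L G u + (F.D G + C k) * u

/-- `G` solves the eikonal equation, `½ ∑ aⁱʲ ∂ⱼ G = zᵢ + O(2)` and `D = n/2 + O(1)`, with
explicit bounds on polydiscs of radius at most `R`. -/
structure Normal (R : ℝ) : Prop extends F.Eikonal G where
  order : OrdGE 2 G
  field_order : ∀ i, OrdGE 2 (F.field G i - X i)
  D_order : OrdGE 1 (F.D G - C ((n : ℝ) / 2))
  field_maj : ∀ r, 0 < r → r ≤ R → ∀ i, Maj r (r / (12 * (n + 1))) (F.field G i - X i)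
  D_maj : ∀ r, 0 < r → r ≤ R → Maj r (1 / 4) (F.D G - C ((n : ℝ) / 2))

variable {F G}

theorem T_smul (k t : ℝ) (u : PS n) : F.T G k (t • u) = t • F.T G k u := by
  rw [T, T, L_smul, mul_smul_comm, smul_add]

theorem T_add (k : ℝ) (u v : PS n) : F.T G k (u + v) = F.T G k u + F.T G k v := by
  rw [T, T, T, L_add]; ring

theorem T_sub (k : ℝ) (u v : PS n) : F.T G k (u - v) = F.T G k u - F.T G k v := by
  rw [T, T, T, L_sub]; ring

theorem T_add_const (k l : ℝ) (u : PS n) : F.T G (k + l) u = F.T G k u + C l * u := by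
  rw [T, T, map_add]; ring

theorem T_world_pow_mul (h : F.Eikonal G) (k : ℝ) (j : ℕ) (u : PS n) :
    F.T G k (G ^ j * u) = G ^ j * F.T G (k + 2 * j) u := by
  rw [T, T, L_world_pow_mul h, map_add, map_mul, map_natCast, map_ofNat]; ring

theorem Normal.nearEuler {R : ℝ} (h : F.Normal G R) :
    NearEuler (F.field G) (F.D G - C ((n : ℝ) / 2)) R :=
  ⟨h.field_order, h.D_order, h.field_maj, h.D_maj⟩

/-- Since D takes the value n/2 at the pole, subtracting n/2 makes κ the indicial constant: the
leading action in degree k is k + κ. -/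
theorem T_eq (κ : ℝ) (u : PS n) : F.T G (κ - n / 2) u
    = ∑ i, F.field G i * pderiv ℝ i u + (F.D G - C ((n : ℝ) / 2) + C κ) * u := by
  rw [T, L, map_sub]; ring

theorem Normal.transport_exists {R : ℝ} (h : F.Normal G R) {κ : ℝ} {d : ℕ}
    (h1 : 1 ≤ d + κ) (h3 : ∀ k : ℕ, d ≤ k → (k : ℝ) ≤ 3 * (k + κ)) {f : PS n} (hf : OrdGE d f) :
    ∃ u, OrdGE d u ∧ F.T G (κ - n / 2) u = f ∧
      ∀ r M, 0 < r → r ≤ R → Maj r M f → Maj r (2 * M / (d + κ)) u := by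
  simp only [T_eq]
  exact h.nearEuler.exists_solution h1 h3 hf

theorem Normal.transport_unique {R : ℝ} (h : F.Normal G R) {κ : ℝ} {d : ℕ} (h1 : 0 < d + κ)
    {u : PS n} (hu : OrdGE d u) (hT : F.T G (κ - n / 2) u = 0) : u = 0 :=
  h.nearEuler.unique h1 hu (by rwa [← T_eq])

/-- A solution of a transport equation whose right-hand side is divisible by `G` is divisible
by `G`. -/
theorem Normal.dvd_of_transport {R : ℝ} (h : F.Normal G R) {κ : ℝ} (hκ : 0 ≤ κ) {d : ℕ}
    (hd : d ≤ 2) (h1 : 0 < d + κ) {u q : PS n} (hu : OrdGE d u)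
    (hT : F.T G (κ - n / 2) u = G * q) : ∃ u', u = G * u' := by
  -- Moving G through the transport operator raises κ by 2. If v solves the shifted equation with
  -- right-hand side q, then G v solves the given equation, and G v has order at least 2 ≥ d, so
  -- uniqueness gives u = G v.
  obtain ⟨v, -, hv, -⟩ := h.transport_exists (κ := κ + 2) (d := 0) (by push_cast; linarith)
    (fun k _ => by have : (0 : ℝ) ≤ k := k.cast_nonneg; linarith) (OrdGE.zero_left q)
  refine ⟨v, ?_⟩
  rw [← sub_eq_zero]
  refine h.transport_unique h1 (hu.sub ?_) (κ := κ) ?_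
  · simpa using (h.order.mono hd).mul (OrdGE.zero_left v)
  · have e := T_world_pow_mul h.toEikonal (κ - n / 2) 1 v
    rw [pow_one] at e
    rw [T_sub, hT, e, show κ - n / 2 + 2 * ((1 : ℕ) : ℝ) = κ + 2 - n / 2 by push_cast; ring, hv,
      sub_self]

end FormalOp

/-! ### Solution of the eikonal equation by power series -/

/-- A convergent series of order `k` is `O(r ^ k)` on polydiscs of radius `r`. -/
theorem Conv.exists_maj_pow {ρ : ℝ} (hρ : 0 < ρ) {c : PS n} (hc : Conv ρ c) {k : ℕ}
    (ho : OrdGE k c) : ∃ M, 0 ≤ M ∧ ∀ r, 0 < r → r ≤ ρ / 2 → Maj r (M * r ^ k) c := by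
  obtain ⟨M, hM⟩ := hc (ρ / 2) (by positivity) (by linarith)
  have := hM.nonneg
  refine ⟨M / (ρ / 2) ^ k, by positivity, fun r hr hrR => ?_⟩
  refine (hM.scale hr.le (by positivity) hrR ho).mono (le_of_eq ?_)
  rw [div_pow]; ring

theorem pderiv_C' (i : Fin n) (t : ℝ) : pderiv ℝ i (C t : PS n) = 0 :=
  (pderiv ℝ i).map_algebraMap t

/-- The quadratic form with matrix `A`, as a power series. -/
def quad (A : Matrix (Fin n) (Fin n) ℝ) : PS n := ∑ i, ∑ j, C (A i j) * X i * X j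

theorem pderiv_quad {A : Matrix (Fin n) (Fin n) ℝ} (hA : A.IsSymm) (k : Fin n) :
    pderiv ℝ k (quad A) = 2 * ∑ j, C (A k j) * X j := by
  classical
  have h : ∀ i : Fin n, pderiv ℝ k (X i : PS n) = if i = k then 1 else 0 := fun i => by
    rw [pderiv_X, Pi.single_apply]
  simp only [quad, map_sum, Derivation.leibniz, smul_eq_mul, h, pderiv_C']
  simp only [mul_ite, mul_one, mul_zero, add_zero, Finset.sum_add_distrib, Finset.sum_ite_eq',
    Finset.mem_univ, if_true]
  have e1 : ∑ i, ∑ j, (if i = k then X j * C (A i j) else 0 : PS n) = ∑ j, C (A k j) * X j := by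
    rw [Finset.sum_comm]
    refine Finset.sum_congr rfl fun j _ => ?_
    simp [mul_comm]
  have e2 : ∑ i, (C (A i k) * X i : PS n) = ∑ j, C (A k j) * X j :=
    Finset.sum_congr rfl fun j _ => by rw [hA.apply]
  rw [e2, e1]; ring

theorem euler_quad {A : Matrix (Fin n) (Fin n) ℝ} (hA : A.IsSymm) :
    euler (quad A) = 2 * quad A := by
  rw [euler_eq, quad, Finset.mul_sum]
  refine Finset.sum_congr rfl fun i _ => ?_
  rw [← quad, pderiv_quad hA, Finset.mul_sum, Finset.mul_sum, Finset.mul_sum]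
  exact Finset.sum_congr rfl fun j _ => by ring

theorem quad_order (A : Matrix (Fin n) (Fin n) ℝ) : OrdGE 2 (quad A) :=
  OrdGE.sum _ fun i _ => OrdGE.sum _ fun j _ => by
    rw [mul_assoc]; exact ((OrdGE.X i).mul (OrdGE.X j)).mul_left _

theorem conv_quad (ρ : ℝ) (A : Matrix (Fin n) (Fin n) ℝ) : Conv ρ (quad A) :=
  Conv.sum _ fun _ _ => Conv.sum _ fun _ _ => ((Conv.const _).mul (Conv.X _)).mul (Conv.X _)

theorem matrix_mul_pderiv_quad {A A' : Matrix (Fin n) (Fin n) ℝ} (hA : A.IsSymm)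
    (hAA : A' * A = 1) (i : Fin n) :
    ∑ j, C (A' i j) * pderiv ℝ j (quad A) = 2 * X i := by
  classical
  have h : ∀ k, ∑ j, (C (A' i j) : PS n) * C (A j k) = if i = k then 1 else 0 := fun k => by
    have := congrFun (congrFun hAA i) k
    rw [Matrix.mul_apply, Matrix.one_apply] at this
    have h2 := congrArg (C (σ := Fin n)) this
    rw [map_sum] at h2
    simp only [map_mul] at h2
    rw [h2]; split_ifs <;> simp
  calc ∑ j, (C (A' i j) : PS n) * pderiv ℝ j (quad A)
      = 2 * ∑ k, (∑ j, C (A' i j) * C (A j k)) * X k := by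
        simp only [pderiv_quad hA, Finset.mul_sum, Finset.sum_mul]
        rw [Finset.sum_comm]
        exact Finset.sum_congr rfl fun _ _ => Finset.sum_congr rfl fun _ _ => by ring
    _ = 2 * X i := by simp [h]

namespace FormalOp

variable {F : FormalOp n}

/-- The value at the centre of the principal coefficients. -/
def a₀ (F : FormalOp n) : Matrix (Fin n) (Fin n) ℝ := fun i j => constantCoeff (F.a i j)

/-- The nonlinear right-hand side in the equation `(∑ zᵢ∂ᵢ - 1) E = g` for the part `E` of order
three of the world function. -/
def eikonalRHS (F : FormalOp n) (Q E : PS n) : PS n :=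
  -(1 / 4 : ℝ) • ∑ i, ∑ j, (C (F.a₀ i j) * pderiv ℝ i E * pderiv ℝ j E
    + (F.a i j - C (F.a₀ i j)) * pderiv ℝ i (Q + E) * pderiv ℝ j (Q + E))

/-- Expand the eikonal form about Q, where A inverts the frozen principal matrix. The Q–Q terms give
4Q by Euler's identity, the two cross terms give 2 Euler(E) each, and the rest is the nonlinear
right-hand side. -/
theorem eikonal_of_fixedPoint (hs : ∀ i j, F.a i j = F.a j i) {A : Matrix (Fin n) (Fin n) ℝ}
    (hA : A.IsSymm) (hAA : F.a₀ * A = 1) {E : PS n}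
    (hE : euler E - E = F.eikonalRHS (quad A) E) : F.Eikonal (quad A + E) := by
  refine ⟨hs, ?_⟩
  set Q := quad A with hQ
  have h0s : ∀ i j, F.a₀ i j = F.a₀ j i := fun i j => by rw [a₀, a₀, hs]
  have e1 : ∑ i, ∑ j, C (F.a₀ i j) * pderiv ℝ i Q * pderiv ℝ j Q = 4 * Q := by
    have : ∀ i, ∑ j, C (F.a₀ i j) * pderiv ℝ i Q * pderiv ℝ j Q
        = 2 * (X i * pderiv ℝ i Q) := fun i => by
      have := matrix_mul_pderiv_quad hA hAA i
      calc _ = pderiv ℝ i Q * ∑ j, C (F.a₀ i j) * pderiv ℝ j Q := by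
            rw [Finset.mul_sum]; exact Finset.sum_congr rfl fun _ _ => by ring
        _ = _ := by rw [this]; ring
    rw [Finset.sum_congr rfl fun i _ => this i, ← Finset.mul_sum, ← euler_eq, euler_quad hA]; ring
  have e2 : ∑ i, ∑ j, C (F.a₀ i j) * pderiv ℝ i E * pderiv ℝ j Q = 2 * euler E := by
    have : ∀ i, ∑ j, C (F.a₀ i j) * pderiv ℝ i E * pderiv ℝ j Q
        = 2 * (X i * pderiv ℝ i E) := fun i => by
      have := matrix_mul_pderiv_quad hA hAA i
      calc _ = pderiv ℝ i E * ∑ j, C (F.a₀ i j) * pderiv ℝ j Q := by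
            rw [Finset.mul_sum]; exact Finset.sum_congr rfl fun _ _ => by ring
        _ = _ := by rw [this]; ring
    rw [Finset.sum_congr rfl fun i _ => this i, ← Finset.mul_sum, ← euler_eq]
  have e3 : ∑ i, ∑ j, C (F.a₀ i j) * pderiv ℝ i Q * pderiv ℝ j E = 2 * euler E := by
    rw [← e2, Finset.sum_comm]
    exact Finset.sum_congr rfl fun i _ => Finset.sum_congr rfl fun j _ => by rw [h0s]; ring
  have e4 : -4 * (euler E - E) = ∑ i, ∑ j, (C (F.a₀ i j) * pderiv ℝ i E * pderiv ℝ j E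
      + (F.a i j - C (F.a₀ i j)) * pderiv ℝ i (Q + E) * pderiv ℝ j (Q + E)) := by
    rw [hE, eikonalRHS, neg_smul, neg_mul_neg, four_smul_quarter]
  have e5 : ∑ i, ∑ j, F.a i j * pderiv ℝ i (Q + E) * pderiv ℝ j (Q + E)
      = ∑ i, ∑ j, C (F.a₀ i j) * pderiv ℝ i Q * pderiv ℝ j Q
        + ∑ i, ∑ j, C (F.a₀ i j) * pderiv ℝ i E * pderiv ℝ j Q
        + ∑ i, ∑ j, C (F.a₀ i j) * pderiv ℝ i Q * pderiv ℝ j E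
        + ∑ i, ∑ j, (C (F.a₀ i j) * pderiv ℝ i E * pderiv ℝ j E
          + (F.a i j - C (F.a₀ i j)) * pderiv ℝ i (Q + E) * pderiv ℝ j (Q + E)) := by
    simp only [← Finset.sum_add_distrib]
    refine Finset.sum_congr rfl fun i _ => Finset.sum_congr rfl fun j _ => ?_
    simp only [map_add]; ring
  rw [e5, e1, e2, e3, ← e4]; ring

theorem eikonalRHS_order {Q E : PS n} (hQ : OrdGE 2 Q) (hE : OrdGE 3 E) :
    OrdGE 3 (F.eikonalRHS Q E) := by
  refine OrdGE.smul _ (OrdGE.sum _ fun i _ => OrdGE.sum _ fun j _ => OrdGE.add ?_ ?_)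
  · rw [mul_assoc]
    exact (((hE.pderiv i).mul (hE.pderiv j)).mul_left _).mono (by norm_num)
  · have := hQ.add (hE.mono (by norm_num : 2 ≤ 3))
    exact ((OrdGE.sub_const _).mul (this.pderiv i)).mul (this.pderiv j)

theorem eikonalRHS_sub_order {Q E E' : PS n} (hQ : OrdGE 2 Q) (hE : OrdGE 3 E) (hE' : OrdGE 3 E')
    {k : ℕ} (h : OrdGE k (E - E')) : OrdGE (k + 1) (F.eikonalRHS Q E - F.eikonalRHS Q E') := by
  have h1 : ∀ i, OrdGE (k - 1) (pderiv ℝ i E - pderiv ℝ i E') := fun i => by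
    rw [← map_sub]; exact h.pderiv_sub_one i
  rw [eikonalRHS, eikonalRHS, ← smul_sub, ← Finset.sum_sub_distrib]
  refine OrdGE.smul _ (OrdGE.sum _ fun i _ => ?_)
  rw [← Finset.sum_sub_distrib]
  refine OrdGE.sum _ fun j _ => ?_
  have hG := hQ.add (hE.mono (by norm_num : 2 ≤ 3))
  have hG' := hQ.add (hE'.mono (by norm_num : 2 ≤ 3))
  have e : C (F.a₀ i j) * pderiv ℝ i E * pderiv ℝ j E
      + (F.a i j - C (F.a₀ i j)) * pderiv ℝ i (Q + E) * pderiv ℝ j (Q + E)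
      - (C (F.a₀ i j) * pderiv ℝ i E' * pderiv ℝ j E'
      + (F.a i j - C (F.a₀ i j)) * pderiv ℝ i (Q + E') * pderiv ℝ j (Q + E'))
      = C (F.a₀ i j) * (pderiv ℝ i E * (pderiv ℝ j E - pderiv ℝ j E'))
        + C (F.a₀ i j) * (pderiv ℝ j E' * (pderiv ℝ i E - pderiv ℝ i E'))
        + ((F.a i j - C (F.a₀ i j)) * pderiv ℝ i (Q + E) * (pderiv ℝ j E - pderiv ℝ j E')
        + (F.a i j - C (F.a₀ i j)) * pderiv ℝ j (Q + E') * (pderiv ℝ i E - pderiv ℝ i E')) := by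
    simp only [map_add]; ring
  rw [e]
  refine (OrdGE.add ?_ ?_).add (OrdGE.add ?_ ?_)
  · exact (((hE.pderiv i).mul (h1 j)).mul_left _).mono (by omega)
  · exact (((hE'.pderiv j).mul (h1 i)).mul_left _).mono (by omega)
  · exact (((OrdGE.sub_const _).mul (hG.pderiv i)).mul (h1 j)).mono (by omega)
  · exact (((OrdGE.sub_const _).mul (hG'.pderiv j)).mul (h1 i)).mono (by omega)

/-- Existence of the world function as a convergent power series. -/
theorem exists_eikonal {ρ : ℝ} (hρ : 0 < ρ) (hs : ∀ i j, F.a i j = F.a j i)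
    (ha : ∀ i j, Conv ρ (F.a i j)) {A : Matrix (Fin n) (Fin n) ℝ} (hA : A.IsSymm)
    (hAA : F.a₀ * A = 1) :
    ∃ E : PS n, OrdGE 3 E ∧ F.Eikonal (quad A + E) ∧ ∃ r > 0, r ≤ ρ ∧ Conv r E := by
  set Q := quad A with hQ
  have hQo : OrdGE 2 Q := quad_order A
  have hk : ∀ k : ℕ, 3 ≤ k → (3 : ℝ) ≤ k := fun k hk => by exact_mod_cast hk
  -- The unknown of the iteration is g = (Euler - 1) E. In degrees k ≥ 3 this operator is
  -- invertible, and k ≤ 2 (k - 1) bounds the first derivatives of E by (2 / r) times the norm of g.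
  set φ : ℕ → ℝ := fun k => k + (-1) with hφ
  have hφ0 : ∀ k, 3 ≤ k → (0 : ℝ) < φ k := fun k h => by have := hk k h; simp only [hφ]; linarith
  have hinv : ∀ {g : PS n}, OrdGE 3 g → diag φ (diag (fun j => (φ j)⁻¹) g) = g := fun hg =>
    diag_sub_diag_inv (fun j hj => (hφ0 j hj).ne') hg
  obtain ⟨g, hgo, hg, hgM⟩ := exists_fixedPoint (n := n) (k := 3)
    (fun g => F.eikonalRHS Q (diag (fun j => (φ j)⁻¹) g))
    (fun g hg => eikonalRHS_order hQo (hg.diag _))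
    (fun j g g' hg hg' h => eikonalRHS_sub_order hQo (hg.diag _) (hg'.diag _)
      (by rw [← map_sub]; exact h.diag _))
  have hE : euler (diag (fun j => (φ j)⁻¹) g) - diag (fun j => (φ j)⁻¹) g
      = F.eikonalRHS Q (diag (fun j => (φ j)⁻¹) g) := by
    rw [hg]
    conv_rhs => rw [← hinv hgo, hφ, diag_add_const]
    simp only [map_neg, map_one, hφ]; ring
  refine ⟨diag (fun j => (φ j)⁻¹) g, hgo.diag _, eikonal_of_fixedPoint hs hA hAA hE, ?_⟩
  choose Mα hMα0 hMα using fun i j => ((ha i j).sub (Conv.const (F.a₀ i j))).exists_maj_pow hρ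
    (OrdGE.sub_const (F.a i j))
  choose Mq hMq0 hMq using fun i => ((conv_quad ρ A).pderiv i).exists_maj_pow hρ
    ((quad_order A).pderiv i)
  set m := ∑ i, ∑ j, |F.a₀ i j| with hm
  have hm0 : 0 ≤ m := Finset.sum_nonneg fun _ _ => Finset.sum_nonneg fun _ _ => abs_nonneg _
  -- The ball of radius η r² is to be invariant. The choice η m ≤ ½ gives half of it to the terms
  -- quadratic in E; then r K ≤ 2η gives the other half to the terms with the variable part of the
  -- coefficients.
  set η : ℝ := 1 / (2 * (m + 1)) with hη
  have hη0 : 0 < η := by positivity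
  set K := ∑ i, ∑ j, Mα i j * (Mq i + 2 * η) * (Mq j + 2 * η) with hK
  have hK0 : 0 ≤ K := Finset.sum_nonneg fun i _ => Finset.sum_nonneg fun j _ => by
    have := hMα0 i j; have := hMq0 i; have := hMq0 j; positivity
  obtain ⟨r, hr0, hr⟩ : ∃ r : ℝ, 0 < r ∧ r ≤ ρ / 2 ∧ r * K ≤ 2 * η := by
    refine ⟨min (ρ / 2) (2 * η / (K + 1)), by positivity, min_le_left _ _, ?_⟩
    calc _ ≤ 2 * η / (K + 1) * (K + 1) := by gcongr; exacts [min_le_right _ _, by linarith]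
      _ = 2 * η := by field_simp
  have hg1 : Maj r (η * r ^ 2) g := by
    refine hgM r _ (by positivity) fun g hgo hgM => ?_
    have e1 : ∀ i, Maj r (2 / r * (η * r ^ 2)) (pderiv ℝ i (diag (fun j => (φ j)⁻¹) g)) := fun i =>
      Maj.pderiv_of_diag hr0 (φ := φ) (hgo.diag _) (fun j hj => by
        rw [abs_of_pos (hφ0 j hj)]; have := hk j hj; simp only [hφ]; linarith) (by norm_num) i
        (by rwa [hinv hgo])
    have e2 : 2 / r * (η * r ^ 2) = 2 * η * r := by field_simp
    rw [e2] at e1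
    have e3 : ∀ i, Maj r ((Mq i + 2 * η) * r) (pderiv ℝ i (Q + diag (fun j => (φ j)⁻¹) g)) :=
      fun i => by
        rw [map_add]
        exact ((hMq i r hr0 hr.1).add hr0.le (e1 i)).mono (le_of_eq (by ring))
    have e4 := (Maj.sum hr0.le Finset.univ fun i _ => Maj.sum hr0.le Finset.univ fun j _ =>
      (((Maj.const (n := n) (r := r) (F.a₀ i j)).mul hr0.le (e1 i)).mul hr0.le (e1 j)).add hr0.le
        (((hMα i j r hr0 hr.1).mul hr0.le (e3 i)).mul hr0.le (e3 j))).smul (-(1 / 4))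
    refine e4.mono ?_
    have e5 : ∑ i, ∑ j, (|F.a₀ i j| * (2 * η * r) * (2 * η * r) +
        Mα i j * r ^ 1 * ((Mq i + 2 * η) * r) * ((Mq j + 2 * η) * r))
        = 4 * η ^ 2 * r ^ 2 * m + r ^ 3 * K := by
      rw [hm, hK]
      simp only [Finset.mul_sum, ← Finset.sum_add_distrib]
      exact Finset.sum_congr rfl fun i _ => Finset.sum_congr rfl fun j _ => by ring
    rw [e5, abs_neg, abs_of_pos (by norm_num : (0 : ℝ) < 1 / 4)]
    have e6 : η * m ≤ 1 / 2 := by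
      rw [hη, div_mul_eq_mul_div, one_mul, div_le_div_iff₀ (by positivity) (by norm_num)]; linarith
    have e7 : η * r ^ 2 * (η * m) ≤ η * r ^ 2 * (1 / 2) := by gcongr
    have e8 : r ^ 2 * (r * K) ≤ r ^ 2 * (2 * η) := mul_le_mul_of_nonneg_left hr.2 (by positivity)
    nlinarith
  refine ⟨r, hr0, by linarith [hr.1], Conv.of_maj (M := 1 * (η * r ^ 2)) ?_⟩
  refine hg1.diag hr0.le (fun j hj => ?_) hgo
  rw [abs_inv, abs_of_pos (hφ0 j hj)]
  refine inv_le_one_of_one_le₀ ?_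
  have := hk j hj; simp only [hφ]; linarith

theorem conv_field {ρ : ℝ} (ha : ∀ i j, Conv ρ (F.a i j)) {G : PS n} (hG : Conv ρ G) (i : Fin n) :
    Conv ρ (F.field G i) :=
  (Conv.sum _ fun j _ => (ha i j).mul (hG.pderiv j)).smul _

theorem conv_D {ρ : ℝ} (ha : ∀ i j, Conv ρ (F.a i j)) (hb : ∀ i, Conv ρ (F.b i)) {G : PS n}
    (hG : Conv ρ G) : Conv ρ (F.D G) :=
  ((Conv.sum _ fun i _ => Conv.sum _ fun j _ => (ha i j).mul ((hG.pderiv j).pderiv i)).smul _).add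
    ((Conv.sum _ fun i _ => (hb i).mul (hG.pderiv i)).smul _)

theorem field_sub_X_order {A : Matrix (Fin n) (Fin n) ℝ} (hA : A.IsSymm)
    (hAA : F.a₀ * A = 1) {E : PS n} (hE : OrdGE 3 E) (i : Fin n) :
    OrdGE 2 (F.field (quad A + E) i - X i) := by
  have e : F.field (quad A + E) i - X i = (1 / 2 : ℝ) • ∑ j, (C (F.a₀ i j) * pderiv ℝ j E
      + (F.a i j - C (F.a₀ i j)) * pderiv ℝ j (quad A + E)) := by
    have h := matrix_mul_pderiv_quad hA hAA i
    have h2 : X i = (1 / 2 : ℝ) • ∑ j, C (F.a₀ i j) * pderiv ℝ j (quad A) := by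
      rw [h, smul_half_two]
    rw [field, h2, ← smul_sub, ← Finset.sum_sub_distrib]
    congr 1
    refine Finset.sum_congr rfl fun j _ => ?_
    rw [map_add]; ring
  rw [e]
  refine OrdGE.smul _ (OrdGE.sum _ fun j _ => OrdGE.add ((hE.pderiv j).mul_left _) ?_)
  exact (OrdGE.sub_const _).mul
    (((quad_order A).add (hE.mono (by norm_num : 2 ≤ 3))).pderiv j)

/-- At the pole the Hessian of the world function is 2A, so the value of D is half the trace of a₀
A, that is n/2; the first-order term vanishes there with the gradient. -/
theorem D_sub_order {A : Matrix (Fin n) (Fin n) ℝ} (hA : A.IsSymm)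
    (hAA : F.a₀ * A = 1) {E : PS n} (hE : OrdGE 3 E) :
    OrdGE 1 (F.D (quad A + E) - C ((n : ℝ) / 2)) := by
  classical
  have h1 : ∀ i j, constantCoeff (pderiv ℝ i (pderiv ℝ j (quad A + E))) = 2 * A j i := fun i j => by
    rw [map_add, map_add, map_add, OrdGE.one_iff.1 ((hE.pderiv j).pderiv i), add_zero,
      pderiv_quad hA]
    have : ∀ k : Fin n, pderiv ℝ i (X k : PS n) = if k = i then 1 else 0 := fun k => by
      rw [pderiv_X, Pi.single_apply]
    have h2 : pderiv ℝ i (2 : PS n) = 0 := by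
      have := pderiv_C' i (2 : ℝ); rwa [map_ofNat] at this
    simp only [Derivation.leibniz, map_sum, this, pderiv_C', h2, smul_eq_mul, map_add, map_mul]
    simp
    exact Or.inl (map_ofNat _ 2)
  have h2 : ∀ i, constantCoeff (pderiv ℝ i (quad A + E)) = 0 := fun i =>
    OrdGE.one_iff.1 (((quad_order A).add (hE.mono (by norm_num : 2 ≤ 3))).pderiv i)
  have h3 : ∑ i, ∑ j, F.a₀ i j * A j i = n := by
    have := congrArg Matrix.trace hAA
    simpa [Matrix.trace, Matrix.mul_apply] using this
  rw [OrdGE.one_iff, D, map_sub, map_add, constantCoeff_smul, constantCoeff_smul]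
  simp only [map_sum, map_mul, h1, h2, mul_zero, Finset.sum_const_zero, smul_eq_mul, add_zero,
    constantCoeff_C]
  have h4 : ∑ i, ∑ j, constantCoeff (F.a i j) * (2 * A j i) = 2 * n := by
    rw [← h3]
    simp only [Finset.mul_sum, a₀]
    exact Finset.sum_congr rfl fun i _ => Finset.sum_congr rfl fun j _ => by ring
  rw [h4]; ring

/-- On small polydiscs the world function is in normal form. -/
theorem exists_normal {ρ : ℝ} (hρ : 0 < ρ) (ha : ∀ i j, Conv ρ (F.a i j))
    (hb : ∀ i, Conv ρ (F.b i)) {A : Matrix (Fin n) (Fin n) ℝ} (hA : A.IsSymm)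
    (hAA : F.a₀ * A = 1) {E : PS n} (hE : OrdGE 3 E) (hEc : Conv ρ E)
    (hEik : F.Eikonal (quad A + E)) : ∃ R > 0, R ≤ ρ / 2 ∧ F.Normal (quad A + E) R := by
  have hG : Conv ρ (quad A + E) := (conv_quad ρ A).add hEc
  choose M hM0 hM using fun i => ((conv_field ha hG i).sub (Conv.X i)).exists_maj_pow hρ
    (field_sub_X_order hA hAA hE i)
  obtain ⟨M', hM0', hM'⟩ := ((conv_D ha hb hG).sub (Conv.const _)).exists_maj_pow hρ
    (D_sub_order hA hAA hE)
  set m := ∑ i, M i with hm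
  have hm0 : 0 ≤ m := Finset.sum_nonneg fun i _ => hM0 i
  refine ⟨min (ρ / 2) (1 / (12 * (n + 1) * (m + M' + 1))), by positivity, min_le_left _ _,
    { toEikonal := hEik, order := (quad_order A).add (hE.mono (by norm_num : 2 ≤ 3)),
      field_order := field_sub_X_order hA hAA hE,
      D_order := D_sub_order hA hAA hE, field_maj := fun r hr hrR i => ?_,
      D_maj := fun r hr hrR => ?_ }⟩
  · have h1 := hrR.trans (min_le_right _ _)
    refine (hM i r hr (hrR.trans (min_le_left _ _))).mono ?_
    have h2 : M i ≤ m := Finset.single_le_sum (fun i _ => hM0 i) (Finset.mem_univ i)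
    rw [le_div_iff₀ (by positivity)] at h1 ⊢
    calc M i * r ^ 2 * (12 * (n + 1)) ≤ (m + M' + 1) * r ^ 2 * (12 * (n + 1)) := by
          gcongr; linarith
      _ = r * (r * (12 * (n + 1) * (m + M' + 1))) := by ring
      _ ≤ r * 1 := by gcongr
      _ = r := mul_one r
  · have h1 := hrR.trans (min_le_right _ _)
    refine (hM' r hr (hrR.trans (min_le_left _ _))).mono ?_
    rw [le_div_iff₀ (by positivity)] at h1
    have h3 : (0 : ℝ) ≤ n := n.cast_nonneg
    have h2 : r * (12 * (0 + 1) * (0 + M' + 0)) ≤ r * (12 * (n + 1) * (m + M' + 1)) := by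
      gcongr; norm_num
    nlinarith

end FormalOp

/-! ### Nagumo estimates and growth of the recursions -/

theorem expo_add_one (n : ℕ) : (n : ℝ) / 2 = expo n + 1 := by rw [expo]; ring

namespace FormalOp

variable {F : FormalOp n} {G : PS n}

/-- All coefficients have norm at most `A` on the polydisc of radius `R`. -/
structure Bdd (F : FormalOp n) (R A : ℝ) : Prop where
  a : ∀ i j, Maj R A (F.a i j)
  b : ∀ i, Maj R A (F.b i)
  c : Maj R A F.c

/-- The loss in two derivatives. -/
theorem Bdd.app_maj {R A : ℝ} (hF : F.Bdd R A) (hR1 : R ≤ 1) {r δ M : ℝ} (hr : 0 ≤ r) (hδ : 0 < δ)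
    (hrδ : r + 2 * δ ≤ R) {u : PS n} (hu : Maj (r + 2 * δ) M u) :
    Maj r ((n + 1) ^ 2 * A * (M / δ ^ 2)) (F.app u) := by
  have hA : 0 ≤ A := hF.c.nonneg
  have hM : 0 ≤ M := hu.nonneg
  have hrR : r ≤ R := by linarith
  have h1 : ∀ i, Maj (r + δ) (δ⁻¹ * M) (pderiv ℝ i u) := fun i => by
    have := hu.pderiv (r := r + δ) (by linarith) (by linarith) i
    rwa [show r + 2 * δ - (r + δ) = δ by ring] at this
  have h2 : ∀ i k, Maj r (M / δ ^ 2) (pderiv ℝ i (pderiv ℝ k u)) := fun i k => by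
    have := (h1 k).pderiv (r := r) hr (by linarith) i
    rw [show r + δ - r = δ by ring] at this
    exact this.mono (le_of_eq (by field_simp))
  have hδ1 : δ ≤ 1 := by linarith
  have h3 : ∀ i, Maj r (M / δ ^ 2) (pderiv ℝ i u) := fun i => by
    refine ((h1 i).of_le hr (by linarith)).mono ?_
    rw [← div_eq_inv_mul]
    exact div_le_div_of_nonneg_left hM (by positivity) (by nlinarith)
  have h4 : Maj r (M / δ ^ 2) u := by
    refine (hu.of_le hr (by linarith)).mono ?_
    rw [le_div_iff₀ (by positivity)]
    nlinarith [mul_nonneg hM (sub_nonneg.2 (show δ ^ 2 ≤ 1 by nlinarith))]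
  have h5 := ((Maj.sum hr Finset.univ fun i _ => Maj.sum hr Finset.univ fun k _ =>
    ((hF.a i k).of_le hr hrR).mul hr (h2 i k)).add hr (Maj.sum hr Finset.univ fun i _ =>
      ((hF.b i).of_le hr hrR).mul hr (h3 i))).add hr ((hF.c.of_le hr hrR).mul hr h4)
  refine h5.mono ?_
  simp only [Finset.sum_const, Finset.card_univ, Fintype.card_fin, nsmul_eq_mul]
  have h6 : 0 ≤ A * (M / δ ^ 2) := by positivity
  have h7 : (0 : ℝ) ≤ n := n.cast_nonneg
  nlinarith [mul_nonneg h7 h6]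

/-- The base is 1 + 1/(l + 1), so the power stays below e. -/
theorem pow_ratio_le (l : ℕ) : (((l : ℝ) + 2) / (l + 1)) ^ l ≤ 3 := by
  have h1 : ((l : ℝ) + 2) / (l + 1) = 1 / (l + 1) + 1 := by field_simp; ring
  have h2 : ((l : ℝ) + 2) / (l + 1) ≤ Real.exp (1 / (l + 1)) := by
    rw [h1]; exact Real.add_one_le_exp _
  calc (((l : ℝ) + 2) / (l + 1)) ^ l ≤ Real.exp (1 / (l + 1)) ^ l := by gcongr
    _ = Real.exp (l * (1 / (l + 1))) := by rw [← Real.exp_nat_mul]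
    _ ≤ Real.exp 1 := by
        apply Real.exp_le_exp.2
        rw [mul_one_div, div_le_one (by positivity)]; linarith
    _ ≤ 3 := by linarith [Real.exp_one_lt_d9]

/-- Nagumo's estimate: two derivatives of a series growing like `(R - r) ^ (-2 l)`. -/
theorem Bdd.app_nagumo {R A : ℝ} (hF : F.Bdd R A) (hR1 : R ≤ 1) {M K : ℝ} {l : ℕ}
    {u : PS n} (hu : ∀ r, 0 < r → r < R → Maj r (M * (K / (R - r) ^ 2) ^ l) u) {r : ℝ} (hr : 0 < r)
    (hrR : r < R) : Maj r (144 * ((n + 1) ^ 2 * A) * (l + 1) ^ 2 *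
      (M * K ^ l * (1 / (R - r) ^ 2) ^ (l + 1))) (F.app u) := by
  have h0 : 0 < R - r := sub_pos.2 hrR
  -- Two steps of size δ shrink the distance to R by the factor (l + 1)/(l + 2), whose 2l-th inverse
  -- power is at most 9. The cost δ⁻² = 4 (l + 2)²/(R - r)² is at most 16 (l + 1)²/(R - r)²; hence
  -- 144 = 16 · 9.
  set δ := (R - r) / (2 * (l + 2)) with hδ
  have hδ0 : 0 < δ := by positivity
  have h2δ : 2 * δ = (R - r) / (l + 2) := by rw [hδ]; field_simp
  have e1 : R - (r + 2 * δ) = (R - r) * ((l + 1) / (l + 2)) := by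
    rw [h2δ]; field_simp; ring
  have e2 : r + 2 * δ < R := by
    rw [← sub_pos, e1]; positivity
  have e3 := hF.app_maj hR1 hr.le hδ0 e2.le (hu _ (by positivity) e2)
  refine e3.mono ?_
  have hA : 0 ≤ A := hF.c.nonneg
  have hM : 0 ≤ M * K ^ l := by
    have := (hu r hr hrR).nonneg
    rw [div_pow, mul_div_assoc'] at this
    by_contra hneg
    exact absurd this (not_le.2 (div_neg_of_neg_of_pos (not_le.1 hneg) (by positivity)))
  have e4 : M * (K / (R - (r + 2 * δ)) ^ 2) ^ l / δ ^ 2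
      = M * K ^ l * (1 / (R - r) ^ 2) ^ (l + 1) * (4 * (l + 2) ^ 2)
        * ((((l : ℝ) + 2) / (l + 1)) ^ l) ^ 2 := by
    rw [e1, hδ, ← pow_mul, mul_comm l 2, pow_mul]
    simp only [div_pow, mul_pow, pow_succ]
    field_simp
    ring
  rw [e4]
  have e5 : ((((l : ℝ) + 2) / (l + 1)) ^ l) ^ 2 ≤ 9 := by
    have := pow_ratio_le l
    have h1 : 0 ≤ (((l : ℝ) + 2) / (l + 1)) ^ l := by positivity
    nlinarith
  have e6 : (4 * ((l : ℝ) + 2) ^ 2) ≤ 16 * (l + 1) ^ 2 := by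
    have : (0 : ℝ) ≤ l := l.cast_nonneg
    nlinarith
  have e7 : 0 ≤ M * K ^ l * (1 / (R - r) ^ 2) ^ (l + 1) := by positivity
  calc (n + 1) ^ 2 * A * (M * K ^ l * (1 / (R - r) ^ 2) ^ (l + 1) * (4 * (l + 2) ^ 2)
        * ((((l : ℝ) + 2) / (l + 1)) ^ l) ^ 2)
      ≤ (n + 1) ^ 2 * A * (M * K ^ l * (1 / (R - r) ^ 2) ^ (l + 1) * (16 * (l + 1) ^ 2) * 9) := by
        gcongr
    _ = _ := by ring

/-- Geometric growth of a sequence defined by a recursion with a gain of `(l + 1) ^ (-2)`. -/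
theorem Bdd.recursion_bound {R A : ℝ} (hF : F.Bdd R A) (hR1 : R ≤ 1) {u : ℕ → PS n} {M₀ c B K₀ : ℝ}
    (hc : 0 ≤ c) (hB : 0 ≤ B) (hK₀ : 0 ≤ K₀) (h0 : ∀ r, 0 < r → r < R → Maj r M₀ (u 0))
    (hs : ∀ l r N, 0 < r → r < R → Maj r N (F.app (u l)) →
      Maj r (c / (l + 1) ^ 2 * N + B * (K₀ / (R - r) ^ 2) ^ (l + 1)) (u (l + 1))) :
    ∃ M K, 0 ≤ M ∧ 0 ≤ K ∧ ∀ l r, 0 < r → r < R → Maj r (M * (K / (R - r) ^ 2) ^ l) (u l) := by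
  have hA : 0 ≤ A := hF.c.nonneg
  -- K is large enough for the recursive term to use only half of the new bound; since M ≥ 2B and K
  -- ≥ K₀, the forcing term fits in the other half.
  set K := K₀ + 2 * c * (144 * ((n + 1) ^ 2 * A)) with hK
  have hK0 : 0 ≤ K := by positivity
  refine ⟨|M₀| + 2 * B, K, by positivity, hK0, fun l => ?_⟩
  set M := |M₀| + 2 * B with hM
  have hM0 : 0 ≤ M := by positivity
  induction l with
  | zero =>
    intro r hr hrR
    refine (h0 r hr hrR).mono ?_
    rw [pow_zero, mul_one]
    linarith [le_abs_self M₀]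
  | succ l ih =>
    intro r hr hrR
    refine (hs l r _ hr hrR (hF.app_nagumo hR1 ih hr hrR)).mono ?_
    have hp : 0 ≤ (1 / (R - r) ^ 2) ^ (l + 1) := by positivity
    have e1 : ∀ k : ℝ, (k / (R - r) ^ 2) ^ (l + 1) = k ^ (l + 1) * (1 / (R - r) ^ 2) ^ (l + 1) :=
      fun k => by rw [← mul_pow, mul_one_div]
    rw [e1 K₀, e1 K]
    have e2 : c / (l + 1) ^ 2 * (144 * ((n + 1) ^ 2 * A) * (l + 1) ^ 2 *
        (M * K ^ l * (1 / (R - r) ^ 2) ^ (l + 1)))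
        = (c * (144 * ((n + 1) ^ 2 * A))) * M * K ^ l * (1 / (R - r) ^ 2) ^ (l + 1) := by
      field_simp
    rw [e2]
    have e3 : c * (144 * ((n + 1) ^ 2 * A)) * M * K ^ l ≤ K / 2 * M * K ^ l := by
      gcongr; rw [hK]; linarith
    have e4 : B * K₀ ^ (l + 1) ≤ M / 2 * K ^ (l + 1) := by
      have : 0 ≤ 2 * c * (144 * ((n + 1) ^ 2 * A)) := by positivity
      gcongr
      · rw [hM]; linarith [abs_nonneg M₀]
      · rw [hK]; linarith
    calc c * (144 * ((n + 1) ^ 2 * A)) * M * K ^ l * (1 / (R - r) ^ 2) ^ (l + 1)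
          + B * (K₀ ^ (l + 1) * (1 / (R - r) ^ 2) ^ (l + 1))
        = (c * (144 * ((n + 1) ^ 2 * A)) * M * K ^ l + B * K₀ ^ (l + 1))
          * (1 / (R - r) ^ 2) ^ (l + 1) := by ring
      _ ≤ (K / 2 * M * K ^ l + M / 2 * K ^ (l + 1)) * (1 / (R - r) ^ 2) ^ (l + 1) := by gcongr
      _ = _ := by ring

theorem exists_seq_of_step {α : Type*} (P : ℕ → α → α → Prop) (h : ∀ l x, ∃ y, P l x y) (x₀ : α) :
    ∃ u : ℕ → α, u 0 = x₀ ∧ ∀ l, P l (u l) (u (l + 1)) := by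
  choose f hf using h
  exact ⟨fun l => Nat.rec x₀ (fun l x => f l x) l, rfl, fun l => hf l _⟩

/-- The recursion `T (l - 1 - μ) u_l = - F u_{l-1} / (4 (l - μ)) + g_l`. -/
theorem Normal.exists_frobenius {R : ℝ} (h : F.Normal G R) {μ : ℝ} (hμ : μ ≤ expo n) (u₀ : PS n)
    (g : ℕ → PS n) :
    ∃ u : ℕ → PS n, u 0 = u₀ ∧ ∀ l : ℕ,
      F.T G (((l + 1 : ℕ) : ℝ) - μ - 1) (u (l + 1))
        = -(1 / (4 * (((l + 1 : ℕ) : ℝ) - μ))) • F.app (u l) + g l ∧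
      ∀ r N N', 0 < r → r ≤ R → Maj r N (F.app (u l)) → Maj r N' (g l) →
        Maj r (2 * (|1 / (4 * (((l + 1 : ℕ) : ℝ) - μ))| * N + N') / (l + 1)) (u (l + 1)) := by
  refine exists_seq_of_step (fun l x y => F.T G (((l + 1 : ℕ) : ℝ) - μ - 1) y
        = -(1 / (4 * (((l + 1 : ℕ) : ℝ) - μ))) • F.app x + g l ∧
      ∀ r N N', 0 < r → r ≤ R → Maj r N (F.app x) → Maj r N' (g l) →
        Maj r (2 * (|1 / (4 * (((l + 1 : ℕ) : ℝ) - μ))| * N + N') / (l + 1)) y) (fun l x => ?_) u₀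
  have hl : (0 : ℝ) ≤ l := l.cast_nonneg
  -- The indicial constant is l + 1 + (m - μ) ≥ l + 1 with m = n/2 - 1: there is no resonance in the
  -- transport operator, and its inverse supplies one of the two factors 1/(l + 1).
  obtain ⟨y, -, hy, hyM⟩ := h.transport_exists (κ := ((l + 1 : ℕ) : ℝ) + (expo n - μ)) (d := 0)
    (by push_cast; linarith) (fun k _ => by
      have : (0 : ℝ) ≤ k := k.cast_nonneg
      push_cast; linarith)
    (OrdGE.zero_left (-(1 / (4 * (((l + 1 : ℕ) : ℝ) - μ))) • F.app x + g l))
  refine ⟨y, ?_, fun r N N' hr hrR hN hN' => ?_⟩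
  · rw [← hy, expo_add_one]; congr 1; ring
  · have hN0 := hN.nonneg
    have hN0' := hN'.nonneg
    have h1 := (hN.smul (-(1 / (4 * (((l + 1 : ℕ) : ℝ) - μ))))).add hr.le hN'
    rw [abs_neg] at h1
    refine (hyM r _ hr hrR h1).mono ?_
    refine div_le_div_of_nonneg_left (by positivity) (by positivity) ?_
    push_cast; linarith

end FormalOp

/-! ### Summation of series in powers of Γ and the equations satisfied by the sums -/

/-- Fubini for the absolutely summable double family indexed by the term and by the exponent:
summing exponents first gives the values of the terms, summing terms first gives the formal sum. -/
theorem hasSum_fn_fsum {r : ℝ} {M : ℕ → ℝ} {u : ℕ → PS n} (ho : ∀ l, OrdGE l (u l))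
    (hu : ∀ l, Maj r (M l) (u l)) (hM : Summable M) {ξ x : Fin n → ℝ} (hx : ‖x - ξ‖ ≤ r) :
    HasSum (fun l => fn ξ (u l) x) (fn ξ (fsum u) x) := by
  set z := x - ξ with hz
  have hf : Summable fun p : ℕ × (Fin n →₀ ℕ) => coeff p.2 (u p.1) * mon p.2 z := by
    refine Summable.of_norm ((summable_prod_of_nonneg fun p => norm_nonneg _).2 ⟨fun l => ?_, ?_⟩)
    · exact (hu l).summable_abs hx
    · refine Summable.of_nonneg_of_le (fun l => tsum_nonneg fun α => norm_nonneg _) (fun l => ?_) hM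
      refine ((hu l).summable_abs hx).tsum_le_of_sum_le fun s => le_trans ?_ (hu l s)
      refine Finset.sum_le_sum fun α _ => ?_
      rw [abs_mul]
      exact mul_le_mul_of_nonneg_left (abs_mon_le α hx) (abs_nonneg _)
  have h1 := hf.hasSum.prod_fiberwise fun l => (hu l).hasSum hx
  have h2 : ∑' p : ℕ × (Fin n →₀ ℕ), coeff p.2 (u p.1) * mon p.2 z = fn ξ (fsum u) x := by
    have hs := hf.prod_symm
    rw [← (Equiv.prodComm (Fin n →₀ ℕ) ℕ).tsum_eq, fn, ev]
    refine (Summable.tsum_prod hs).trans (tsum_congr fun α => ?_)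
    simp only [Prod.swap_prod_mk]
    rw [tsum_mul_right, coeff_fsum, tsum_eq_sum (s := Finset.range (α.degree + 1))]
    intro l hl
    exact ho l α (by simpa using hl)
  rwa [h2] at h1

theorem tendstoUniformlyOn_fn_fsum {r : ℝ} {M : ℕ → ℝ} {u : ℕ → PS n} (ho : ∀ l, OrdGE l (u l))
    (hu : ∀ l, Maj r (M l) (u l)) (hM : Summable M) (ξ : Fin n → ℝ) :
    TendstoUniformlyOn (fun L x => ∑ l ∈ Finset.range L, fn ξ (u l) x) (fn ξ (fsum u)) atTop
      (ball ξ r) := by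
  have h1 : ∀ x ∈ ball ξ r, ‖x - ξ‖ ≤ r := fun x hx => by
    rw [mem_ball_iff_norm] at hx; exact hx.le
  refine (tendstoUniformlyOn_tsum_nat hM fun l x hx => (hu l).abs_ev_le (h1 x hx)).congr_right ?_
  intro x hx
  exact (hasSum_fn_fsum ho hu hM (h1 x hx)).tsum_eq

theorem Conv.of_pos {R : ℝ} {c : PS n} (h : ∀ r, 0 < r → r < R → ∃ M, Maj r M c) : Conv R c := by
  intro r hr hrR
  rcases hr.eq_or_lt with rfl | hr
  · obtain ⟨M, hM⟩ := h (R / 2) (by linarith) (by linarith)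
    exact ⟨M, hM.of_le le_rfl (by linarith)⟩
  · exact h r hr hrR

/-- If `u_l = O(Q ^ l)` on a polydisc then `∑ G ^ l u_l` converges on a smaller one. -/
theorem exists_series_radius {R : ℝ} (hR : 0 < R) {G : PS n} (hG : Conv R G) (hGo : OrdGE 2 G)
    {u : ℕ → PS n} {M Q : ℝ} (hQ : 0 ≤ Q)
    (hu : ∀ l r, 0 < r → r ≤ R / 2 → Maj r (M * Q ^ l) (u l)) :
    ∃ r₀ > 0, r₀ ≤ R / 2 ∧ ∀ r, 0 < r → r ≤ r₀ →
      ∀ l, Maj r (M * (1 / 2) ^ l) (G ^ l * u l) := by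
  obtain ⟨N, hN0, hN⟩ := hG.exists_maj_pow hR hGo
  have hM : 0 ≤ M := by simpa using (hu 0 (R / 2) (by positivity) le_rfl).nonneg
  refine ⟨min (min (R / 2) 1) (1 / (2 * (N * Q + 1))), by positivity,
    (min_le_left _ _).trans (min_le_left _ _), fun r hr hr0 l => ?_⟩
  have h1 : r ≤ R / 2 := hr0.trans ((min_le_left _ _).trans (min_le_left _ _))
  have h2 : r ≤ 1 := hr0.trans ((min_le_left _ _).trans (min_le_right _ _))
  have h3 : r ≤ 1 / (2 * (N * Q + 1)) := hr0.trans (min_le_right _ _)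
  refine (((hN r hr h1).pow hr.le l).mul hr.le (hu l r hr h1)).mono ?_
  have hNQ : 0 ≤ N * Q := by positivity
  rw [le_div_iff₀ (by positivity)] at h3
  have h4 : N * r ^ 2 * Q ≤ 1 / 2 := by nlinarith
  calc (N * r ^ 2) ^ l * (M * Q ^ l) = M * (N * r ^ 2 * Q) ^ l := by rw [mul_pow _ Q]; ring
    _ ≤ M * (1 / 2) ^ l := by gcongr

theorem summable_const_mul_half (M : ℝ) : Summable fun l : ℕ => M * (1 / 2 : ℝ) ^ l :=
  summable_geometric_two.mul_left M

namespace FormalOp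

variable {F : FormalOp n} {G : PS n}

theorem Bdd.conv_app {R A : ℝ} (hF : F.Bdd R A) {u : PS n} (hu : Conv R u) : Conv R (F.app u) :=
  ((Conv.sum _ fun i _ => Conv.sum _ fun k _ =>
    (Conv.of_maj (hF.a i k)).mul ((hu.pderiv k).pderiv i)).add
    (Conv.sum _ fun i _ => (Conv.of_maj (hF.b i)).mul (hu.pderiv i))).add
    ((Conv.of_maj hF.c).mul hu)

/-- The first Hadamard coefficient. -/
theorem Normal.exists_U₀ {R : ℝ} (h : F.Normal G R) (P : ℝ) :
    ∃ u : PS n, constantCoeff u = P ∧ F.T G (-expo n - 1) u = 0 ∧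
      ∀ r, 0 < r → r ≤ R → Maj r (2 * |P|) u := by
  -- The indicial exponent vanishes in degree 0, so a constant solves the equation up to order one;
  -- the error is corrected by a solution of order one, where k ≥ 1 is invertible.
  have e1 : F.T G (0 - (n : ℝ) / 2) (C P) = (F.D G - C ((n : ℝ) / 2)) * C P := by
    rw [T, L_C, zero_sub, map_neg]; ring
  have ho : OrdGE 1 (F.T G (0 - (n : ℝ) / 2) (C P)) := by
    rw [e1, mul_comm]; exact h.D_order.mul_left _
  obtain ⟨v, hvo, hv, hvM⟩ := h.transport_exists (κ := 0) (d := 1) (by norm_num)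
    (fun k _ => by have : (0 : ℝ) ≤ k := k.cast_nonneg; linarith) ho
  refine ⟨C P - v, ?_, ?_, fun r hr hrR => ?_⟩
  · rw [map_sub, OrdGE.one_iff.1 hvo, constantCoeff_C, sub_zero]
  · rw [show -expo n - 1 = 0 - (n : ℝ) / 2 by rw [expo]; ring, T_sub, hv, sub_self]
  · have h1 := (h.D_maj r hr hrR).mul hr.le (Maj.const (n := n) (r := r) P)
    rw [← e1] at h1
    refine ((Maj.const P).sub hr.le (hvM r _ hr hrR h1)).mono ?_
    have := abs_nonneg P
    push_cast; linarith

/-- Partial sums of the Frobenius recursion. -/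
theorem frobenius_partial (h : F.Eikonal G) (μ : ℝ) {u : ℕ → PS n}
    (h0 : μ = 0 ∨ F.T G (-μ - 1) (u 0) = 0) (L : ℕ)
    (hu : ∀ l < L, C (4 * (((l + 1 : ℕ) : ℝ) - μ)) * F.T G (((l + 1 : ℕ) : ℝ) - μ - 1) (u (l + 1))
      = -F.app (u l)) :
    G * F.app (∑ l ∈ Finset.range (L + 1), G ^ l * u l)
      - C (4 * μ) * F.T G (-μ - 1) (∑ l ∈ Finset.range (L + 1), G ^ l * u l)
      = G ^ (L + 1) * F.app (u L) := by
  -- The left-hand side is the coefficient of Γ^(-μ) in Γ F[Γ^(-μ) S]. The recursion cancels the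
  -- contribution of each new term against the remainder of the previous sum, so only the image of
  -- the last coefficient survives.
  induction L with
  | zero =>
    simp only [zero_add, Finset.range_one, Finset.sum_singleton, pow_zero, one_mul, pow_one]
    rcases h0 with rfl | h0
    · simp
    · rw [h0]; simp
  | succ L ih =>
    rw [Finset.sum_range_succ, app_add, T_add, mul_add, mul_add]
    have e1 := ih fun l hl => hu l (by omega)
    have e2 := hu L (by omega)
    have e3 := app_world_pow_mul h L (u (L + 1))
    have e4 := T_world_pow_mul h (-μ - 1) (L + 1) (u (L + 1))
    rw [e3, e4]
    have e5 : F.L G (u (L + 1)) = F.T G (((L + 1 : ℕ) : ℝ) - μ - 1) (u (L + 1))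
        - (F.D G + C (((L + 1 : ℕ) : ℝ) - μ - 1)) * u (L + 1) := by rw [T]; ring
    have e6 : F.T G (-μ - 1 + 2 * ((L + 1 : ℕ) : ℝ)) (u (L + 1))
        = F.T G (((L + 1 : ℕ) : ℝ) - μ - 1) (u (L + 1)) + C ((L + 1 : ℕ) : ℝ) * u (L + 1) := by
      rw [← T_add_const]; congr 1; ring
    rw [e5, e6]
    simp only [map_mul, map_sub, map_one, map_natCast, map_ofNat] at e1 e2 ⊢
    push_cast at e1 e2 ⊢
    linear_combination e1 + G ^ (L + 1) * e2

/-- The remainders of the partial sums have order tending to infinity: F lowers the order by at most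
two, which the factor G restores. For μ = 0 the transport term is absent, so nothing is required of
u₀. -/
theorem frobenius_sum {R : ℝ} (h : F.Normal G R) (μ : ℝ) {u : ℕ → PS n}
    (h0 : μ = 0 ∨ F.T G (-μ - 1) (u 0) = 0)
    (hu : ∀ l : ℕ, C (4 * (((l + 1 : ℕ) : ℝ) - μ)) *
      F.T G (((l + 1 : ℕ) : ℝ) - μ - 1) (u (l + 1)) = -F.app (u l)) :
    G * F.app (fsum fun l => G ^ l * u l)
      - C (4 * μ) * F.T G (-μ - 1) (fsum fun l => G ^ l * u l) = 0 := by
  have ho : ∀ l, OrdGE l (G ^ l * u l) := fun l =>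
    ((h.order.pow l).mul (OrdGE.zero_left _)).mono (by omega)
  have hf1 : ∀ i, OrdGE 1 (F.field G i) := fun i => by
    have := (OrdGE.X i).add ((h.field_order i).mono (by norm_num : 1 ≤ 2)); simpa using this
  refine OrdGE.eq_zero fun L => ?_
  set S := fsum fun l => G ^ l * u l
  set SL := ∑ l ∈ Finset.range (L + 1), G ^ l * u l
  have h1 : OrdGE (L + 1) (S - SL) := fsum_sub_range ho (L + 1)
  have h2 : OrdGE L (G * F.app (S - SL)) := by
    rcases L with _ | L
    · exact OrdGE.zero_left _
    · exact (h.order.mul (app_sub_order L h1)).mono (by omega)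
  have h3 : OrdGE L (F.T G (-μ - 1) (S - SL)) :=
    (((L_order hf1 _ h1).add (h1.mul_left _)).mono (Nat.le_succ L))
  have h4 := frobenius_partial h.toEikonal μ h0 L fun l _ => hu l
  have h5 : OrdGE L (G ^ (L + 1) * F.app (u L)) :=
    ((h.order.pow (L + 1)).mul (OrdGE.zero_left _)).mono (by omega)
  have h6 := (h2.sub (h3.mul_left (C (4 * μ)))).add h5
  rw [← h4, app_sub, T_sub] at h6
  convert h6 using 1; ring

/-- The equation satisfied by the regular part `∑ G ^ l w_l` which compensates the logarithmic
term. -/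
theorem log_partial (h : F.Eikonal G) {u : PS n} {v w : ℕ → PS n} (hw0 : w 0 = 0)
    (hv0 : 4 * F.T G (-1) (v 0) = -F.app u)
    (hw : ∀ l : ℕ, C (4 * ((l + 1 : ℕ) : ℝ)) * F.T G (((l + 1 : ℕ) : ℝ) - 1) (w (l + 1))
      = -F.app (w l) - 4 * F.T G (2 * ((l + 1 : ℕ) : ℝ) - 1) (v (l + 1))) (L : ℕ) :
    F.app u + 4 * F.T G (-1) (∑ l ∈ Finset.range (L + 1), G ^ l * v l)
      + G * F.app (∑ l ∈ Finset.range (L + 1), G ^ l * w l) = G ^ (L + 1) * F.app (w L) := by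
  -- With u = U_(m-1), the left-hand side collects the terms of Γ F[R] free of log Γ that remain
  -- once the sum of negative powers has been reduced to its remainder F[u]; it telescopes as the
  -- partial sums grow.
  induction L with
  | zero => simp [hw0, hv0, app_zero]
  | succ L ih =>
    rw [Finset.sum_range_succ, Finset.sum_range_succ (fun l => G ^ l * w l), app_add, T_add,
      app_world_pow_mul h L, T_world_pow_mul h]
    have e2 := hw L
    have e5 : F.L G (w (L + 1)) = F.T G (((L + 1 : ℕ) : ℝ) - 1) (w (L + 1))
        - (F.D G + C (((L + 1 : ℕ) : ℝ) - 1)) * w (L + 1) := by rw [T]; ring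
    rw [e5, show (-1 : ℝ) + 2 * ((L + 1 : ℕ) : ℝ) = 2 * ((L + 1 : ℕ) : ℝ) - 1 by ring]
    simp only [map_mul, map_sub, map_one, map_natCast, map_ofNat] at e2 ⊢
    push_cast at e2 ih ⊢
    linear_combination ih + G ^ (L + 1) * e2

theorem log_sum {R : ℝ} (h : F.Normal G R) {u : PS n} {v w : ℕ → PS n} (hw0 : w 0 = 0)
    (hv0 : 4 * F.T G (-1) (v 0) = -F.app u)
    (hw : ∀ l : ℕ, C (4 * ((l + 1 : ℕ) : ℝ)) * F.T G (((l + 1 : ℕ) : ℝ) - 1) (w (l + 1))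
      = -F.app (w l) - 4 * F.T G (2 * ((l + 1 : ℕ) : ℝ) - 1) (v (l + 1))) :
    F.app u + 4 * F.T G (-1) (fsum fun l => G ^ l * v l)
      + G * F.app (fsum fun l => G ^ l * w l) = 0 := by
  have ho : ∀ (u : ℕ → PS n) l, OrdGE l (G ^ l * u l) := fun u l =>
    ((h.order.pow l).mul (OrdGE.zero_left _)).mono (by omega)
  have hf1 : ∀ i, OrdGE 1 (F.field G i) := fun i => by
    have := (OrdGE.X i).add ((h.field_order i).mono (by norm_num : 1 ≤ 2)); simpa using this
  refine OrdGE.eq_zero fun L => ?_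
  set V := fsum fun l => G ^ l * v l
  set W := fsum fun l => G ^ l * w l
  set VL := ∑ l ∈ Finset.range (L + 1), G ^ l * v l
  set WL := ∑ l ∈ Finset.range (L + 1), G ^ l * w l
  have h1 : OrdGE (L + 1) (V - VL) := fsum_sub_range (ho v) (L + 1)
  have h1' : OrdGE (L + 1) (W - WL) := fsum_sub_range (ho w) (L + 1)
  have h2 : OrdGE L (G * F.app (W - WL)) := by
    rcases L with _ | L
    · exact OrdGE.zero_left _
    · exact (h.order.mul (app_sub_order L h1')).mono (by omega)
  have h3 : OrdGE L (F.T G (-1) (V - VL)) :=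
    (((L_order hf1 _ h1).add (h1.mul_left _)).mono (Nat.le_succ L))
  have h4 := log_partial h.toEikonal hw0 hv0 hw L
  have h5 : OrdGE L (G ^ (L + 1) * F.app (w L)) :=
    ((h.order.pow (L + 1)).mul (OrdGE.zero_left _)).mono (by omega)
  have h6 := ((h3.mul_left 4).add h2).add h5
  rw [← h4, app_sub, T_sub] at h6
  convert h6 using 1; ring

theorem _root_.HadamardFS.C_mul_C_inv {t : ℝ} (ht : t ≠ 0) (u : PS n) : C t * ((1 / t) • u) = u := by
  rw [smul_eq_C_mul, ← mul_assoc, ← map_mul, mul_one_div_cancel ht, map_one, one_mul]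

end FormalOp

/-- Geometric growth of a sequence of series on half the polydisc of radius `ρ`. -/
def Growth (ρ : ℝ) (u : ℕ → PS n) : Prop :=
  ∃ M Q, 0 ≤ Q ∧ ∀ l r, 0 < r → r ≤ ρ / 2 → Maj r (M * Q ^ l) (u l)

theorem Growth.of_bound {R M K : ℝ} (hR : 0 < R) (hK : 0 ≤ K) {u : ℕ → PS n}
    (h : ∀ l r, 0 < r → r < R → Maj r (M * (K / (R - r) ^ 2) ^ l) (u l)) : Growth R u := by
  have hM : 0 ≤ M := by simpa using (h 0 (R / 2) (by positivity) (by linarith)).nonneg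
  refine ⟨M, K / (R / 2) ^ 2, by positivity, fun l r hr hrR => ?_⟩
  refine (h l r hr (by linarith)).mono ?_
  have : R / 2 ≤ R - r := by linarith
  gcongr

theorem Growth.succ {ρ : ℝ} {u : ℕ → PS n} (h : Growth ρ u) : Growth ρ fun l => u (l + 1) := by
  obtain ⟨M, Q, hQ, h⟩ := h
  refine ⟨M * Q, Q, hQ, fun l r hr hrρ => (h (l + 1) r hr hrρ).mono (le_of_eq ?_)⟩
  ring

theorem abs_inv_sub_expo_le (n l : ℕ) :
    |1 / (4 * (((l + 1 : ℕ) : ℝ) - expo n))| ≤ (n + 1) / (l + 1) := by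
  have hl : (0 : ℝ) ≤ l := l.cast_nonneg
  have hn : (0 : ℝ) ≤ n := n.cast_nonneg
  have e : 4 * (((l + 1 : ℕ) : ℝ) - expo n) = 2 * ((2 * (l + 1) - n + 2 : ℤ) : ℝ) := by
    rw [expo]; push_cast; ring
  rw [e]
  set N : ℤ := 2 * (l + 1) - n + 2 with hN
  -- At the resonance l + 1 = m the quotient has the default value 0 and the bound is trivial;
  -- otherwise twice the integer N is at least 2 in absolute value, and for large l it exceeds l +
  -- 1.
  rcases eq_or_ne N 0 with h0 | h0
  · rw [h0]; simp; positivity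
  · have h1 : (1 : ℝ) ≤ |(N : ℝ)| := by
      rw [← Int.cast_abs]; exact_mod_cast Int.one_le_abs h0
    rw [abs_div, abs_one, abs_mul, abs_two, div_le_div_iff₀ (by positivity) (by positivity), one_mul]
    rcases le_or_gt n (l + 1) with h | h
    · have h' : (n : ℝ) ≤ l + 1 := by exact_mod_cast h
      have h2 : (l : ℝ) + 1 ≤ |(N : ℝ)| := by
        refine le_trans ?_ (le_abs_self _)
        rw [hN]; push_cast; linarith
      nlinarith
    · have h' : (l : ℝ) + 1 ≤ n := by exact_mod_cast h.le
      nlinarith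

namespace FormalOp

variable {F : FormalOp n} {G : PS n}

theorem Normal.mono {R R' : ℝ} (h : F.Normal G R) (hR : R' ≤ R) : F.Normal G R' :=
  { h with
    field_maj := fun r hr hrR => h.field_maj r hr (hrR.trans hR)
    D_maj := fun r hr hrR => h.D_maj r hr (hrR.trans hR) }

theorem Bdd.mono {R R' A : ℝ} (h : F.Bdd R A) (h0 : 0 ≤ R') (hR : R' ≤ R) : F.Bdd R' A :=
  ⟨fun i j => (h.a i j).of_le h0 hR, fun i => (h.b i).of_le h0 hR, h.c.of_le h0 hR⟩

/-- The Frobenius recursion together with the growth of its solution. -/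
theorem Normal.exists_growth {R A : ℝ} (hR1 : R ≤ 1) (h : F.Normal G R)
    (hF : F.Bdd R A) {μ c M₀ : ℝ} (hμ : μ ≤ expo n) (hc0 : 0 ≤ c)
    (hc : ∀ l : ℕ, |1 / (4 * (((l + 1 : ℕ) : ℝ) - μ))| ≤ c / (l + 1)) {u₀ : PS n}
    (hu₀ : ∀ r, 0 < r → r < R → Maj r M₀ u₀) {g : ℕ → PS n} {B K₀ : ℝ} (hB : 0 ≤ B) (hK₀ : 0 ≤ K₀)
    (hg : ∀ l r, 0 < r → r < R → Maj r (B * (K₀ / (R - r) ^ 2) ^ (l + 1)) (g l)) :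
    ∃ u : ℕ → PS n, u 0 = u₀ ∧ (∀ l : ℕ, F.T G (((l + 1 : ℕ) : ℝ) - μ - 1) (u (l + 1))
        = -(1 / (4 * (((l + 1 : ℕ) : ℝ) - μ))) • F.app (u l) + g l) ∧
      ∃ M K, 0 ≤ M ∧ 0 ≤ K ∧ ∀ l r, 0 < r → r < R → Maj r (M * (K / (R - r) ^ 2) ^ l) (u l) := by
  obtain ⟨u, hu0, hu⟩ := h.exists_frobenius hμ u₀ g
  refine ⟨u, hu0, fun l => (hu l).1, ?_⟩
  refine hF.recursion_bound hR1 (c := 2 * c) (B := 2 * B) (K₀ := K₀) (by positivity) (by positivity)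
    hK₀ (by rwa [hu0]) fun l r N hr hrR hN => ?_
  refine ((hu l).2 r N _ hr hrR.le hN (hg l r hr hrR)).mono ?_
  have hN0 := hN.nonneg
  have hl : (0 : ℝ) ≤ l := l.cast_nonneg
  have e1 : |1 / (4 * (((l + 1 : ℕ) : ℝ) - μ))| * N ≤ c / (l + 1) * N := by gcongr; exact hc l
  have e2 : 0 ≤ B * (K₀ / (R - r) ^ 2) ^ (l + 1) := by positivity
  rw [mul_add, add_div]
  refine add_le_add ?_ ?_
  · calc 2 * (|1 / (4 * (((l + 1 : ℕ) : ℝ) - μ))| * N) / (l + 1)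
        ≤ 2 * (c / (l + 1) * N) / (l + 1) := by gcongr
      _ = _ := by field_simp
  · rw [div_le_iff₀ (by positivity)]
    nlinarith

/-- The Hadamard coefficients `U_l`. -/
theorem Normal.exists_U {R A : ℝ} (hR : 0 < R) (hR1 : R ≤ 1) (h : F.Normal G R)
    (hF : F.Bdd R A) (P : ℝ) :
    ∃ u : ℕ → PS n, constantCoeff (u 0) = P ∧ F.T G (-expo n - 1) (u 0) = 0 ∧
      (∀ l : ℕ, F.T G (((l + 1 : ℕ) : ℝ) - expo n - 1) (u (l + 1))
        = -(1 / (4 * (((l + 1 : ℕ) : ℝ) - expo n))) • F.app (u l)) ∧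
      (∀ l, Conv R (u l)) ∧ Growth R u := by
  obtain ⟨u₀, h1, h2, h3⟩ := h.exists_U₀ P
  obtain ⟨u, hu0, hu, M, K, -, hK, hM⟩ := h.exists_growth hR1 hF (g := fun _ => 0) (B := 0)
    (K₀ := 0) le_rfl (by positivity) (abs_inv_sub_expo_le n) (fun r hr hrR => h3 r hr hrR.le) le_rfl
    le_rfl (fun l r _ _ => by rw [zero_mul]; exact Maj.zero)
  refine ⟨u, by rw [hu0, h1], by rw [hu0, h2], fun l => by rw [hu l, add_zero],
    fun l => Conv.of_pos fun r hr hrR => ⟨_, hM l r hr hrR⟩, Growth.of_bound hR hK hM⟩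

/-- The coefficients `V_l` of the logarithmic term and `W_l` of the regular term. -/
theorem Normal.exists_V_W {R A : ℝ} (hR : 0 < R) (hR1 : R ≤ 1) (h : F.Normal G R)
    (hF : F.Bdd R A) (hn : 4 ≤ n) {u : PS n} {N₀ : ℝ} (hu : Maj R N₀ (F.app u)) :
    ∃ v w : ℕ → PS n, F.T G (-1) (v 0) = -(1 / 4 : ℝ) • F.app u ∧
      (∀ l : ℕ, F.T G (((l + 1 : ℕ) : ℝ) - 1) (v (l + 1))
        = -(1 / (4 * ((l + 1 : ℕ) : ℝ))) • F.app (v l)) ∧ w 0 = 0 ∧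
      (∀ l : ℕ, C (4 * ((l + 1 : ℕ) : ℝ)) * F.T G (((l + 1 : ℕ) : ℝ) - 1) (w (l + 1))
        = -F.app (w l) - 4 * F.T G (2 * ((l + 1 : ℕ) : ℝ) - 1) (v (l + 1))) ∧
      (∀ l, Conv R (v l)) ∧ (∀ l, Conv R (w l)) ∧ Growth R v ∧ Growth R w := by
  have hn' : (4 : ℝ) ≤ n := by exact_mod_cast hn
  have hm : 1 ≤ expo n := by rw [expo]; linarith
  -- Here -1 = m - n/2, so the indicial constant is m ≥ 1, and V₀ exists without a free value at the
  -- pole.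
  obtain ⟨v₀, -, hv₀, hv₀M⟩ := h.transport_exists (κ := expo n) (d := 0) (by simpa using hm)
    (fun k _ => by have : (0 : ℝ) ≤ k := k.cast_nonneg; linarith)
    (OrdGE.zero_left (-(1 / 4 : ℝ) • F.app u))
  have hc : ∀ l : ℕ, |1 / (4 * (((l + 1 : ℕ) : ℝ) - 0))| ≤ 1 / ((l : ℝ) + 1) := fun l => by
    have hl : (0 : ℝ) ≤ l := l.cast_nonneg
    push_cast
    rw [sub_zero, abs_of_pos (by positivity)]
    exact one_div_le_one_div_of_le (by positivity) (by linarith)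
  obtain ⟨v, hv0, hv, M, K, hM0, hK, hM⟩ := h.exists_growth hR1 hF (g := fun _ => 0) (B := 0)
    (K₀ := 0) (by linarith) zero_le_one hc (fun r hr hrR =>
      hv₀M r _ hr hrR.le ((hu.of_le hr.le hrR.le).smul (-(1 / 4)))) le_rfl
    le_rfl (fun l r _ _ => by rw [zero_mul]; exact Maj.zero)
  have hA : 0 ≤ A := hF.c.nonneg
  -- The forcing term is obtained from the wanted equation for w by writing T_(2(l+1)-1) = T_l + (l
  -- + 1), inserting the recursion for v_(l+1) and dividing by 4 (l + 1). It contains F[v_l] with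
  -- the factor (l + 1)⁻², so it obeys the same Nagumo growth. The choice w₀ = 0 normalises the
  -- solution.
  obtain ⟨w, hw0, hw, M', K', -, hK', hM'⟩ := h.exists_growth hR1 hF (μ := 0) (u₀ := 0) (M₀ := 0)
    (g := fun l => -v (l + 1) + (1 / (4 * ((l : ℝ) + 1) ^ 2)) • F.app (v l))
    (B := M + 144 * ((n + 1) ^ 2 * A) * M) (K₀ := K + 1)
    (by linarith) zero_le_one hc (fun r hr hrR => Maj.zero) (by positivity) (by positivity)
    (fun l r hr hrR => by
      refine ((hM (l + 1) r hr hrR).neg.add hr.le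
        ((hF.app_nagumo hR1 (hM l) hr hrR).smul _)).mono ?_
      rw [abs_of_pos (by positivity), add_mul]
      refine add_le_add (by gcongr; linarith) ?_
      have e : 1 / (4 * ((l : ℝ) + 1) ^ 2) * (144 * ((n + 1) ^ 2 * A) * (l + 1) ^ 2 *
          (M * K ^ l * (1 / (R - r) ^ 2) ^ (l + 1)))
          = 144 * ((n + 1) ^ 2 * A) * M * (K ^ l * 1 / 4) * (1 / (R - r) ^ 2) ^ (l + 1) := by
        field_simp
      have e1 : ((K + 1) / (R - r) ^ 2) ^ (l + 1)
          = (K + 1) ^ (l + 1) * (1 / (R - r) ^ 2) ^ (l + 1) := by rw [← mul_pow, mul_one_div]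
      rw [e, e1]
      have e2 : K ^ l * 1 / 4 ≤ (K + 1) ^ (l + 1) := by
        have h1 : K ^ l ≤ (K + 1) ^ l := by gcongr; linarith
        have h2 : (K + 1) ^ l ≤ (K + 1) ^ (l + 1) := pow_le_pow_right₀ (by linarith) (by omega)
        have h3 : 0 ≤ K ^ l := by positivity
        linarith
      refine le_of_le_of_eq ?_ (mul_assoc _ _ _)
      gcongr)
  have hv' : ∀ l : ℕ, F.T G (((l + 1 : ℕ) : ℝ) - 1) (v (l + 1))
        = -(1 / (4 * ((l + 1 : ℕ) : ℝ))) • F.app (v l) := fun l => by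
    have := hv l
    rwa [sub_zero, add_zero] at this
  refine ⟨v, w, ?_, hv', hw0, fun l => ?_,
    fun l => Conv.of_pos fun r hr hrR => ⟨_, hM l r hr hrR⟩,
    fun l => Conv.of_pos fun r hr hrR => ⟨_, hM' l r hr hrR⟩, Growth.of_bound hR hK hM,
    Growth.of_bound hR hK' hM'⟩
  · rw [hv0, ← hv₀, expo_add_one]; congr 1; ring
  · have e1 := hw l
    rw [sub_zero] at e1
    have hl : (0 : ℝ) < ((l + 1 : ℕ) : ℝ) := by positivity
    rw [show 2 * ((l + 1 : ℕ) : ℝ) - 1 = ((l + 1 : ℕ) : ℝ) - 1 + ((l + 1 : ℕ) : ℝ) by ring,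
      T_add_const, hv' l, e1]
    have e2 := C_mul_C_inv (show 4 * ((l + 1 : ℕ) : ℝ) ≠ 0 by positivity) (F.app (w l))
    have e3 : (C (4 * ((l + 1 : ℕ) : ℝ)) : PS n) * ((1 / (4 * ((l : ℝ) + 1) ^ 2)) • F.app (v l))
        = 4 * ((1 / (4 * ((l + 1 : ℕ) : ℝ))) • F.app (v l)) := by
      rw [smul_eq_C_mul, smul_eq_C_mul, ← mul_assoc, ← mul_assoc, ← map_mul,
        ← map_ofNat (MvPowerSeries.C (σ := Fin n) (R := ℝ)) 4, ← map_mul]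
      congr 2
      push_cast
      field_simp
    rw [mul_add, mul_add, e3, neg_smul, mul_neg, e2, map_mul, map_ofNat, neg_smul]
    ring

end FormalOp

/-! ### From formal operators to functions; normal coordinates -/

theorem Conv.pd_pd_fn {ρ : ℝ} {c : PS n} (hc : Conv ρ c) {ξ x : Fin n → ℝ} (i j : Fin n)
    (hx : x ∈ ball ξ ρ) :
    pd i (pd j (fn ξ c)) x = fn ξ (MvPowerSeries.pderiv ℝ i (MvPowerSeries.pderiv ℝ j c)) x := by
  rw [← (hc.pderiv j).pd_fn i hx]
  refine pd_congr ?_ i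
  filter_upwards [isOpen_ball.mem_nhds hx] with y hy using hc.pd_fn j hy

/-- The coefficients of `F` are the sums of the series `H` on the ball of radius `ρ` about `ξ`. -/
structure Models (F : LinOp n) (ξ : Fin n → ℝ) (ρ : ℝ) (H : FormalOp n) : Prop where
  conv_a : ∀ i k, Conv ρ (H.a i k)
  conv_b : ∀ i, Conv ρ (H.b i)
  conv_c : Conv ρ H.c
  a_eq : ∀ x ∈ ball ξ ρ, ∀ i k, F.a x i k = fn ξ (H.a i k) x
  b_eq : ∀ x ∈ ball ξ ρ, ∀ i, F.B x i = fn ξ (H.b i) x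
  c_eq : ∀ x ∈ ball ξ ρ, F.C x = fn ξ H.c x

theorem exists_pos_forall_le {ι : Type*} [Finite ι] (f : ι → ℝ) (hf : ∀ i, 0 < f i) :
    ∃ ρ > 0, ∀ i, ρ ≤ f i := by
  cases nonempty_fintype ι
  have h : ∀ᶠ t in 𝓝[>] (0 : ℝ), ∀ i, t ≤ f i := by
    rw [eventually_all]
    exact fun i => mem_nhdsWithin_of_mem_nhds (Iic_mem_nhds (hf i))
  obtain ⟨t, ht, ht'⟩ := (h.and self_mem_nhdsWithin).exists
  exact ⟨t, ht', ht⟩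

theorem LinOp.IsAnalyticOn.exists_models {F : LinOp n} {Ω : Set (Fin n → ℝ)}
    (hF : F.IsAnalyticOn Ω) (hΩ : IsOpen Ω) {ξ : Fin n → ℝ} (hξ : ξ ∈ Ω) :
    ∃ ρ > 0, ball ξ ρ ⊆ Ω ∧ ∃ H, Models F ξ ρ H := by
  choose ra hra ca hca ha using fun i k => exists_conv_of_analyticAt (hF.analytic_a i k ξ hξ)
  choose rb hrb cb hcb hb using fun i => exists_conv_of_analyticAt (hF.analytic_B i ξ hξ)
  obtain ⟨rc, hrc, cc, hcc, hc⟩ := exists_conv_of_analyticAt (hF.analytic_C ξ hξ)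
  obtain ⟨rΩ, hrΩ, hball⟩ := Metric.isOpen_iff.1 hΩ ξ hξ
  obtain ⟨ρ₁, h₁, h₁'⟩ := exists_pos_forall_le (fun p : Fin n × Fin n => ra p.1 p.2)
    fun p => hra _ _
  obtain ⟨ρ₂, h₂, h₂'⟩ := exists_pos_forall_le rb hrb
  set ρ := min (min ρ₁ ρ₂) (min rc rΩ)
  have e1 : ∀ i k, ρ ≤ ra i k := fun i k =>
    ((min_le_left _ _).trans (min_le_left _ _)).trans (h₁' (i, k))
  have e2 : ∀ i, ρ ≤ rb i := fun i => ((min_le_left _ _).trans (min_le_right _ _)).trans (h₂' i)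
  have e3 : ρ ≤ rc := (min_le_right _ _).trans (min_le_left _ _)
  have e4 : ρ ≤ rΩ := (min_le_right _ _).trans (min_le_right _ _)
  exact ⟨ρ, lt_min (lt_min h₁ h₂) (lt_min hrc hrΩ), (ball_subset_ball e4).trans hball,
    ⟨ca, cb, cc⟩, fun i k => (hca i k).mono (e1 i k), fun i => (hcb i).mono (e2 i), hcc.mono e3,
    fun x hx i k => ha i k x (ball_subset_ball (e1 i k) hx),
    fun x hx i => hb i x (ball_subset_ball (e2 i) hx), fun x hx => hc x (ball_subset_ball e3 hx)⟩

namespace Models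

variable {F : LinOp n} {ξ : Fin n → ℝ} {ρ : ℝ} {H : FormalOp n}

theorem mono (h : Models F ξ ρ H) {ρ' : ℝ} (hρ : ρ' ≤ ρ) : Models F ξ ρ' H :=
  ⟨fun i k => (h.conv_a i k).mono hρ, fun i => (h.conv_b i).mono hρ, h.conv_c.mono hρ,
    fun x hx => h.a_eq x (ball_subset_ball hρ hx), fun x hx => h.b_eq x (ball_subset_ball hρ hx),
    fun x hx => h.c_eq x (ball_subset_ball hρ hx)⟩

theorem conv_app (h : Models F ξ ρ H) {u : PS n} (hu : Conv ρ u) : Conv ρ (H.app u) :=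
  (((Conv.sum _ fun i _ => Conv.sum _ fun k _ => (h.conv_a i k).mul ((hu.pderiv k).pderiv i)).add
    (Conv.sum _ fun i _ => (h.conv_b i).mul (hu.pderiv i))).add (h.conv_c.mul hu))

theorem app_fn (h : Models F ξ ρ H) {u : PS n} (hu : Conv ρ u) {x : Fin n → ℝ}
    (hx : x ∈ ball ξ ρ) : F.app (fn ξ u) x = fn ξ (H.app u) x := by
  have c1 : ∀ i k, Conv ρ (H.a i k * pderiv ℝ i (pderiv ℝ k u)) := fun i k =>
    (h.conv_a i k).mul ((hu.pderiv k).pderiv i)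
  have c2 : ∀ i, Conv ρ (H.b i * pderiv ℝ i u) := fun i => (h.conv_b i).mul (hu.pderiv i)
  have c3 : ∀ i, Conv ρ (∑ k, H.a i k * pderiv ℝ i (pderiv ℝ k u)) := fun i =>
    Conv.sum _ fun k _ => c1 i k
  rw [FormalOp.app, Conv.fn_add ((Conv.sum _ fun i _ => c3 i).add (Conv.sum _ fun i _ => c2 i))
    (h.conv_c.mul hu) hx, Conv.fn_add (Conv.sum _ fun i _ => c3 i) (Conv.sum _ fun i _ => c2 i) hx,
    Conv.fn_sum _ (fun i _ => c3 i) hx, Conv.fn_sum _ (fun i _ => c2 i) hx,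
    h.conv_c.fn_mul hu hx, LinOp.app, h.c_eq x hx]
  simp only [smul_eq_mul]
  congr 1
  congr 1
  · refine Finset.sum_congr rfl fun i _ => ?_
    rw [Conv.fn_sum _ (fun k _ => c1 i k) hx]
    refine Finset.sum_congr rfl fun k _ => ?_
    rw [(h.conv_a i k).fn_mul ((hu.pderiv k).pderiv i) hx, hu.pd_pd_fn i k hx, h.a_eq x hx]
  · refine Finset.sum_congr rfl fun i _ => ?_
    rw [(h.conv_b i).fn_mul (hu.pderiv i) hx, hu.pd_fn i hx, h.b_eq x hx]

theorem pd_a (h : Models F ξ ρ H) (i j k : Fin n) {x : Fin n → ℝ} (hx : x ∈ ball ξ ρ) :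
    pd i (fun y => F.a y j k) x = fn ξ (pderiv ℝ i (H.a j k)) x := by
  rw [← (h.conv_a j k).pd_fn i hx]
  refine pd_congr ?_ i
  filter_upwards [isOpen_ball.mem_nhds hx] with y hy using h.a_eq y hy j k

theorem a₀_eq (h : Models F ξ ρ H) (hρ : 0 < ρ) : H.a₀ = F.a ξ := by
  ext i k
  rw [h.a_eq ξ (mem_ball_self hρ), fn_self]
  rfl

theorem symm (h : Models F ξ ρ H) (hρ : 0 < ρ) (hs : ∀ x ∈ ball ξ ρ, (F.a x).IsSymm)
    (i k : Fin n) : H.a i k = H.a k i := by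
  have h1 : ∀ i k, Rep ξ (fun x => F.a x i k) (H.a i k) := fun i k =>
    ⟨ρ, hρ, h.conv_a i k, fun x hx => h.a_eq x hx i k⟩
  refine (h1 i k).unique ((h1 k i).congr ?_)
  filter_upwards [ball_mem_nhds ξ hρ] with x hx using (hs x hx).apply i k

theorem exists_bdd (h : Models F ξ ρ H) {R : ℝ} (hR : 0 ≤ R) (hRρ : R < ρ) :
    ∃ A, H.Bdd R A := by
  choose Ma hMa using fun i k => h.conv_a i k R hR hRρ
  choose Mb hMb using fun i => h.conv_b i R hR hRρ
  obtain ⟨Mc, hMc⟩ := h.conv_c R hR hRρ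
  refine ⟨∑ i, ∑ k, Ma i k + ∑ i, Mb i + Mc, fun i k => (hMa i k).mono ?_,
    fun i => (hMb i).mono ?_, hMc.mono ?_⟩ <;>
  have e1 : ∀ i, 0 ≤ ∑ k, Ma i k := fun i => Finset.sum_nonneg fun k _ => (hMa i k).nonneg
  all_goals
    have e2 : 0 ≤ ∑ i, ∑ k, Ma i k := Finset.sum_nonneg fun i _ => e1 i
    have e3 : 0 ≤ ∑ i, Mb i := Finset.sum_nonneg fun i _ => (hMb i).nonneg
    have e4 := hMc.nonneg
  · have e5 := Finset.single_le_sum (fun i _ => e1 i) (Finset.mem_univ i)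
    have e6 := Finset.single_le_sum (fun k _ => (hMa i k).nonneg) (Finset.mem_univ k)
    linarith
  · have e5 := Finset.single_le_sum (fun i _ => (hMb i).nonneg) (Finset.mem_univ i)
    linarith
  · linarith

end Models

/-- Coordinates in which a vector field tangent to the Euler field becomes the Euler field. -/
theorem NearEuler.exists_linearize {ℓ : Fin n → PS n} {δ : PS n} {R : ℝ}
    (h : NearEuler ℓ δ R) (i : Fin n) :
    ∃ Z : PS n, OrdGE 2 (Z - X i) ∧ ∑ j, ℓ j * pderiv ℝ j Z = Z ∧ Conv R Z := by
  classical
  have h0 : NearEuler ℓ 0 R :=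
    ⟨h.order, OrdGE.zero, h.maj, fun r _ _ => Maj.zero.mono (by norm_num)⟩
  -- Put Z = Xᵢ + y. The correction has to satisfy (L - 1) y = -(ℓᵢ - Xᵢ), which is solvable from
  -- degree 2 on, where k - 1 ≥ 1.
  obtain ⟨y, hy, hy', hM⟩ := h0.exists_solution (κ := -1) (d := 2) (by norm_num)
    (fun k hk => by have : (2 : ℝ) ≤ k := by exact_mod_cast hk
                    linarith) (f := -(ℓ i - X i)) (h.order i).neg
  refine ⟨X i + y, by simpa using hy, ?_, (Conv.X i).add (Conv.of_pos fun r hr hrR =>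
    ⟨_, hM r _ hr hrR.le (h.maj r hr hrR.le i).neg⟩)⟩
  simp only [map_add, mul_add, Finset.sum_add_distrib]
  have e1 : ∑ j, ℓ j * pderiv ℝ j (X i : PS n) = ℓ i := by
    rw [Finset.sum_eq_single i]
    · simp [pderiv_X_self]
    · intro j _ hj; rw [pderiv_X_of_ne hj.symm, mul_zero]
    · simp
  rw [e1]
  have e2 : (C (-1 : ℝ) : PS n) = -1 := by simp
  rw [e2] at hy'
  linear_combination hy'

/-- The vector field `½ ∑ aⁱʲ ∂ⱼ Γ`. -/
def LinOp.flow (F : LinOp n) (Γ : (Fin n → ℝ) → ℝ) (x : Fin n → ℝ) (j : Fin n) : ℝ :=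
  1 / 2 * ∑ k, F.a x j k * pd k Γ x

/-- A solution `Γ` of the eikonal equation with pole `ξ` on the domain `B`, and functions `Z i`
(normal coordinates) in which `½ ∑ aⁱʲ ∂ⱼ Γ` is the Euler field and `Γ` is a quadratic form. -/
structure Chart (F : LinOp n) (ξ : Fin n → ℝ) (B : Set (Fin n → ℝ)) (Γ : (Fin n → ℝ) → ℝ)
    (Z : Fin n → (Fin n → ℝ) → ℝ) : Prop where
  isOpen : IsOpen B
  mem : ξ ∈ B
  symm : ∀ x ∈ B, ∀ i j, F.a x i j = F.a x j i
  det : (F.a ξ).det ≠ 0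
  analytic_a : ∀ i j, AnalyticOnNhd ℝ (fun x => F.a x i j) B
  analytic_Γ : AnalyticOnNhd ℝ Γ B
  analytic_Z : ∀ i, AnalyticOnNhd ℝ (Z i) B
  eikonal : ∀ x ∈ B, ∑ i, ∑ j, F.a x i j * pd i Γ x * pd j Γ x = 4 * Γ x
  flow_pd : ∀ x ∈ B, ∀ i, ∑ j, F.flow Γ x j * pd j (pd i Γ) x = pd i Γ x
    - 1 / 4 * ∑ j, ∑ k, pd i (fun y => F.a y j k) x * pd j Γ x * pd k Γ x
  flow_Z : ∀ x ∈ B, ∀ i, ∑ j, F.flow Γ x j * pd j (Z i) x = Z i x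
  Γ_eq : ∀ x ∈ B, Γ x = ∑ i, ∑ j, (F.a ξ)⁻¹ i j * Z i x * Z j x
  pd_Γ : ∀ x ∈ B, ∀ k, pd k Γ x = 2 * ∑ i, pd k (Z i) x * ∑ j, (F.a ξ)⁻¹ i j * Z j x
  Z_zero : ∀ i, Z i ξ = 0
  pd_Z : ∀ i j, pd j (Z i) ξ = (1 : Matrix (Fin n) (Fin n) ℝ) i j
  hess : ∀ i k, ∑ j, pd j (pd i Γ) ξ * F.a ξ j k = 2 * (1 : Matrix (Fin n) (Fin n) ℝ) i k

theorem pderiv_comm (i j : Fin n) (u : PS n) :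
    pderiv ℝ i (pderiv ℝ j u) = pderiv ℝ j (pderiv ℝ i u) := by
  ext α
  simp only [coeff_pderiv, Finsupp.add_apply, add_right_comm]
  rcases eq_or_ne i j with rfl | h
  · rfl
  · simp [h, h.symm]; ring

namespace FormalOp

variable {H : FormalOp n} {G : PS n}

/-- The differentiated eikonal equation. Along L, which becomes s d/ds, it is Hamilton's equation
for the momentum s p = dΓ. -/
theorem Eikonal.L_pderiv (h : H.Eikonal G) (i : Fin n) : H.L G (pderiv ℝ i G) = pderiv ℝ i G
    - (1 / 4 : ℝ) • ∑ j, ∑ k, pderiv ℝ i (H.a j k) * pderiv ℝ j G * pderiv ℝ k G := by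
  have h1 := congrArg (pderiv ℝ i) h.eq
  have h2 := H.two_mul_L (G := G) (pderiv ℝ i G)
  have e4 : pderiv ℝ i (4 * G) = 4 * pderiv ℝ i G := by
    rw [← map_ofNat (MvPowerSeries.C (σ := Fin n) (R := ℝ)) 4, Derivation.leibniz, pderiv_C']
    simp
  have h3 : pderiv ℝ i (∑ j, ∑ k, H.a j k * pderiv ℝ j G * pderiv ℝ k G)
      = ∑ j, ∑ k, pderiv ℝ i (H.a j k) * pderiv ℝ j G * pderiv ℝ k G
        + ∑ j, ∑ k, H.a j k * pderiv ℝ k G * pderiv ℝ j (pderiv ℝ i G)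
        + ∑ j, ∑ k, H.a j k * pderiv ℝ j G * pderiv ℝ k (pderiv ℝ i G) := by
    simp only [map_sum, ← Finset.sum_add_distrib]
    refine Finset.sum_congr rfl fun j _ => Finset.sum_congr rfl fun k _ => ?_
    simp only [Derivation.leibniz, smul_eq_mul]
    rw [pderiv_comm i j, pderiv_comm i k]
    ring
  have h4 : ∑ j, ∑ k, H.a j k * pderiv ℝ j G * pderiv ℝ k (pderiv ℝ i G)
      = ∑ j, ∑ k, H.a j k * pderiv ℝ k G * pderiv ℝ j (pderiv ℝ i G) := by
    rw [Finset.sum_comm]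
    exact Finset.sum_congr rfl fun j _ => Finset.sum_congr rfl fun k _ => by rw [h.symm k j]
  rw [h3, h4, e4, ← h2] at h1
  have h5 := four_smul_quarter
    (∑ j, ∑ k, pderiv ℝ i (H.a j k) * pderiv ℝ j G * pderiv ℝ k G)
  refine two_mul_cancel (two_mul_cancel ?_)
  linear_combination h1 + h5

/-- In normal coordinates the world function is a quadratic form. -/
theorem Normal.eq_quad {R : ℝ} {A : Matrix (Fin n) (Fin n) ℝ} {E : PS n}
    (h : H.Normal (quad A + E) R) (hE : OrdGE 3 E) {Z : Fin n → PS n}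
    (hZ : ∀ i, OrdGE 2 (Z i - X i)) (hL : ∀ i, H.L (quad A + E) (Z i) = Z i) :
    quad A + E = ∑ i, ∑ j, C (A i j) * Z i * Z j := by
  rw [← sub_eq_zero]
  have h0 : NearEuler (H.field (quad A + E)) 0 R :=
    ⟨h.field_order, OrdGE.zero, h.field_maj, fun r _ _ => Maj.zero.mono (by norm_num)⟩
  have hX : ∀ i, OrdGE 1 (X i : PS n) := fun i => OrdGE.X i
  have hZ1 : ∀ i, OrdGE 1 (Z i) := fun i => by
    simpa using ((hZ i).mono (by norm_num : 1 ≤ 2)).add (hX i)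
  -- Both sides are eigenvectors of L with eigenvalue 2 and have the same quadratic part, so the
  -- difference has order 3, where k - 2 > 0.
  refine h0.unique (κ := -2) (d := 3) (by norm_num) ?_ ?_
  · have e : quad A + E - ∑ i, ∑ j, C (A i j) * Z i * Z j
        = E - ∑ i, ∑ j, C (A i j) * ((Z i - X i) * Z j + (Z j - X j) * X i) := by
      rw [quad, add_comm, add_sub_assoc]
      rw [← neg_sub, ← sub_eq_add_neg, ← Finset.sum_sub_distrib]
      congr 1
      refine Finset.sum_congr rfl fun i _ => ?_
      rw [← Finset.sum_sub_distrib]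
      exact Finset.sum_congr rfl fun j _ => by ring
    rw [e]
    refine hE.sub (OrdGE.sum _ fun i _ => OrdGE.sum _ fun j _ => OrdGE.mul_left _ ?_)
    exact ((hZ i).mul (hZ1 j)).add ((hZ j).mul (hX i))
  · have e1 : H.L (quad A + E) (∑ i, ∑ j, C (A i j) * Z i * Z j)
        = 2 * ∑ i, ∑ j, C (A i j) * Z i * Z j := by
      simp only [L_sum, Finset.mul_sum]
      refine Finset.sum_congr rfl fun i _ => Finset.sum_congr rfl fun j _ => ?_
      rw [L_mul, L_mul, L_C, hL, hL]
      ring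
    have e2 := h.toEikonal.L_self
    have e3 : H.L (quad A + E) (quad A + E - ∑ i, ∑ j, C (A i j) * Z i * Z j)
        = 2 * (quad A + E) - 2 * ∑ i, ∑ j, C (A i j) * Z i * Z j := by rw [L_sub, e1, e2]
    have e4 : (C (-2 : ℝ) : PS n) = -2 := by rw [map_neg, map_ofNat]
    rw [← L, e3, e4]
    ring

end FormalOp

theorem fn_sum_mul {ρ : ℝ} {ξ x : Fin n → ℝ} {c d : Fin n → PS n} (hc : ∀ i, Conv ρ (c i))
    (hd : ∀ i, Conv ρ (d i)) (hx : x ∈ ball ξ ρ) :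
    fn ξ (∑ i, c i * d i) x = ∑ i, fn ξ (c i) x * fn ξ (d i) x := by
  rw [Conv.fn_sum _ (fun i _ => (hc i).mul (hd i)) hx]
  exact Finset.sum_congr rfl fun i _ => (hc i).fn_mul (hd i) hx

namespace Models

variable {F : LinOp n} {ξ : Fin n → ℝ} {ρ : ℝ} {H : FormalOp n}

theorem field_fn (h : Models F ξ ρ H) {G : PS n} (hG : Conv ρ G) {x : Fin n → ℝ}
    (hx : x ∈ ball ξ ρ) (j : Fin n) : fn ξ (H.field G j) x = F.flow (fn ξ G) x j := by
  rw [FormalOp.field, fn_smul, fn_sum_mul (h.conv_a j) (fun k => hG.pderiv k) hx, LinOp.flow]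
  congr 1
  exact Finset.sum_congr rfl fun k _ => by rw [h.a_eq x hx, hG.pd_fn k hx]

theorem L_fn (h : Models F ξ ρ H) {G u : PS n} (hG : Conv ρ G) (hu : Conv ρ u) {x : Fin n → ℝ}
    (hx : x ∈ ball ξ ρ) : fn ξ (H.L G u) x = ∑ j, F.flow (fn ξ G) x j * pd j (fn ξ u) x := by
  rw [FormalOp.L, fn_sum_mul (fun j => FormalOp.conv_field h.conv_a hG j)
    (fun j => hu.pderiv j) hx]
  exact Finset.sum_congr rfl fun j _ => by rw [h.field_fn hG hx, hu.pd_fn j hx]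

theorem D_fn (h : Models F ξ ρ H) {G : PS n} (hG : Conv ρ G) {x : Fin n → ℝ}
    (hx : x ∈ ball ξ ρ) : fn ξ (H.D G) x
      = (1 / 4) * ∑ i, ∑ j, F.a x i j * pd i (pd j (fn ξ G)) x
        + (1 / 4) * ∑ i, F.B x i * pd i (fn ξ G) x := by
  have c1 : ∀ i j, Conv ρ (pderiv ℝ i (pderiv ℝ j G)) := fun i j => (hG.pderiv j).pderiv i
  have c2 : ∀ i, Conv ρ (∑ j, H.a i j * pderiv ℝ i (pderiv ℝ j G)) := fun i =>
    Conv.sum _ fun j _ => (h.conv_a i j).mul (c1 i j)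
  rw [FormalOp.D, Conv.fn_add ((Conv.sum _ fun i _ => c2 i).smul _)
    ((Conv.sum _ fun i _ => (h.conv_b i).mul (hG.pderiv i)).smul _) hx, fn_smul, fn_smul,
    Conv.fn_sum _ (fun i _ => c2 i) hx, fn_sum_mul h.conv_b (fun i => hG.pderiv i) hx]
  congr 2
  · refine Finset.sum_congr rfl fun i _ => ?_
    rw [fn_sum_mul (h.conv_a i) (c1 i) hx]
    exact Finset.sum_congr rfl fun j _ => by rw [h.a_eq x hx, hG.pd_pd_fn i j hx]
  · exact Finset.sum_congr rfl fun i _ => by rw [h.b_eq x hx, hG.pd_fn i hx]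

/-- The passage from formal identities to functions on the ball. The coordinates come from
linearising the gradient field; the Hessian identity at the pole records that A is the inverse of
the principal matrix. -/
theorem exists_chart (hM : Models F ξ ρ H) (hρ : 0 < ρ) (hs : ∀ x ∈ ball ξ ρ, (F.a x).IsSymm)
    (hdet : (F.a ξ).det ≠ 0) {E : PS n} (hE : OrdGE 3 E) (hEc : Conv ρ E)
    (hN : H.Normal (quad (F.a ξ)⁻¹ + E) ρ) :
    ∃ Z, Chart F ξ (ball ξ ρ) (fn ξ (quad (F.a ξ)⁻¹ + E)) Z := by
  set A := (F.a ξ)⁻¹ with hA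
  set G := quad A + E with hGdef
  have hAs : A.IsSymm := (Matrix.IsSymm.inv (hs ξ (mem_ball_self hρ)) : _)
  have haA : F.a ξ * A = 1 := Matrix.mul_nonsing_inv _ (isUnit_iff_ne_zero.2 hdet)
  have hG : Conv ρ G := (conv_quad ρ A).add hEc
  choose Z hZ hLZ hZc using fun i => hN.nearEuler.exists_linearize i
  have hq : G = ∑ i, ∑ j, C (A i j) * Z i * Z j := hN.eq_quad hE hZ hLZ
  have c1 : ∀ i j, Conv ρ (pderiv ℝ i (pderiv ℝ j G)) := fun i j => (hG.pderiv j).pderiv i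
  have c2 : ∀ i, Conv ρ (∑ j, C (A i j) * Z j) := fun i =>
    Conv.sum _ fun j _ => (Conv.const _).mul (hZc j)
  refine ⟨fun i => fn ξ (Z i), isOpen_ball, mem_ball_self hρ,
    fun x hx i j => (hs x hx).apply j i, hdet, fun i j => ?_, hG.analyticOnNhd ξ,
    fun i => (hZc i).analyticOnNhd ξ, fun x hx => ?_, fun x hx i => ?_, fun x hx i => ?_,
    fun x hx => ?_, fun x hx k => ?_, fun i => ?_, fun i j => ?_, fun i k => ?_⟩
  · exact AnalyticOnNhd.congr isOpen_ball ((hM.conv_a i j).analyticOnNhd ξ) fun x hx => (hM.a_eq x hx i j).symm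
  · have h1 : fn ξ _ x = fn ξ _ x := congrArg (fun c => fn ξ c x) hN.toEikonal.eq
    have e4 : fn ξ (4 * G) x = 4 * fn ξ G x := by
      rw [← map_ofNat (MvPowerSeries.C (σ := Fin n) (R := ℝ)) 4, ← smul_eq_C_mul, fn_smul]
    rw [e4, Conv.fn_sum _ (fun i _ => Conv.sum _ fun j _ =>
      ((hM.conv_a i j).mul (hG.pderiv i)).mul (hG.pderiv j)) hx] at h1
    rw [← h1]
    refine Finset.sum_congr rfl fun i _ => ?_
    rw [fn_sum_mul (fun j => (hM.conv_a i j).mul (hG.pderiv i)) (fun j => hG.pderiv j) hx]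
    exact Finset.sum_congr rfl fun j _ => by
      rw [(hM.conv_a i j).fn_mul (hG.pderiv i) hx, hM.a_eq x hx, hG.pd_fn i hx, hG.pd_fn j hx]
  · have h1 : fn ξ _ x = fn ξ _ x := congrArg (fun c => fn ξ c x) (hN.toEikonal.L_pderiv i)
    have c3 : ∀ j k, Conv ρ (pderiv ℝ i (H.a j k) * pderiv ℝ j G) := fun j k =>
      ((hM.conv_a j k).pderiv i).mul (hG.pderiv j)
    have c4 : ∀ j, Conv ρ (∑ k, pderiv ℝ i (H.a j k) * pderiv ℝ j G * pderiv ℝ k G) := fun j =>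
      Conv.sum _ fun k _ => (c3 j k).mul (hG.pderiv k)
    rw [Conv.fn_sub (hG.pderiv i) ((Conv.sum _ fun j _ => c4 j).smul _) hx, fn_smul,
      Conv.fn_sum _ (fun j _ => c4 j) hx, FormalOp.L,
      fn_sum_mul (fun j => FormalOp.conv_field hM.conv_a hG j) (fun j => c1 j i) hx] at h1
    have e1 : ∀ j, F.flow (fn ξ G) x j * pd j (pd i (fn ξ G)) x
        = fn ξ (H.field G j) x * fn ξ (pderiv ℝ j (pderiv ℝ i G)) x := fun j => by
      rw [hM.field_fn hG hx, hG.pd_pd_fn j i hx]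
    simp only [e1, h1]
    rw [hG.pd_fn i hx]
    congr 2
    refine Finset.sum_congr rfl fun j _ => ?_
    rw [fn_sum_mul (c3 j) (fun k => hG.pderiv k) hx]
    exact Finset.sum_congr rfl fun k _ => by
      rw [((hM.conv_a j k).pderiv i).fn_mul (hG.pderiv j) hx, hM.pd_a i j k hx, hG.pd_fn j hx,
        hG.pd_fn k hx]
  · have h1 : fn ξ _ x = fn ξ _ x := congrArg (fun c => fn ξ c x) (hLZ i)
    rw [← FormalOp.L, hM.L_fn hG (hZc i) hx] at h1
    exact h1
  · have c3 : ∀ i, Conv ρ (∑ j, C (A i j) * Z i * Z j) := fun i => Conv.sum _ fun j _ =>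
      ((Conv.const _).mul (hZc i)).mul (hZc j)
    rw [hq, Conv.fn_sum _ (fun i _ => c3 i) hx]
    refine Finset.sum_congr rfl fun i _ => ?_
    rw [fn_sum_mul (fun j => (Conv.const _).mul (hZc i)) hZc hx]
    exact Finset.sum_congr rfl fun j _ => by rw [(Conv.const _).fn_mul (hZc i) hx, fn_C]
  · have e1 : pderiv ℝ k G = 2 * ∑ i, pderiv ℝ k (Z i) * ∑ j, C (A i j) * Z j := by
      have e2 : ∑ i, ∑ j, C (A i j) * pderiv ℝ k (Z j) * Z i
          = ∑ i, ∑ j, C (A i j) * pderiv ℝ k (Z i) * Z j := by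
        rw [Finset.sum_comm]
        exact Finset.sum_congr rfl fun j _ => Finset.sum_congr rfl fun i _ => by rw [hAs.apply]
      have e3 : ∑ i, pderiv ℝ k (Z i) * ∑ j, C (A i j) * Z j
          = ∑ i, ∑ j, C (A i j) * pderiv ℝ k (Z i) * Z j := by
        simp only [Finset.mul_sum]
        exact Finset.sum_congr rfl fun j _ => Finset.sum_congr rfl fun i _ => by ring
      rw [e3, two_mul]
      nth_rewrite 1 [← e2]
      rw [hq]
      simp only [map_sum, ← Finset.sum_add_distrib]
      refine Finset.sum_congr rfl fun i _ => Finset.sum_congr rfl fun j _ => ?_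
      simp only [Derivation.leibniz, smul_eq_mul, pderiv_C']
      ring_nf
    have e4 : ∀ c : PS n, fn ξ (2 * c) x = 2 * fn ξ c x := fun c => by
      rw [← map_ofNat (MvPowerSeries.C (σ := Fin n) (R := ℝ)) 2, ← smul_eq_C_mul, fn_smul]
    rw [hG.pd_fn k hx, e1, e4, fn_sum_mul (fun i => (hZc i).pderiv k) c2 hx]
    congr 1
    refine Finset.sum_congr rfl fun i _ => ?_
    rw [fn_sum_mul (fun j => Conv.const _) hZc hx, (hZc i).pd_fn k hx]
    simp only [fn_C]
    rfl
  · rw [fn_self]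
    have : constantCoeff (Z i - X i) = 0 := (OrdGE.one_iff).1 ((hZ i).mono (by norm_num))
    simpa using this
  · rw [(hZc i).pd_fn j (mem_ball_self hρ), fn_self]
    have h1 : constantCoeff (pderiv ℝ j (Z i - X i)) = 0 := (OrdGE.one_iff).1 ((hZ i).pderiv j)
    rw [map_sub, map_sub, sub_eq_zero] at h1
    rw [h1, Matrix.one_apply]
    split_ifs with hij
    · rw [hij, pderiv_X_self, map_one]
    · rw [pderiv_X_of_ne hij, map_zero]
  · have e1 : ∀ j, pd j (pd i (fn ξ G)) ξ = 2 * A i j := fun j => by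
      have h1 : constantCoeff (pderiv ℝ j (pderiv ℝ i E)) = 0 :=
        (OrdGE.one_iff).1 ((hE.pderiv i).pderiv j)
      have h2 : constantCoeff (pderiv ℝ j (pderiv ℝ i (quad A))) = 2 * A i j := by
        rw [pderiv_quad hAs, ← map_ofNat (MvPowerSeries.C (σ := Fin n) (R := ℝ)) 2,
          ← smul_eq_C_mul, Derivation.map_smul, map_sum]
        simp only [← smul_eq_C_mul, Derivation.map_smul]
        rw [Finset.sum_eq_single j]
        · simp [pderiv_X_self]
        · intro k _ hk; rw [pderiv_X_of_ne hk, smul_zero]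
        · simp
      rw [hG.pd_pd_fn j i (mem_ball_self hρ), fn_self, hGdef, map_add, map_add, map_add, h1, h2,
        add_zero]
    simp only [e1, mul_assoc, ← Finset.mul_sum]
    congr 1
    have hAa : A * F.a ξ = 1 := Matrix.nonsing_inv_mul _ (isUnit_iff_ne_zero.2 hdet)
    rw [← hAa, Matrix.mul_apply]

end Models

/-! ### Geodesics issuing from the pole -/

theorem fderiv_eq_sum_pd {E : Type*} [NormedAddCommGroup E] [NormedSpace ℝ E]
    (f : (Fin n → ℝ) → E) (x v : Fin n → ℝ) : fderiv ℝ f x v = ∑ j, v j • pd j f x := by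
  have h := LinearMap.pi_apply_eq_sum_univ (fderiv ℝ f x : (Fin n → ℝ) →ₗ[ℝ] E) v
  refine h.trans (Finset.sum_congr rfl fun j _ => ?_)
  congr 1
  simp only [pd, ContinuousLinearMap.coe_coe]
  congr 1
  ext i
  simp [Pi.single_apply, eq_comm]

theorem analyticOnNhd_pd {f : (Fin n → ℝ) → ℝ} {B : Set (Fin n → ℝ)} (hf : AnalyticOnNhd ℝ f B)
    (i : Fin n) : AnalyticOnNhd ℝ (pd i f) B := fun x hx =>
  (ContinuousLinearMap.apply ℝ ℝ (Pi.single i 1 : Fin n → ℝ)).analyticAt _ |>.comp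
    (hf.fderiv x hx)

/-- Chain rule along a curve. -/
theorem hasDerivWithinAt_comp_curve {E : Type*} [NormedAddCommGroup E] [NormedSpace ℝ E]
    {f : (Fin n → ℝ) → E} {γ : ℝ → Fin n → ℝ} {g : Fin n → ℝ}
    {I : Set ℝ} {s : ℝ} (hf : DifferentiableAt ℝ f (γ s)) (hγ : HasDerivWithinAt γ g I s) :
    HasDerivWithinAt (fun t => f (γ t)) (∑ j, g j • pd j f (γ s)) I s := by
  rw [← fderiv_eq_sum_pd]
  exact hf.hasFDerivAt.comp_hasDerivWithinAt s hγ

theorem abs_sub_le_mul_of_continuousOn_deriv {φ φ' : ℝ → ℝ}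
    (h : ∀ s ∈ Icc (0 : ℝ) 1, HasDerivWithinAt φ (φ' s) (Icc 0 1) s)
    (hc : ContinuousOn φ' (Icc 0 1)) :
    ∃ C, 0 ≤ C ∧ ∀ s ∈ Icc (0 : ℝ) 1, |φ s - φ 0| ≤ C * s := by
  obtain ⟨C, hC⟩ := isCompact_Icc.exists_bound_of_continuousOn hc
  have h0 : (0 : ℝ) ∈ Icc (0 : ℝ) 1 := ⟨le_rfl, zero_le_one⟩
  refine ⟨C, (norm_nonneg _).trans (hC 0 h0), fun s hs => ?_⟩
  have := (convex_Icc (0 : ℝ) 1).norm_image_sub_le_of_norm_hasDerivWithin_le h hC h0 hs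
  simpa [abs_of_nonneg hs.1] using this

/-- A solution on `[0, 1]` of `s dζ/ds = ζ` is linear. -/
theorem eq_mul_of_euler {ζ ζ' : ℝ → ℝ}
    (h : ∀ s ∈ Icc (0 : ℝ) 1, HasDerivWithinAt ζ (ζ' s) (Icc 0 1) s)
    (he : ∀ s ∈ Icc (0 : ℝ) 1, s * ζ' s = ζ s) : ∀ s ∈ Icc (0 : ℝ) 1, ζ s = s * ζ' 0 := by
  have h0 : (0 : ℝ) ∈ Icc (0 : ℝ) 1 := ⟨le_rfl, zero_le_one⟩
  have h1 : (1 : ℝ) ∈ Ioc (0 : ℝ) 1 := ⟨zero_lt_one, le_rfl⟩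
  have hζ0 : ζ 0 = 0 := by simpa using (he 0 h0).symm
  have key : ∀ s ∈ Icc (0 : ℝ) 1, ζ s = s * ζ 1 := by
    intro s hs
    rcases hs.1.eq_or_lt with rfl | hs0
    · simpa using hζ0
    · have hd : ∀ t ∈ Ioc (0 : ℝ) 1, HasDerivWithinAt (fun t => ζ t / t) 0 (Ioc 0 1) t := by
        intro t ht
        have ht' : t ∈ Icc (0 : ℝ) 1 := ⟨ht.1.le, ht.2⟩
        have h1 := ((h t ht').mono Ioc_subset_Icc_self).div (hasDerivWithinAt_id t _) ht.1.ne'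
        have h2 : (ζ' t * t - ζ t * 1) / t ^ 2 = 0 := by rw [mul_comm, he t ht']; simp
        exact h2 ▸ h1
      have := (convex_Ioc (0 : ℝ) 1).norm_image_sub_le_of_norm_hasDerivWithin_le (C := 0) hd
        (by simp) h1 ⟨hs0, hs.2⟩
      rw [zero_mul, norm_le_zero_iff, sub_eq_zero, div_one, div_eq_iff hs0.ne'] at this
      rw [this, mul_comm]
  intro s hs
  rw [key s hs]
  congr 1
  have e1 : HasDerivWithinAt (fun s => s * ζ 1) (ζ' 0) (Icc 0 1) 0 :=
    (h 0 h0).congr (fun s hs => (key s hs).symm) (by simp [hζ0])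
  have e2 : HasDerivWithinAt (fun s => s * ζ 1) (ζ 1) (Icc 0 1) 0 := by
    simpa using (hasDerivWithinAt_id (0 : ℝ) (Icc 0 1)).mul_const (ζ 1)
  exact (uniqueDiffOn_Icc zero_lt_one 0 h0).eq_deriv _ e2 e1

theorem eqOn_Icc_of_eqOn_Ioc {φ ψ : ℝ → ℝ} (hφ : ContinuousOn φ (Icc 0 1))
    (hψ : ContinuousOn ψ (Icc 0 1)) (h : EqOn φ ψ (Ioc 0 1)) : EqOn φ ψ (Icc 0 1) :=
  h.of_subset_closure hφ hψ Ioc_subset_Icc_self (closure_Ioc zero_ne_one).ge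

/-- A solution of a linear system with regular singular matrix `O(s) / s` and zero initial value
vanishes. -/
theorem eq_zero_of_singular_system {w w' : ℝ → Fin n → ℝ} {b : ℝ → Fin n → Fin n → ℝ}
    (hw : ∀ s ∈ Icc (0 : ℝ) 1, HasDerivWithinAt w (w' s) (Icc 0 1) s) (h0 : w 0 = 0)
    (h0' : w' 0 = 0) (he : ∀ s ∈ Icc (0 : ℝ) 1, ∀ i, s * w' s i = ∑ k, b s i k * w s k)
    (hb : ∀ i k, ∃ C, 0 ≤ C ∧ ∀ s ∈ Icc (0 : ℝ) 1, |b s i k| ≤ C * s) :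
    ∀ s ∈ Icc (0 : ℝ) 1, w s = 0 := by
  choose C hC0 hC using hb
  refine eq_zero_of_abs_deriv_le_mul_abs_self_of_eq_zero_right (f' := w')
    (K := ∑ i, ∑ k, C i k) (fun s hs => (hw s hs).continuousWithinAt) (fun s hs => ?_) h0
    fun s hs => ?_
  · exact (hw s (Ico_subset_Icc_self hs)).mono_of_mem_nhdsWithin (Icc_mem_nhdsGE_of_mem hs)
  -- At s = 0 the singular equation says nothing, which is why the vanishing of w' there is assumed
  -- separately. For s > 0 the factor s cancels against the bound C s on the matrix, leaving
  -- Grönwall's inequality.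
  · rcases hs.1.eq_or_lt with rfl | hs0
    · rw [h0', h0]; simp
    · have hs' := Ico_subset_Icc_self hs
      refine (pi_norm_le_iff_of_nonneg ?_).2 fun i => ?_
      · exact mul_nonneg (Finset.sum_nonneg fun i _ => Finset.sum_nonneg fun k _ => hC0 i k)
          (norm_nonneg _)
      · have e1 : s * ‖w' s i‖ ≤ s * ((∑ k, C i k) * ‖w s‖) := by
          calc s * ‖w' s i‖ = |∑ k, b s i k * w s k| := by
                rw [← he s hs' i, abs_mul, abs_of_pos hs0, Real.norm_eq_abs]
            _ ≤ ∑ k, |b s i k * w s k| := Finset.abs_sum_le_sum_abs _ _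
            _ ≤ ∑ k, C i k * s * ‖w s‖ := Finset.sum_le_sum fun k _ => by
                rw [abs_mul]
                exact mul_le_mul (hC i k s hs') (norm_le_pi_norm (w s) k) (abs_nonneg _)
                  (mul_nonneg (hC0 i k) hs0.le)
            _ = _ := by rw [← Finset.sum_mul, ← Finset.sum_mul]; ring
        refine (le_of_mul_le_mul_left e1 hs0).trans ?_
        exact mul_le_mul_of_nonneg_right (Finset.single_le_sum (f := fun i => ∑ k, C i k)
          (fun i _ => Finset.sum_nonneg fun k _ => hC0 i k) (Finset.mem_univ i)) (norm_nonneg _)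

namespace Chart

variable {F : LinOp n} {ξ : Fin n → ℝ} {B N : Set (Fin n → ℝ)} {Γ : (Fin n → ℝ) → ℝ}
  {Z : Fin n → (Fin n → ℝ) → ℝ}

theorem pd_a_symm (h : Chart F ξ B Γ Z) {x : Fin n → ℝ} (hx : x ∈ B) (i j k : Fin n) :
    pd i (fun y => F.a y j k) x = pd i (fun y => F.a y k j) x := by
  refine pd_congr ?_ i
  filter_upwards [h.isOpen.mem_nhds hx] with y hy using h.symm y hy j k

theorem pd_Γ_pole (h : Chart F ξ B Γ Z) (k : Fin n) : pd k Γ ξ = 0 := by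
  rw [h.pd_Γ ξ h.mem k]
  simp [h.Z_zero]

theorem deriv_curve_bound {f : (Fin n → ℝ) → ℝ} (hf : AnalyticOnNhd ℝ f B) {γ : ℝ → Fin n → ℝ}
    {g : ℝ → Fin n → ℝ} (hγ : ∀ s ∈ Icc (0 : ℝ) 1, HasDerivWithinAt γ (g s) (Icc 0 1) s)
    (hB : ∀ s ∈ Icc (0 : ℝ) 1, γ s ∈ B) (hg : ContinuousOn g (Icc 0 1)) (h0 : f (γ 0) = 0) :
    ∃ C, 0 ≤ C ∧ ∀ s ∈ Icc (0 : ℝ) 1, |f (γ s)| ≤ C * s := by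
  have hγc : ContinuousOn γ (Icc 0 1) := fun s hs => (hγ s hs).continuousWithinAt
  have := abs_sub_le_mul_of_continuousOn_deriv (φ := fun s => f (γ s))
    (fun s hs => hasDerivWithinAt_comp_curve (hf _ (hB s hs)).differentiableAt (hγ s hs))
    (continuousOn_finsetSum _ fun j _ => ((continuous_apply j).comp_continuousOn hg).smul
      ((analyticOnNhd_pd hf j).continuousOn.comp hγc hB))
  simpa [h0] using this

/-- Along a geodesic issuing from the pole, `s p = dΓ`. -/
theorem momentum_eq (h : Chart F ξ B Γ Z) (hNB : N ⊆ B) {γ p : ℝ → Fin n → ℝ}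
    (hg : F.IsGeodesic ξ N γ p) {s : ℝ} (hs : s ∈ Icc (0 : ℝ) 1) (i : Fin n) :
    s * p s i = pd i Γ (γ s) := by
  have h0 : (0 : ℝ) ∈ Icc (0 : ℝ) 1 := ⟨le_rfl, zero_le_one⟩
  have hB : ∀ s ∈ Icc (0 : ℝ) 1, γ s ∈ B := fun s hs => hNB (hg.mem s hs)
  have hγc : ContinuousOn γ (Icc 0 1) := fun s hs => (hg.position s hs).continuousWithinAt
  have hpc : ContinuousOn p (Icc 0 1) := fun s hs => (hg.momentum s hs).continuousWithinAt
  have hpc' : ∀ j, ContinuousOn (fun s => p s j) (Icc 0 1) := fun j =>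
    (continuous_apply j).comp_continuousOn hpc
  have hac : ∀ i j, ContinuousOn (fun s => F.a (γ s) i j) (Icc 0 1) := fun i j =>
    (h.analytic_a i j).continuousOn.comp hγc hB
  have hgc : ContinuousOn (fun s => fun i => (1 / 2) * ∑ j, F.a (γ s) i j * p s j) (Icc 0 1) :=
    continuousOn_pi.2 fun i => continuousOn_const.mul
      (continuousOn_finsetSum _ fun j _ => (hac i j).mul (hpc' j))
  set v : ℝ → Fin n → ℝ := fun s i => (1 / 2) * ∑ j, F.a (γ s) i j * p s j with hv
  set p' : ℝ → Fin n → ℝ := fun s i =>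
    -(1 / 4) * ∑ j, ∑ k, pd i (fun y => F.a y j k) (γ s) * p s j * p s k with hp'
  -- The momentum equation for p and the differentiated eikonal equation for dΓ combine to s w' = b
  -- w, linear in this difference.
  set w : ℝ → Fin n → ℝ := fun s i => s * p s i - pd i Γ (γ s) with hw
  set w' : ℝ → Fin n → ℝ := fun s i =>
    (1 * p s i + s * p' s i) - ∑ j, v s j • pd j (pd i Γ) (γ s) with hw'
  have hΓ : ∀ i, AnalyticOnNhd ℝ (pd i Γ) B := analyticOnNhd_pd h.analytic_Γ
  have hwd : ∀ s ∈ Icc (0 : ℝ) 1, HasDerivWithinAt w (w' s) (Icc 0 1) s := fun s hs =>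
    hasDerivWithinAt_pi.2 fun i =>
      ((hasDerivWithinAt_id s _).mul (hasDerivWithinAt_pi.1 (hg.momentum s hs) i)).sub
        (hasDerivWithinAt_comp_curve (hΓ i _ (hB s hs)).differentiableAt (hg.position s hs))
  -- The matrix of the system is b = f(γ) - s e. The part f vanishes at the pole, because the
  -- Hessian times a is twice the identity and the gradient is zero there; hence b = O(s) along the
  -- geodesic.
  set f : Fin n → Fin n → (Fin n → ℝ) → ℝ := fun i k x =>
    (1 : Matrix (Fin n) (Fin n) ℝ) i k - 1 / 2 * ∑ j, pd j (pd i Γ) x * F.a x j k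
      - 1 / 4 * ∑ j, pd i (fun y => F.a y j k) x * pd j Γ x with hf
  set e : ℝ → Fin n → Fin n → ℝ := fun s i k =>
    1 / 4 * ∑ j, pd i (fun y => F.a y j k) (γ s) * p s j with he
  have hfa : ∀ i k, AnalyticOnNhd ℝ (f i k) B := fun i k =>
    (analyticOnNhd_const.sub (analyticOnNhd_const.mul (Finset.analyticOnNhd_fun_sum _ fun j _ =>
      (analyticOnNhd_pd (hΓ i) j).mul (h.analytic_a j k)))).sub
      (analyticOnNhd_const.mul (Finset.analyticOnNhd_fun_sum _ fun j _ =>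
        (analyticOnNhd_pd (h.analytic_a j k) i).mul (hΓ j)))
  have hfξ : ∀ i k, f i k (γ 0) = 0 := fun i k => by
    simp only [hf, hg.start, h.hess, h.pd_Γ_pole]; simp
  have hec : ∀ i k, ContinuousOn (fun s => e s i k) (Icc 0 1) := fun i k =>
    continuousOn_const.mul (continuousOn_finsetSum _ fun j _ =>
      ((analyticOnNhd_pd (h.analytic_a j k) i).continuousOn.comp hγc hB).mul (hpc' j))
  have hw0 : w 0 = 0 := by ext i; simp [hw, hg.start, h.pd_Γ_pole]
  have key : ∀ s ∈ Icc (0 : ℝ) 1, w s = 0 := by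
    refine eq_zero_of_singular_system (b := fun s i k => f i k (γ s) - s * e s i k) hwd hw0 ?_
      (fun s hs i => ?_) (fun i k => ?_)
    · ext i
      have e1 : ∑ j, v 0 j • pd j (pd i Γ) (γ 0)
          = 1 / 2 * ∑ k, (∑ j, pd j (pd i Γ) ξ * F.a ξ j k) * p 0 k := by
        simp only [hv, hg.start, smul_eq_mul, Finset.sum_mul, Finset.mul_sum]
        rw [Finset.sum_comm]
        exact Finset.sum_congr rfl fun j _ => Finset.sum_congr rfl fun k _ => by ring
      simp only [hw', e1, h.hess, Matrix.one_apply]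
      simp
    · have hx := hB s hs
      have e0 := h.flow_pd _ hx i
      have e1 : ∀ k, s * p s k = w s k + pd k Γ (γ s) := fun k => by simp [hw]
      have e2 : s * ∑ j, v s j • pd j (pd i Γ) (γ s)
          = ∑ j, F.flow Γ (γ s) j * pd j (pd i Γ) (γ s)
            + ∑ k, (1 / 2 * ∑ j, pd j (pd i Γ) (γ s) * F.a (γ s) j k) * w s k := by
        have e3 : ∑ k, (1 / 2 * ∑ j, pd j (pd i Γ) (γ s) * F.a (γ s) j k) * w s k
            = ∑ j, (1 / 2 * ∑ k, F.a (γ s) j k * w s k) * pd j (pd i Γ) (γ s) := by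
          simp only [Finset.mul_sum, Finset.sum_mul]
          rw [Finset.sum_comm]
          exact Finset.sum_congr rfl fun j _ => Finset.sum_congr rfl fun k _ => by ring
        rw [e3, ← Finset.sum_add_distrib, Finset.mul_sum]
        refine Finset.sum_congr rfl fun j _ => ?_
        rw [← add_mul, LinOp.flow, ← mul_add, ← Finset.sum_add_distrib]
        simp only [← mul_add, hv, smul_eq_mul]
        rw [← mul_assoc, mul_left_comm s, Finset.mul_sum]
        congr 2
        exact Finset.sum_congr rfl fun k _ => by rw [mul_left_comm, e1, add_comm]
      have e4 : s * (s * p' s i) = -(1 / 4) * ∑ j, ∑ k,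
          pd i (fun y => F.a y j k) (γ s) * (s * p s j) * (s * p s k) := by
        simp only [hp', Finset.mul_sum]
        exact Finset.sum_congr rfl fun j _ => Finset.sum_congr rfl fun k _ => by ring
      have e5 : ∑ j, ∑ k, pd i (fun y => F.a y j k) (γ s) * (s * p s j) * (s * p s k)
          = ∑ j, ∑ k, pd i (fun y => F.a y j k) (γ s) * pd j Γ (γ s) * pd k Γ (γ s)
            + ∑ k, (∑ j, pd i (fun y => F.a y j k) (γ s) * pd j Γ (γ s)) * w s k
            + s * ∑ k, (∑ j, pd i (fun y => F.a y j k) (γ s) * p s j) * w s k := by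
        have e6 : ∑ k, (∑ j, pd i (fun y => F.a y j k) (γ s) * pd j Γ (γ s)) * w s k
            = ∑ j, ∑ k, pd i (fun y => F.a y j k) (γ s) * w s j * pd k Γ (γ s) := by
          simp only [Finset.sum_mul]
          exact Finset.sum_congr rfl fun k _ => Finset.sum_congr rfl fun j _ => by
            rw [h.pd_a_symm hx]; ring
        have e7 : s * ∑ k, (∑ j, pd i (fun y => F.a y j k) (γ s) * p s j) * w s k
            = ∑ j, ∑ k, pd i (fun y => F.a y j k) (γ s) * (s * p s j) * w s k := by
          simp only [Finset.sum_mul, Finset.mul_sum]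
          rw [Finset.sum_comm]
          exact Finset.sum_congr rfl fun k _ => Finset.sum_congr rfl fun j _ => by ring
        rw [e6, e7]
        simp only [← Finset.sum_add_distrib]
        exact Finset.sum_congr rfl fun j _ => Finset.sum_congr rfl fun k _ => by
          rw [e1 j, e1 k]; ring
      have e8 : ∑ k, (f i k (γ s) - s * e s i k) * w s k
          = w s i - ∑ k, (1 / 2 * ∑ j, pd j (pd i Γ) (γ s) * F.a (γ s) j k) * w s k
            - 1 / 4 * ∑ k, (∑ j, pd i (fun y => F.a y j k) (γ s) * pd j Γ (γ s)) * w s k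
            - 1 / 4 * (s * ∑ k, (∑ j, pd i (fun y => F.a y j k) (γ s) * p s j) * w s k) := by
        have e9 : w s i = ∑ k, (1 : Matrix (Fin n) (Fin n) ℝ) i k * w s k := by
          simp [Matrix.one_apply]
        rw [e9, Finset.mul_sum, Finset.mul_sum, Finset.mul_sum, ← Finset.sum_sub_distrib,
          ← Finset.sum_sub_distrib, ← Finset.sum_sub_distrib]
        exact Finset.sum_congr rfl fun k _ => by simp only [hf, he]; ring
      have e10 : s * w' s i = s * p s i + s * (s * p' s i)
          - s * ∑ j, v s j • pd j (pd i Γ) (γ s) := by simp only [hw']; ring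
      rw [e10, e8, e2, e4, e5, e0, e1 i]
      ring
    · obtain ⟨C₁, hC₁, h1⟩ := deriv_curve_bound (hfa i k) hg.position hB hgc (hfξ i k)
      obtain ⟨C₂, hC₂⟩ := isCompact_Icc.exists_bound_of_continuousOn (hec i k)
      have hC₂0 := (norm_nonneg _).trans (hC₂ 0 h0)
      refine ⟨C₁ + C₂, by positivity, fun s hs => ?_⟩
      have e1 : |s * e s i k| ≤ C₂ * s := by
        rw [abs_mul, abs_of_nonneg hs.1, mul_comm]
        exact mul_le_mul_of_nonneg_right (hC₂ s hs) hs.1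
      linarith [abs_sub (f i k (γ s)) (s * e s i k), h1 s hs]
  have := congrFun (key s hs) i
  simpa [hw, sub_eq_zero] using this

/-- Along a geodesic issuing from the pole, `s dx/ds` is the Euler field. -/
theorem flow_geodesic (h : Chart F ξ B Γ Z) (hNB : N ⊆ B) {γ p : ℝ → Fin n → ℝ}
    (hg : F.IsGeodesic ξ N γ p) {s : ℝ} (hs : s ∈ Icc (0 : ℝ) 1) (i : Fin n) :
    s * ((1 / 2) * ∑ j, F.a (γ s) i j * p s j) = F.flow Γ (γ s) i := by
  rw [LinOp.flow, mul_left_comm, Finset.mul_sum]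
  congr 1
  exact Finset.sum_congr rfl fun j _ => by rw [mul_left_comm, h.momentum_eq hNB hg hs]

theorem mul_derivWithin_geodesic (h : Chart F ξ B Γ Z) (hNB : N ⊆ B) {γ p : ℝ → Fin n → ℝ}
    (hg : F.IsGeodesic ξ N γ p) {u : (Fin n → ℝ) → ℝ} {s : ℝ} (hs : s ∈ Icc (0 : ℝ) 1)
    (hu : DifferentiableAt ℝ u (γ s)) :
    s * derivWithin (fun τ => u (γ τ)) (Icc 0 1) s
      = ∑ j, F.flow Γ (γ s) j * pd j u (γ s) := by
  rw [(hasDerivWithinAt_comp_curve hu (hg.position s hs)).derivWithin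
    (uniqueDiffOn_Icc zero_lt_one s hs), Finset.mul_sum]
  exact Finset.sum_congr rfl fun j _ => by
    rw [smul_eq_mul, ← mul_assoc, h.flow_geodesic hNB hg hs]

/-- The normal coordinates of a geodesic are linear functions of the parameter. -/
theorem Z_geodesic (h : Chart F ξ B Γ Z) (hNB : N ⊆ B) {γ p : ℝ → Fin n → ℝ}
    (hg : F.IsGeodesic ξ N γ p) {s : ℝ} (hs : s ∈ Icc (0 : ℝ) 1) (i : Fin n) :
    Z i (γ s) = s * ((1 / 2) * ∑ j, F.a ξ i j * p 0 j) := by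
  have hZ : ∀ s ∈ Icc (0 : ℝ) 1, DifferentiableAt ℝ (Z i) (γ s) := fun s hs =>
    (h.analytic_Z i _ (hNB (hg.mem s hs))).differentiableAt
  rw [eq_mul_of_euler (ζ := fun s => Z i (γ s)) (fun s hs =>
    hasDerivWithinAt_comp_curve (hZ s hs) (hg.position s hs)) (fun s hs => ?_) s hs]
  · simp only [hg.start, h.pd_Z, Matrix.one_apply, smul_eq_mul]
    simp
  · rw [← h.flow_Z _ (hNB (hg.mem s hs)) i, Finset.mul_sum]
    exact Finset.sum_congr rfl fun j _ => by
      rw [smul_eq_mul, ← mul_assoc, h.flow_geodesic hNB hg hs]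

end Chart

namespace Chart

variable {F : LinOp n} {ξ : Fin n → ℝ} {B N : Set (Fin n → ℝ)} {Γ : (Fin n → ℝ) → ℝ}
  {Z : Fin n → (Fin n → ℝ) → ℝ}

/-- The normal coordinates have a continuously differentiable inverse near the origin. -/
theorem exists_exp (h : Chart F ξ B Γ Z) :
    ∃ ρ > 0, ∃ X : (Fin n → ℝ) → Fin n → ℝ, (∀ v ∈ ball 0 ρ, ContDiffAt ℝ 1 X v) ∧
      IsOpen (X '' ball 0 ρ) ∧ X '' ball 0 ρ ⊆ B ∧ X 0 = ξ ∧
      ∀ v ∈ ball 0 ρ, (fun i => Z i (X v)) = v := by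
  set Y : (Fin n → ℝ) → Fin n → ℝ := fun x i => Z i x with hY
  have hYa : ContDiffAt ℝ 1 Y ξ := contDiffAt_pi.2 fun i => (h.analytic_Z i ξ h.mem).contDiffAt
  have hYd : HasFDerivAt Y ((ContinuousLinearEquiv.refl ℝ (Fin n → ℝ) :
      (Fin n → ℝ) →L[ℝ] Fin n → ℝ)) ξ := by
    refine hasFDerivAt_pi'.2 fun i => ?_
    have h1 := (h.analytic_Z i ξ h.mem).differentiableAt.hasFDerivAt
    convert h1 using 1
    ext v
    rw [fderiv_eq_sum_pd]
    simp [h.pd_Z, Matrix.one_apply]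
  set e := hYa.toOpenPartialHomeomorph Y hYd one_ne_zero with he
  have heY : ∀ x, e x = Y x := fun x => rfl
  have hξe : ξ ∈ e.source := hYa.mem_toOpenPartialHomeomorph_source hYd one_ne_zero
  have hYξ : Y ξ = 0 := by ext i; exact h.Z_zero i
  have h0t : (0 : Fin n → ℝ) ∈ e.target := by
    have := e.map_source hξe
    rwa [heY, hYξ] at this
  have hX0 : e.symm 0 = ξ := by
    have := e.left_inv hξe
    rwa [heY, hYξ] at this
  have hsm : ContDiffAt ℝ 1 e.symm 0 := by
    have := hYa.to_localInverse hYd one_ne_zero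
    rwa [hYξ] at this
  have hev : ∀ᶠ v in 𝓝 (0 : Fin n → ℝ), v ∈ e.target ∧ ContDiffAt ℝ 1 e.symm v ∧ e.symm v ∈ B := by
    have k1 : ∀ᶠ v in 𝓝 (0 : Fin n → ℝ), v ∈ e.target := e.open_target.mem_nhds h0t
    refine k1.and ((hsm.eventually (by simp)).and ?_)
    refine hsm.continuousAt.eventually ?_
    rw [hX0]
    exact h.isOpen.mem_nhds h.mem
  obtain ⟨ρ, hρ, hball⟩ := Metric.eventually_nhds_iff_ball.1 hev
  refine ⟨ρ, hρ, e.symm, fun v hv => (hball v hv).2.1, ?_, ?_, hX0, fun v hv => ?_⟩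
  · exact e.symm.isOpen_image_of_subset_source isOpen_ball fun v hv => (hball v hv).1
  · rintro _ ⟨v, hv, rfl⟩
    exact (hball v hv).2.2
  · have := e.right_inv (hball v hv).1
    rwa [heY] at this

/-- The rays of the normal coordinates are geodesics. -/
theorem exists_geodesic (h : Chart F ξ B Γ Z) {ρ : ℝ} {X : (Fin n → ℝ) → Fin n → ℝ}
    (hX : ∀ v ∈ ball 0 ρ, ContDiffAt ℝ 1 X v) (hN : IsOpen (X '' ball 0 ρ))
    (hNB : X '' ball 0 ρ ⊆ B) (hX0 : X 0 = ξ) (hZX : ∀ v ∈ ball 0 ρ, (fun i => Z i (X v)) = v)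
    {v : Fin n → ℝ} (hv : v ∈ ball 0 ρ) :
    ∃ γ p, F.IsGeodesic ξ (X '' ball 0 ρ) γ p ∧ p 0 = (2 : ℝ) • (F.a ξ)⁻¹.mulVec v ∧ γ 1 = X v := by
  have h0 : (0 : ℝ) ∈ Icc (0 : ℝ) 1 := ⟨le_rfl, zero_le_one⟩
  set θ : Fin n → ℝ := (2 : ℝ) • (F.a ξ)⁻¹.mulVec v with hθ
  have hsv : ∀ s ∈ Icc (0 : ℝ) 1, s • v ∈ ball (0 : Fin n → ℝ) ρ := fun s hs => by
    rw [mem_ball_zero_iff] at hv ⊢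
    rw [norm_smul, Real.norm_of_nonneg hs.1]
    exact (mul_le_of_le_one_left (norm_nonneg _) hs.2).trans_lt hv
  set γ : ℝ → Fin n → ℝ := fun s => X (s • v) with hγ
  have hmem : ∀ s ∈ Icc (0 : ℝ) 1, γ s ∈ X '' ball 0 ρ := fun s hs => ⟨_, hsv s hs, rfl⟩
  have hB : ∀ s ∈ Icc (0 : ℝ) 1, γ s ∈ B := fun s hs => hNB (hmem s hs)
  have hZγ : ∀ s ∈ Icc (0 : ℝ) 1, ∀ i, Z i (γ s) = s * v i := fun s hs i =>
    congrFun (hZX _ (hsv s hs)) i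
  -- Since Γ is quadratic in Z and Z = s v on the ray, dΓ = s P with P = ∑ θⱼ dZⱼ. This defines the
  -- momentum without dividing by s.
  set P : Fin n → (Fin n → ℝ) → ℝ := fun i x => ∑ j, pd i (Z j) x * θ j with hP
  have hPa : ∀ i, AnalyticOnNhd ℝ (P i) B := fun i => Finset.analyticOnNhd_fun_sum _ fun j _ =>
    (analyticOnNhd_pd (h.analytic_Z j) i).mul analyticOnNhd_const
  set p : ℝ → Fin n → ℝ := fun s i => P i (γ s) with hp
  have hsp : ∀ s ∈ Icc (0 : ℝ) 1, ∀ i, s * p s i = pd i Γ (γ s) := fun s hs i => by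
    rw [h.pd_Γ _ (hB s hs) i]
    simp only [hp, hP, Finset.mul_sum]
    refine Finset.sum_congr rfl fun j _ => ?_
    have : θ j = ∑ k, 2 * ((F.a ξ)⁻¹ j k * v k) := by
      simp only [hθ, Pi.smul_apply, Matrix.mulVec, dotProduct, smul_eq_mul, Finset.mul_sum]
    rw [this, Finset.mul_sum, Finset.mul_sum]
    refine Finset.sum_congr rfl fun k _ => ?_
    rw [hZγ s hs]; ring
  set g : ℝ → Fin n → ℝ := fun s => fderiv ℝ X (s • v) v with hg
  have hγd : ∀ s ∈ Icc (0 : ℝ) 1, HasDerivWithinAt γ (g s) (Icc 0 1) s := fun s hs => by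
    have h1 : HasDerivAt (fun s : ℝ => s • v) v s := by
      simpa using (hasDerivAt_id s).smul_const v
    exact (((hX _ (hsv s hs)).differentiableAt one_ne_zero).hasFDerivAt.comp_hasDerivAt s
      h1).hasDerivWithinAt
  have hγc : ContinuousOn γ (Icc 0 1) := fun s hs => (hγd s hs).continuousWithinAt
  have hgc : ContinuousOn g (Icc 0 1) := fun s hs => by
    have h1 : ContinuousAt (fderiv ℝ X) (s • v) :=
      ((hX _ (hsv s hs)).fderiv_right (m := 0) (by simp)).continuousAt
    have h2 : ContinuousAt (fun s : ℝ => fderiv ℝ X (s • v)) s :=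
      ContinuousAt.comp (f := fun s : ℝ => s • v) h1 (by fun_prop)
    exact (h2.clm_apply continuousAt_const).continuousWithinAt
  have hpc : ∀ i, ContinuousOn (fun s => p s i) (Icc 0 1) := fun i =>
    (hPa i).continuousOn.comp hγc hB
  have hac : ∀ i j, ContinuousOn (fun s => F.a (γ s) i j) (Icc 0 1) := fun i j =>
    (h.analytic_a i j).continuousOn.comp hγc hB
  have hflow : ∀ s ∈ Icc (0 : ℝ) 1, ∀ i, F.flow Γ (γ s) i
      = s * ((1 / 2) * ∑ j, F.a (γ s) i j * p s j) := fun s hs i => by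
    rw [LinOp.flow, mul_left_comm s]
    congr 1
    rw [Finset.mul_sum]
    exact Finset.sum_congr rfl fun j _ => by rw [mul_left_comm s, hsp s hs]
  -- In the coordinates Z the flow is the Euler field, so at the point s v its components are s v;
  -- the derivative of the inverse chart carries this back.
  have hDX : ∀ s ∈ Icc (0 : ℝ) 1, s • g s = F.flow Γ (γ s) := fun s hs => by
    have hx := hB s hs
    set Y : (Fin n → ℝ) → Fin n → ℝ := fun x i => Z i x with hY
    have hYs : Y (γ s) = s • v := hZX _ (hsv s hs)
    have hYd : HasFDerivAt Y (ContinuousLinearMap.pi fun i => fderiv ℝ (Z i) (γ s)) (γ s) :=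
      hasFDerivAt_pi.2 fun i => (h.analytic_Z i _ hx).differentiableAt.hasFDerivAt
    have hXd : HasFDerivAt X (fderiv ℝ X (s • v)) (Y (γ s)) := by
      rw [hYs]
      exact ((hX _ (hsv s hs)).differentiableAt one_ne_zero).hasFDerivAt
    have h1 := hXd.comp (γ s) hYd
    have h2 : HasFDerivAt (X ∘ Y) (ContinuousLinearMap.id ℝ _) (γ s) := by
      refine (hasFDerivAt_id _).congr_of_eventuallyEq ?_
      filter_upwards [hN.mem_nhds (hmem s hs)]
      rintro _ ⟨w, hw, rfl⟩
      exact congrArg X (hZX w hw)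
    have h3 := DFunLike.congr_fun (h1.unique h2) (F.flow Γ (γ s))
    have h4 : (ContinuousLinearMap.pi fun i => fderiv ℝ (Z i) (γ s)) (F.flow Γ (γ s))
        = s • v := by
      ext i
      simp only [ContinuousLinearMap.pi_apply, fderiv_eq_sum_pd, smul_eq_mul]
      rw [h.flow_Z _ hx, hZγ s hs]
      rfl
    simp only [ContinuousLinearMap.comp_apply, h4, ContinuousLinearMap.map_smul,
      ContinuousLinearMap.id_apply] at h3
    exact h3
  -- The velocity equation is known only after multiplication by s. It is divided out for s > 0 and
  -- extended to s = 0 by continuity, as is the momentum equation below.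
  have hpos : ∀ i, EqOn (fun s => g s i) (fun s => (1 / 2) * ∑ j, F.a (γ s) i j * p s j)
      (Icc 0 1) := fun i => by
    refine eqOn_Icc_of_eqOn_Ioc ((continuous_apply i).comp_continuousOn hgc)
      (continuousOn_const.mul (continuousOn_finsetSum _ fun j _ => (hac i j).mul (hpc j)))
      fun s hs => ?_
    have h1 := congrFun (hDX s (Ioc_subset_Icc_self hs)) i
    rw [hflow s (Ioc_subset_Icc_self hs) i] at h1
    exact mul_left_cancel₀ hs.1.ne' h1
  have hpd : ∀ i, ∀ s ∈ Icc (0 : ℝ) 1, HasDerivWithinAt (fun s => p s i)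
      (∑ j, g s j • pd j (P i) (γ s)) (Icc 0 1) s := fun i s hs =>
    hasDerivWithinAt_comp_curve (hPa i _ (hB s hs)).differentiableAt (hγd s hs)
  have hmom : ∀ i, EqOn (fun s => ∑ j, g s j • pd j (P i) (γ s))
      (fun s => -(1 / 4) * ∑ j, ∑ k, pd i (fun y => F.a y j k) (γ s) * p s j * p s k)
      (Icc 0 1) := fun i => by
    refine eqOn_Icc_of_eqOn_Ioc (continuousOn_finsetSum _ fun j _ =>
      ((continuous_apply j).comp_continuousOn hgc).smul
        ((analyticOnNhd_pd (hPa i) j).continuousOn.comp hγc hB))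
      (continuousOn_const.mul (continuousOn_finsetSum _ fun j _ =>
        continuousOn_finsetSum _ fun k _ =>
          ((((analyticOnNhd_pd (h.analytic_a j k) i).continuousOn.comp hγc hB)).mul (hpc j)).mul
            (hpc k))) fun s hs => ?_
    have hs' := Ioc_subset_Icc_self hs
    have hx := hB s hs'
    -- Two expressions for the derivative of s p = dΓ along the ray are compared; the differentiated
    -- eikonal equation then gives the momentum equation multiplied by s².
    have h1 := (hasDerivWithinAt_id s (Icc (0 : ℝ) 1)).mul (hpd i s hs')
    have h2 : HasDerivWithinAt (fun s => pd i Γ (γ s)) (∑ j, g s j • pd j (pd i Γ) (γ s))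
        (Icc 0 1) s := hasDerivWithinAt_comp_curve
      (analyticOnNhd_pd h.analytic_Γ i _ hx).differentiableAt (hγd s hs')
    have h3 := (uniqueDiffOn_Icc zero_lt_one s hs').eq_deriv _ h1
      (h2.congr (fun t ht => hsp t ht i) (hsp s hs' i))
    have h4 : s * ∑ j, g s j • pd j (pd i Γ) (γ s)
        = ∑ j, F.flow Γ (γ s) j * pd j (pd i Γ) (γ s) := by
      rw [Finset.mul_sum]
      refine Finset.sum_congr rfl fun j _ => ?_
      rw [← hDX s hs', Pi.smul_apply, smul_eq_mul, smul_eq_mul, mul_assoc]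
    have h5 := h.flow_pd _ hx i
    have h6 : ∑ j, ∑ k, pd i (fun y => F.a y j k) (γ s) * pd j Γ (γ s) * pd k Γ (γ s)
        = s * (s * ∑ j, ∑ k, pd i (fun y => F.a y j k) (γ s) * p s j * p s k) := by
      simp only [Finset.mul_sum, ← hsp s hs']
      exact Finset.sum_congr rfl fun j _ => Finset.sum_congr rfl fun k _ => by ring
    rw [← h4, h6, ← hsp s hs' i, ← h3] at h5
    have hs0 : s ≠ 0 := hs.1.ne'
    simp only [id] at h5
    refine mul_left_cancel₀ hs0 (mul_left_cancel₀ hs0 ?_)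
    linear_combination h5
  refine ⟨γ, p, ⟨by simp [hγ, hX0], hmem, fun s hs => ?_, fun s hs => ?_⟩, ?_, by simp [hγ]⟩
  · convert hγd s hs using 1
    ext i
    exact (hpos i hs).symm
  · exact hasDerivWithinAt_pi.2 fun i => by
      have := hpd i s hs
      rwa [show ∑ j, g s j • pd j (P i) (γ s) = _ from hmom i hs] at this
  · ext i
    simp [hp, hP, hγ, hX0, h.pd_Z, Matrix.one_apply]

/-- A neighbourhood in which the chart describes the geodesics issuing from the pole. -/
theorem exists_nhd (h : Chart F ξ B Γ Z) :
    ∃ N ⊆ B, IsPreconnected N ∧ F.IsNormalNhd ξ N ∧ (∀ x ∈ N, F.world ξ N x = Γ x) ∧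
      (∀ x ∈ N, ∃ γ p, F.IsGeodesic ξ N γ p ∧ γ 1 = x) ∧
      ∃ ε > 0, ∀ v : Fin n → ℝ, ‖v‖ < ε → ∃ γ : ℝ → Fin n → ℝ, γ 0 = ξ ∧
        HasDerivWithinAt γ v (Icc 0 1) 0 ∧ ∀ s ∈ Icc (0 : ℝ) 1, γ s ∈ N ∧
          Γ (γ s) = s ^ 2 * ∑ i, ∑ j, (F.a ξ)⁻¹ i j * v i * v j := by
  obtain ⟨ρ, hρ, X, hX, hN, hNB, hX0, hZX⟩ := h.exists_exp
  set N := X '' ball 0 ρ with hNdef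
  have hu : IsUnit (F.a ξ).det := isUnit_iff_ne_zero.2 h.det
  have hr : ∀ v ∈ ball (0 : Fin n → ℝ) ρ, F.Reaches ξ N ((2 : ℝ) • (F.a ξ)⁻¹.mulVec v) (X v) :=
    fun v hv => h.exists_geodesic hX hN hNB hX0 hZX hv
  -- At s = 1 the normal coordinates of any geodesic from the pole inside N are ½ a(ξ) θ, so the
  -- endpoint determines θ.
  have hr' : ∀ v ∈ ball (0 : Fin n → ℝ) ρ, ∀ θ, F.Reaches ξ N θ (X v) →
      θ = (2 : ℝ) • (F.a ξ)⁻¹.mulVec v := by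
    rintro v hv θ ⟨γ, p, hg, rfl, h1⟩
    have e1 : (1 / 2 : ℝ) • (F.a ξ).mulVec (p 0) = v := by
      rw [← hZX v hv]
      ext i
      have := h.Z_geodesic hNB hg (s := 1) ⟨zero_le_one, le_rfl⟩ i
      rw [h1, one_mul] at this
      rw [this]
      simp [Matrix.mulVec, dotProduct]
    rw [← e1, Matrix.mulVec_smul, Matrix.mulVec_mulVec, Matrix.nonsing_inv_mul _ hu,
      Matrix.one_mulVec]
    ext i; simp
  refine ⟨N, hNB, ?_, ⟨hN, ⟨0, mem_ball_self hρ, hX0⟩, ?_⟩, ?_, ?_, ρ, hρ, fun v hv => ?_⟩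
  · exact (convex_ball 0 ρ).isPreconnected.image X fun v hv =>
      (hX v hv).continuousAt.continuousWithinAt
  · rintro _ ⟨v, hv, rfl⟩
    exact ⟨_, hr v hv, hr' v hv⟩
  · rintro _ ⟨v, hv, rfl⟩
    have hex : ∃ θ, F.Reaches ξ N θ (X v) := ⟨_, hr v hv⟩
    rw [LinOp.world, dif_pos hex, hr' v hv _ hex.choose_spec, h.Γ_eq _ (hNB ⟨v, hv, rfl⟩)]
    have e1 : ∀ i, Z i (X v) = v i := fun i => congrFun (hZX v hv) i
    simp only [e1, LinOp.H]
    set A := (F.a ξ)⁻¹ with hA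
    have e2 : ∀ i, ∑ j, F.a ξ i j * A.mulVec v j = v i := fun i => by
      have := congrFun (Matrix.mulVec_mulVec v (F.a ξ) A) i
      rw [hA, Matrix.mul_nonsing_inv _ hu, Matrix.one_mulVec] at this
      exact this
    have e3 : ∑ i, ∑ j, F.a ξ i j * ((2 : ℝ) • A.mulVec v) i * ((2 : ℝ) • A.mulVec v) j
        = ∑ i, 4 * (A.mulVec v i * ∑ j, F.a ξ i j * A.mulVec v j) := by
      simp only [Finset.mul_sum]
      refine Finset.sum_congr rfl fun i _ => Finset.sum_congr rfl fun j _ => ?_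
      simp only [Pi.smul_apply, smul_eq_mul]
      ring
    rw [e3, ← Finset.mul_sum, ← mul_assoc]
    simp only [e2]
    norm_num
    refine Finset.sum_congr rfl fun i _ => ?_
    rw [Matrix.mulVec, dotProduct, Finset.sum_mul]
    exact Finset.sum_congr rfl fun j _ => by ring
  · rintro _ ⟨v, hv, rfl⟩
    obtain ⟨γ, p, hg, -, h1⟩ := hr v hv
    exact ⟨γ, p, hg, h1⟩
  · obtain ⟨γ, p, hg, h0, -⟩ := hr v (mem_ball_zero_iff.2 hv)
    have e1 : (fun i => (1 / 2) * ∑ j, F.a ξ i j * p 0 j) = v := by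
      have h2 : (1 / 2 : ℝ) • (F.a ξ).mulVec (p 0) = v := by
        rw [h0, Matrix.mulVec_smul, Matrix.mulVec_mulVec, Matrix.mul_nonsing_inv _ hu,
          Matrix.one_mulVec]
        ext i; simp
      rw [← h2]
      ext i; simp [Matrix.mulVec, dotProduct]
    refine ⟨γ, hg.start, ?_, fun s hs => ⟨hg.mem s hs, ?_⟩⟩
    · have h2 := hg.position 0 ⟨le_rfl, zero_le_one⟩
      rwa [hg.start, e1] at h2
    · have h2 : ∀ i, Z i (γ s) = s * v i := fun i => by
        rw [h.Z_geodesic hNB hg hs i, ← congrFun e1 i]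
      rw [h.Γ_eq _ (hNB (hg.mem s hs))]
      simp only [h2, Finset.mul_sum]
      exact Finset.sum_congr rfl fun i _ => Finset.sum_congr rfl fun j _ => by ring

end Chart

/-! ### The operator applied to α Γ^μ + β log Γ + w -/

section Calculus

variable {E : Type*} [NormedAddCommGroup E] [NormedSpace ℝ E] {f g : (Fin n → ℝ) → E}
  {u v : (Fin n → ℝ) → ℝ} {x : Fin n → ℝ}

theorem pd_add (hf : DifferentiableAt ℝ f x) (hg : DifferentiableAt ℝ g x) (i : Fin n) :
    pd i (fun y => f y + g y) x = pd i f x + pd i g x :=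
  DFunLike.congr_fun (hf.hasFDerivAt.add hg.hasFDerivAt).fderiv _

theorem pd_smul (hu : DifferentiableAt ℝ u x) (hg : DifferentiableAt ℝ g x) (i : Fin n) :
    pd i (fun y => u y • g y) x = u x • pd i g x + pd i u x • g x :=
  DFunLike.congr_fun (hu.hasFDerivAt.smul hg.hasFDerivAt).fderiv _

theorem pd_const_smul (t : ℝ) (hg : DifferentiableAt ℝ g x) (i : Fin n) :
    pd i (fun y => t • g y) x = t • pd i g x :=
  DFunLike.congr_fun (hg.hasFDerivAt.const_smul t).fderiv _

theorem pd_ofReal (hu : DifferentiableAt ℝ u x) (i : Fin n) :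
    pd i (fun y => (u y : ℂ)) x = ((pd i u x : ℝ) : ℂ) :=
  DFunLike.congr_fun (Complex.ofRealCLM.hasFDerivAt.comp x hu.hasFDerivAt).fderiv _

theorem pd_scalar_comp {φ : ℝ → E} {φ' : E} (hφ : HasDerivAt φ φ' (u x))
    (hu : DifferentiableAt ℝ u x) (i : Fin n) : pd i (fun y => φ (u y)) x = pd i u x • φ' :=
  DFunLike.congr_fun (hφ.hasFDerivAt.comp x hu.hasFDerivAt).fderiv _

theorem pd_div (hv : DifferentiableAt ℝ v x) (hu : DifferentiableAt ℝ u x)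
    (h0 : u x ≠ 0) (i : Fin n) :
    pd i (fun y => v y / u y) x = pd i v x / u x - v x * pd i u x / u x ^ 2 := by
  have h1 : pd i (fun y => (u y)⁻¹) x = pd i u x • (-(u x ^ 2)⁻¹) :=
    pd_scalar_comp (hasDerivAt_inv h0) hu i
  have h2 := pd_smul (g := fun y => (u y)⁻¹) hv (hu.inv h0) i
  simp only [smul_eq_mul, ← div_eq_mul_inv] at h2
  rw [h2, h1, smul_eq_mul]
  field_simp
  ring

end Calculus

namespace LinOp

variable (F : LinOp n) (Γ : (Fin n → ℝ) → ℝ)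

/-- `¼ ∑ aⁱʲ ∂ᵢ∂ⱼ Γ + ¼ ∑ Bⁱ ∂ᵢ Γ`. -/
def dens (x : Fin n → ℝ) : ℝ :=
  (1 / 4) * ∑ i, ∑ j, F.a x i j * pd i (pd j Γ) x + (1 / 4) * ∑ i, F.B x i * pd i Γ x

/-- The transport operator `½ ∑ aⁱʲ ∂ⱼΓ ∂ᵢ + D + k`. -/
def transp (k : ℝ) (u : (Fin n → ℝ) → ℝ) (x : Fin n → ℝ) : ℝ :=
  ∑ j, F.flow Γ x j * pd j u x + (F.dens Γ x + k) * u x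

end LinOp

/-- `α g + β h + w`. -/
def comb (g h : (Fin n → ℝ) → ℂ) (α β w : (Fin n → ℝ) → ℝ) (y : Fin n → ℝ) : ℂ :=
  α y • g y + β y • h y + (w y : ℂ)

/-- `g` and `h` are differentiable near `x` and have the logarithmic derivatives of `Γ ^ μ` and the
derivatives of `log Γ`. -/
structure PowLog (Γ : (Fin n → ℝ) → ℝ) (μ : ℝ) (g h : (Fin n → ℝ) → ℂ) (x : Fin n → ℝ) : Prop where
  analytic : AnalyticAt ℝ Γ x
  ne_zero : Γ x ≠ 0
  diff_g : ∀ᶠ y in 𝓝 x, DifferentiableAt ℝ g y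
  diff_h : ∀ᶠ y in 𝓝 x, DifferentiableAt ℝ h y
  pd_g : ∀ᶠ y in 𝓝 x, ∀ i, pd i g y = (μ * (pd i Γ y / Γ y)) • g y
  pd_h : ∀ᶠ y in 𝓝 x, ∀ i, pd i h y = ((pd i Γ y / Γ y : ℝ) : ℂ)

theorem analyticAt_pd {f : (Fin n → ℝ) → ℝ} {x : Fin n → ℝ} (hf : AnalyticAt ℝ f x) (i : Fin n) :
    AnalyticAt ℝ (pd i f) x :=
  (ContinuousLinearMap.apply ℝ ℝ (Pi.single i 1 : Fin n → ℝ)).analyticAt _ |>.comp hf.fderiv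

namespace PowLog

variable {Γ : (Fin n → ℝ) → ℝ} {μ : ℝ} {g h : (Fin n → ℝ) → ℂ} {x : Fin n → ℝ}
  {α β w : (Fin n → ℝ) → ℝ}

theorem analyticAt_div (H : PowLog Γ μ g h x) (i : Fin n) :
    AnalyticAt ℝ (fun y => pd i Γ y / Γ y) x := (analyticAt_pd H.analytic i).div H.analytic H.ne_zero

theorem pd_comb (H : PowLog Γ μ g h x) (hα : AnalyticAt ℝ α x) (hβ : AnalyticAt ℝ β x)
    (hw : AnalyticAt ℝ w x) (i : Fin n) : pd i (comb g h α β w) =ᶠ[𝓝 x]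
      comb g h (fun y => pd i α y + μ • ((pd i Γ y / Γ y) • α y)) (pd i β)
        (fun y => pd i w y + (pd i Γ y / Γ y) • β y) := by
  filter_upwards [H.diff_g, H.diff_h, H.pd_g, H.pd_h, hα.eventually_analyticAt,
    hβ.eventually_analyticAt, hw.eventually_analyticAt] with y h1 h2 h3 h4 h5 h6 h7
  have d1 : DifferentiableAt ℝ (fun y => α y • g y) y := h5.differentiableAt.smul h1
  have d2 : DifferentiableAt ℝ (fun y => β y • h y) y := h6.differentiableAt.smul h2
  have d3 : DifferentiableAt ℝ (fun y => (w y : ℂ)) y :=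
    Complex.ofRealCLM.differentiableAt.comp y h7.differentiableAt
  have e1 : pd i (comb g h α β w) y = pd i (fun y => α y • g y) y + pd i (fun y => β y • h y) y
      + pd i (fun y => (w y : ℂ)) y := by
    rw [← pd_add d1 d2, ← pd_add (f := fun y => α y • g y + β y • h y) (d1.add d2) d3]; rfl
  rw [e1, pd_smul h5.differentiableAt h1, pd_smul h6.differentiableAt h2,
    pd_ofReal h7.differentiableAt, h3, h4]
  simp only [comb, Complex.real_smul, smul_eq_mul]
  push_cast
  ring

theorem pd_pd_comb (H : PowLog Γ μ g h x) (hα : AnalyticAt ℝ α x) (hβ : AnalyticAt ℝ β x)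
    (hw : AnalyticAt ℝ w x) (k i : Fin n) : pd k (pd i (comb g h α β w)) x
      = (pd k (pd i α) x + μ / Γ x * (pd k α x * pd i Γ x + pd i α x * pd k Γ x
          + α x * pd k (pd i Γ) x) + (μ ^ 2 - μ) * (pd i Γ x * pd k Γ x) / Γ x ^ 2 * α x) • g x
        + pd k (pd i β) x • h x
        + ((pd k (pd i w) x + 1 / Γ x * (pd k β x * pd i Γ x + pd i β x * pd k Γ x
          + β x * pd k (pd i Γ) x) - (pd i Γ x * pd k Γ x) / Γ x ^ 2 * β x : ℝ) : ℂ) := by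
  have hq := H.analyticAt_div i
  have h0 := H.ne_zero
  have e1 : pd k (fun y => pd i Γ y / Γ y) x
      = pd k (pd i Γ) x / Γ x - pd i Γ x * pd k Γ x / Γ x ^ 2 :=
    pd_div (analyticAt_pd H.analytic i).differentiableAt H.analytic.differentiableAt h0 k
  have e2 : pd k (fun y => pd i α y + μ • ((pd i Γ y / Γ y) • α y)) x = pd k (pd i α) x
      + μ • ((pd i Γ x / Γ x) • pd k α x + pd k (fun y => pd i Γ y / Γ y) x • α x) := by
    have d1 : DifferentiableAt ℝ (fun y => (pd i Γ y / Γ y) • α y) x :=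
      hq.differentiableAt.smul hα.differentiableAt
    rw [pd_add (g := fun y => μ • ((pd i Γ y / Γ y) • α y)) (analyticAt_pd hα i).differentiableAt
      (d1.const_smul μ), pd_const_smul μ d1,
      pd_smul hq.differentiableAt hα.differentiableAt]
  have e3 : pd k (fun y => pd i w y + (pd i Γ y / Γ y) • β y) x = pd k (pd i w) x
      + ((pd i Γ x / Γ x) • pd k β x + pd k (fun y => pd i Γ y / Γ y) x • β x) := by
    rw [pd_add (g := fun y => (pd i Γ y / Γ y) • β y) (analyticAt_pd hw i).differentiableAt
      (hq.differentiableAt.smul hβ.differentiableAt),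
      pd_smul hq.differentiableAt hβ.differentiableAt]
  rw [pd_congr (H.pd_comb hα hβ hw i) k,
    (H.pd_comb (α := fun y => pd i α y + μ • ((pd i Γ y / Γ y) • α y))
      (w := fun y => pd i w y + (pd i Γ y / Γ y) • β y)
      ((analyticAt_pd hα i).add ((hq.smul hα).const_smul (c := μ))) (analyticAt_pd hβ i)
      ((analyticAt_pd hw i).add (hq.smul hβ)) k).eq_of_nhds]
  simp only [comb]
  rw [e2, e3, e1]
  simp only [smul_eq_mul]
  refine congrArg₂ (· + ·) (congrArg₂ (· + ·) (congrArg (· • g x) ?_) rfl) (congrArg _ ?_)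
  · field_simp
    ring
  · field_simp
    ring

/-- The action of the operator on `α Γ ^ μ + β log Γ + w`. -/
theorem app_comb (H : PowLog Γ μ g h x) {F : LinOp n} (hs : ∀ i j, F.a x i j = F.a x j i)
    (he : ∑ i, ∑ j, F.a x i j * pd i Γ x * pd j Γ x = 4 * Γ x) (hα : AnalyticAt ℝ α x)
    (hβ : AnalyticAt ℝ β x) (hw : AnalyticAt ℝ w x) :
    F.app (comb g h α β w) x
      = (F.app α x + 4 * μ / Γ x * F.transp Γ (μ - 1) α x) • g x + F.app β x • h x
        + ((F.app w x + 4 / Γ x * F.transp Γ (-1) β x : ℝ) : ℂ) := by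
  have h0 := H.ne_zero
  have hL : ∀ u : (Fin n → ℝ) → ℝ, ∑ i, ∑ k, F.a x i k * (pd i u x * pd k Γ x + pd k u x * pd i Γ x)
      = 4 * ∑ j, F.flow Γ x j * pd j u x := fun u => by
    have e1 : ∑ i, ∑ k, F.a x i k * (pd k u x * pd i Γ x)
        = ∑ i, ∑ k, F.a x i k * (pd i u x * pd k Γ x) := by
      rw [Finset.sum_comm]
      exact Finset.sum_congr rfl fun i _ => Finset.sum_congr rfl fun k _ => by rw [hs k i]
    simp only [mul_add, Finset.sum_add_distrib]
    rw [e1, ← two_mul]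
    simp only [LinOp.flow, Finset.mul_sum, Finset.sum_mul]
    exact Finset.sum_congr rfl fun i _ => Finset.sum_congr rfl fun k _ => by ring
  -- The eikonal equation lowers the double pole to a simple one. With s = μ, t = μ² - μ this treats
  -- the power, the last term supplying the shift μ - 1; with s = 1, t = -1 it treats the logarithm.
  have key : ∀ (u v : (Fin n → ℝ) → ℝ) (s t : ℝ), ∑ i, ∑ k, F.a x i k * (pd i (pd k u) x
        + s / Γ x * (pd i v x * pd k Γ x + pd k v x * pd i Γ x
          + v x * pd i (pd k Γ) x) + t * (pd k Γ x * pd i Γ x) / Γ x ^ 2 * v x)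
      = ∑ i, ∑ k, F.a x i k * pd i (pd k u) x + s / Γ x * (4 * ∑ j, F.flow Γ x j * pd j v x
          + v x * ∑ i, ∑ k, F.a x i k * pd i (pd k Γ) x) + 4 * t / Γ x * v x := by
    intro u v s t
    have e1 : 4 * t / Γ x * v x = t / Γ x ^ 2 * v x
        * ∑ i, ∑ j, F.a x i j * pd i Γ x * pd j Γ x := by
      rw [he]; field_simp
    rw [e1, ← hL]
    simp only [Finset.mul_sum, ← Finset.sum_add_distrib]
    exact Finset.sum_congr rfl fun i _ => Finset.sum_congr rfl fun k _ => by ring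
  have e1 : F.app (comb g h α β w) x
      = (∑ i, ∑ k, F.a x i k * (pd i (pd k α) x
        + μ / Γ x * (pd i α x * pd k Γ x + pd k α x * pd i Γ x
          + α x * pd i (pd k Γ) x) + (μ ^ 2 - μ) * (pd k Γ x * pd i Γ x) / Γ x ^ 2 * α x)
        + ∑ i, F.B x i * (pd i α x + μ * (pd i Γ x / Γ x * α x)) + F.C x * α x) • g x
        + F.app β x • h x
        + ((∑ i, ∑ k, F.a x i k * (pd i (pd k w) x
        + 1 / Γ x * (pd i β x * pd k Γ x + pd k β x * pd i Γ x
          + β x * pd i (pd k Γ) x) + (-1) * (pd k Γ x * pd i Γ x) / Γ x ^ 2 * β x)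
        + ∑ i, F.B x i * (pd i w x + pd i Γ x / Γ x * β x) + F.C x * w x : ℝ) : ℂ) := by
    have e2 : ∀ i, pd i (comb g h α β w) x = (pd i α x + μ * (pd i Γ x / Γ x * α x)) • g x
        + pd i β x • h x + ((pd i w x + pd i Γ x / Γ x * β x : ℝ) : ℂ) := fun i =>
      (H.pd_comb hα hβ hw i).eq_of_nhds
    rw [LinOp.app, LinOp.app]
    simp only [e2, H.pd_pd_comb hα hβ hw]
    simp only [comb, smul_add, Finset.sum_add_distrib, Complex.real_smul, smul_eq_mul]
    push_cast
    simp only [mul_add, add_mul, Finset.sum_add_distrib, Finset.sum_mul, mul_sub,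
      Finset.sum_sub_distrib, neg_mul, one_mul, mul_neg, Finset.sum_neg_distrib, neg_div, mul_assoc]
    ring
  have e3 : ∀ (u v : (Fin n → ℝ) → ℝ) (s : ℝ), ∑ i, F.B x i * (pd i u x + s * (pd i Γ x / Γ x * v x))
      = ∑ i, F.B x i * pd i u x + s / Γ x * v x * ∑ i, F.B x i * pd i Γ x := fun u v s => by
    rw [Finset.mul_sum, ← Finset.sum_add_distrib]
    exact Finset.sum_congr rfl fun i _ => by ring
  have e4 := e3 w β 1
  simp only [one_mul] at e4
  rw [e1, key, key, e3, e4]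
  refine congrArg₂ (· + ·) (congrArg₂ (· + ·) (congrArg (· • g x) ?_) rfl) (congrArg _ ?_)
  · simp only [LinOp.app, LinOp.transp, LinOp.dens, smul_eq_mul]
    field_simp
    ring
  · simp only [LinOp.app, LinOp.transp, LinOp.dens, smul_eq_mul]
    field_simp
    ring

end PowLog

theorem complex_log_ofReal {t : ℝ} (ht : t ≠ 0) :
    Complex.log (t : ℂ) = (Real.log t : ℂ) + if t < 0 then (Real.pi : ℂ) * Complex.I else 0 := by
  rw [Complex.log, Complex.norm_real, Real.norm_eq_abs, Real.log_abs]
  rcases ht.lt_or_gt with h | h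
  · rw [Complex.arg_ofReal_of_neg h, if_pos h]
  · rw [Complex.arg_ofReal_of_nonneg h.le, if_neg h.not_gt]; simp

/-- Near a point off the conoid, `log Γ` is the real logarithm up to a constant. -/
theorem eventually_log_eq {Γ : (Fin n → ℝ) → ℝ} {x : Fin n → ℝ} (hΓ : ContinuousAt Γ x)
    (h0 : Γ x ≠ 0) : ∃ c : ℂ, ∀ᶠ y in 𝓝 x, Γ y ≠ 0 ∧
      Complex.log (Γ y : ℂ) = (Real.log (Γ y) : ℂ) + c := by
  have hne : ∀ᶠ y in 𝓝 x, Γ y ≠ 0 := hΓ.eventually_ne h0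
  rcases h0.lt_or_gt with h | h
  · refine ⟨Real.pi * Complex.I, ?_⟩
    filter_upwards [hne, hΓ.eventually_lt continuousAt_const h] with y h1 h2
    exact ⟨h1, by rw [complex_log_ofReal h1, if_pos h2]⟩
  · refine ⟨0, ?_⟩
    filter_upwards [hne, continuousAt_const.eventually_lt hΓ h] with y h1 h2
    exact ⟨h1, by rw [complex_log_ofReal h1, if_neg h2.not_gt]⟩

/-- Both signs of Γ are covered at once: off the conoid the principal logarithm differs from the
real one by a locally constant number, and the power is the exponential of μ times the logarithm. -/
theorem powLog {Γ : (Fin n → ℝ) → ℝ} {x : Fin n → ℝ} (hΓ : AnalyticAt ℝ Γ x) (h0 : Γ x ≠ 0)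
    (μ : ℝ) : PowLog Γ μ (fun y => (Γ y : ℂ) ^ (μ : ℂ)) (fun y => Complex.log (Γ y : ℂ)) x := by
  obtain ⟨c, hc⟩ := eventually_log_eq hΓ.continuousAt h0
  have hlog : ∀ᶠ y in 𝓝 x, DifferentiableAt ℝ (fun y => Complex.log (Γ y : ℂ)) y ∧
      ∀ i, pd i (fun y => Complex.log (Γ y : ℂ)) y = ((pd i Γ y / Γ y : ℝ) : ℂ) := by
    filter_upwards [hc.eventually_nhds, hΓ.eventually_analyticAt] with y h1 h2
    have hd := h2.differentiableAt
    have hy0 := h1.self_of_nhds.1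
    have he : (fun y => Complex.log (Γ y : ℂ)) =ᶠ[𝓝 y]
        fun y => ((Real.log (Γ y) : ℝ) : ℂ) + c := h1.mono fun z hz => hz.2
    have h3 : HasDerivAt (fun t : ℝ => ((Real.log t : ℝ) : ℂ) + c) ((Γ y)⁻¹ : ℝ) (Γ y) :=
      ((Real.hasDerivAt_log hy0).ofReal_comp).add_const c
    refine ⟨?_, fun i => ?_⟩
    · exact (h3.differentiableAt.comp y hd).congr_of_eventuallyEq he
    · rw [pd_congr he i, pd_scalar_comp h3 hd i, Complex.real_smul, div_eq_mul_inv]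
      push_cast; ring
  have hpow : ∀ᶠ y in 𝓝 x, (fun y => (Γ y : ℂ) ^ (μ : ℂ)) =ᶠ[𝓝 y]
      fun y => Complex.exp (Complex.log (Γ y : ℂ) * μ) := by
    filter_upwards [hc.eventually_nhds] with y h1
    filter_upwards [h1] with z hz
    rw [Complex.cpow_def_of_ne_zero (by exact_mod_cast hz.1)]
  refine ⟨hΓ, h0, ?_, hlog.mono fun y hy => hy.1, ?_, hlog.mono fun y hy => hy.2⟩
  · filter_upwards [hlog, hpow] with y h1 h2
    exact ((h1.1.mul_const _).cexp).congr_of_eventuallyEq h2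
  · filter_upwards [hlog, hpow] with y h1 h2 i
    have h3 := (((h1.1.hasFDerivAt.mul_const (μ : ℂ)).cexp).congr_of_eventuallyEq h2).fderiv
    have h4 := DFunLike.congr_fun h3 (Pi.single i 1)
    have h5 := h1.2 i
    rw [pd] at h5 ⊢
    rw [h4]
    simp only [smul_apply, h5, h2.eq_of_nhds, Complex.real_smul, smul_eq_mul]
    push_cast; ring

namespace LinOp

variable {F : LinOp n}

theorem app_congr {E : Type*} [NormedAddCommGroup E] [NormedSpace ℝ E] {f g : (Fin n → ℝ) → E}
    {x : Fin n → ℝ} (h : f =ᶠ[𝓝 x] g) : F.app f x = F.app g x := by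
  have h1 : ∀ i, pd i f =ᶠ[𝓝 x] pd i g := fun i => h.eventuallyEq_nhds.mono fun y hy => pd_congr hy i
  simp only [app, h.eq_of_nhds, pd_congr h, fun i k => pd_congr (h1 k) i]

theorem transp_congr {Γ : (Fin n → ℝ) → ℝ} (k : ℝ) {f g : (Fin n → ℝ) → ℝ} {x : Fin n → ℝ}
    (h : f =ᶠ[𝓝 x] g) : F.transp Γ k f x = F.transp Γ k g x := by
  simp only [transp, h.eq_of_nhds, pd_congr h]

theorem flow_congr {Γ Γ' : (Fin n → ℝ) → ℝ} {x : Fin n → ℝ} (h : Γ =ᶠ[𝓝 x] Γ') (j : Fin n) :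
    F.flow Γ x j = F.flow Γ' x j := by
  simp only [flow, pd_congr h]

theorem dens_congr {Γ Γ' : (Fin n → ℝ) → ℝ} {x : Fin n → ℝ} (h : Γ =ᶠ[𝓝 x] Γ') :
    F.dens Γ x = F.dens Γ' x := by
  have h1 : ∀ i, pd i Γ =ᶠ[𝓝 x] pd i Γ' := fun i =>
    h.eventuallyEq_nhds.mono fun y hy => pd_congr hy i
  simp only [dens, pd_congr h, fun i k => pd_congr (h1 k) i]

theorem transp_congr' {Γ Γ' : (Fin n → ℝ) → ℝ} (k : ℝ) (u : (Fin n → ℝ) → ℝ) {x : Fin n → ℝ}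
    (h : Γ =ᶠ[𝓝 x] Γ') : F.transp Γ k u x = F.transp Γ' k u x := by
  simp only [transp, flow_congr h, dens_congr h]

theorem split_eq_comb (ξ : Fin n → ℝ) (N : Set (Fin n → ℝ)) (U V W : (Fin n → ℝ) → ℝ) :
    F.split ξ N U V W = comb (fun y => (F.world ξ N y : ℂ) ^ ((-expo n : ℝ) : ℂ))
      (fun y => Complex.log (F.world ξ N y : ℂ)) U V W := by
  ext x
  simp [split, comb]

end LinOp

/-! ### Normal neighbourhoods and the transport equations along geodesics -/

/-- A neighbourhood `N` of the pole on which the world function is the sum of the normal formal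
solution `G` of the eikonal equation. -/
structure Normalized (F : LinOp n) (ξ : Fin n → ℝ) (N : Set (Fin n → ℝ)) (R : ℝ) (H : FormalOp n)
    (G : PS n) : Prop extends Models F ξ R H, F.IsNormalNhd ξ N where
  pos : 0 < R
  conv : Conv R G
  normal : H.Normal G R
  subset : N ⊆ ball ξ R
  preconn : IsPreconnected N
  world_eq : ∀ x ∈ N, F.world ξ N x = fn ξ G x
  exists_geodesic : ∀ x ∈ N, ∃ γ p, F.IsGeodesic ξ N γ p ∧ γ 1 = x
  deriv_geodesic : ∀ γ p, F.IsGeodesic ξ N γ p → ∀ s ∈ Icc (0 : ℝ) 1, ∀ u : (Fin n → ℝ) → ℝ,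
    DifferentiableAt ℝ u (γ s) → s * derivWithin (fun τ => u (γ τ)) (Icc 0 1) s
      = ∑ j, F.flow (fn ξ G) (γ s) j * pd j u (γ s)
  a_symm : ∀ x ∈ N, ∀ i j, F.a x i j = F.a x j i
  eikonal : ∀ x ∈ N, ∑ i, ∑ j, F.a x i j * pd i (fn ξ G) x * pd j (fn ξ G) x = 4 * fn ξ G x
  curve : ∃ ε > 0, ∀ v : Fin n → ℝ, ‖v‖ < ε → ∃ γ : ℝ → Fin n → ℝ, γ 0 = ξ ∧
    HasDerivWithinAt γ v (Icc 0 1) 0 ∧ ∀ s ∈ Icc (0 : ℝ) 1, γ s ∈ N ∧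
      fn ξ G (γ s) = s ^ 2 * ∑ i, ∑ j, (F.a ξ)⁻¹ i j * v i * v j

theorem LinOp.IsAnalyticOn.exists_normalized {F : LinOp n} {Ω : Set (Fin n → ℝ)}
    (hF : F.IsAnalyticOn Ω) (hΩ : IsOpen Ω) {ξ : Fin n → ℝ} (hξ : ξ ∈ Ω) :
    ∃ (R : ℝ) (H : FormalOp n) (A : ℝ) (E : PS n) (N : Set (Fin n → ℝ)), R ≤ 1 / 2 ∧ N ⊆ Ω ∧
      H.a₀ = F.a ξ ∧ OrdGE 3 E ∧ H.Bdd (2 * R) A ∧ H.Normal (quad (F.a ξ)⁻¹ + E) (2 * R) ∧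
      Conv (2 * R) (quad (F.a ξ)⁻¹ + E) ∧ Normalized F ξ N R H (quad (F.a ξ)⁻¹ + E) := by
  obtain ⟨ρ, hρ, hball, H, hM⟩ := hF.exists_models hΩ hξ
  have hs : ∀ x ∈ ball ξ ρ, (F.a x).IsSymm := fun x hx => hF.symm x (hball hx)
  have hdet := hF.nondegenerate ξ hξ
  have hAs : ((F.a ξ)⁻¹).IsSymm := (hF.symm ξ hξ).inv
  have ha₀ := hM.a₀_eq hρ
  have haA : H.a₀ * (F.a ξ)⁻¹ = 1 := by
    rw [ha₀, Matrix.mul_nonsing_inv _ (isUnit_iff_ne_zero.2 hdet)]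
  obtain ⟨E, hE, hEik, r, hr, hrρ, hEr⟩ := FormalOp.exists_eikonal hρ (hM.symm hρ hs) hM.conv_a hAs haA
  obtain ⟨R₁, hR₁, hR₁r, hN⟩ := FormalOp.exists_normal hr (fun i j => (hM.conv_a i j).mono hrρ)
    (fun i => (hM.conv_b i).mono hrρ) hAs haA hE hEr hEik
  set R₂ := min R₁ 1 with hR₂
  have h2 : 0 < R₂ := lt_min hR₁ one_pos
  have h2r : R₂ < r := (min_le_left _ _).trans_lt (by linarith)
  obtain ⟨A, hA⟩ := hM.exists_bdd h2.le (h2r.trans_le hrρ)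
  have hG : Conv r (quad (F.a ξ)⁻¹ + E) := (conv_quad r _).add hEr
  -- The operator is controlled on the doubled radius 2R = R₂ ≤ 1. The estimates blow up at the
  -- outer radius, so the U_l built there converge on a polydisc larger than the one containing N.
  -- The bound 1 lets lower derivatives be estimated like second ones.
  set R := R₂ / 2 with hR
  have e2 : 2 * R = R₂ := by rw [hR]; ring
  have hR0 : 0 < R := by positivity
  have hRR₂ : R ≤ R₂ := by linarith
  have hN2 : H.Normal (quad (F.a ξ)⁻¹ + E) R₂ := hN.mono (min_le_left _ _)
  have hMR : Models F ξ R H := hM.mono (by linarith)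
  have hsub : ball ξ R ⊆ ball ξ ρ := ball_subset_ball (by linarith)
  obtain ⟨Z, hZ⟩ := hMR.exists_chart hR0 (fun x hx => hs x (hsub hx)) hdet hE (hEr.mono (by linarith))
    (hN2.mono hRR₂)
  obtain ⟨N, hNB, hpre, hnn, hw, hgeo, hcurve⟩ := hZ.exists_nhd
  refine ⟨R, H, A, E, N, ?_, hNB.trans (hsub.trans hball), ha₀, hE, by rwa [e2], by rwa [e2],
    by rw [e2]; exact hG.mono h2r.le, hMR, hnn, hR0, hG.mono (by linarith), hN2.mono hRR₂, hNB, hpre, hw, hgeo,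
    fun γ p hg s hsI u hu => hZ.mul_derivWithin_geodesic hNB hg hsI hu,
    fun x hx => hZ.symm x (hNB hx), fun x hx => hZ.eikonal x (hNB hx), hcurve⟩
  have := min_le_right R₁ 1
  linarith

namespace Models

variable {F : LinOp n} {ξ : Fin n → ℝ} {ρ : ℝ} {H : FormalOp n}

theorem conv_T (h : Models F ξ ρ H) {G u : PS n} (hG : Conv ρ G) (hu : Conv ρ u) (k : ℝ) :
    Conv ρ (H.T G k u) :=
  (Conv.sum _ fun i _ => (FormalOp.conv_field h.conv_a hG i).mul (hu.pderiv i)).add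
    (((FormalOp.conv_D h.conv_a h.conv_b hG).add (Conv.const k)).mul hu)

theorem transp_fn (h : Models F ξ ρ H) {G u : PS n} (hG : Conv ρ G) (hu : Conv ρ u) (k : ℝ)
    {x : Fin n → ℝ} (hx : x ∈ ball ξ ρ) :
    F.transp (fn ξ G) k (fn ξ u) x = fn ξ (H.T G k u) x := by
  have hD := FormalOp.conv_D h.conv_a h.conv_b hG
  have hL : Conv ρ (H.L G u) := Conv.sum _ fun i _ =>
    (FormalOp.conv_field h.conv_a hG i).mul (hu.pderiv i)
  rw [FormalOp.T, hL.fn_add ((hD.add (Conv.const k)).mul hu) hx,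
    (hD.add (Conv.const k)).fn_mul hu hx, hD.fn_add (Conv.const k) hx, fn_C, h.L_fn hG hu hx,
    h.D_fn hG hx]
  rfl

end Models

namespace Normalized

variable {F : LinOp n} {ξ : Fin n → ℝ} {N : Set (Fin n → ℝ)} {R : ℝ} {H : FormalOp n} {G : PS n}

theorem world_eventuallyEq (h : Normalized F ξ N R H G) {x : Fin n → ℝ} (hx : x ∈ N) :
    F.world ξ N =ᶠ[𝓝 x] fn ξ G := by
  filter_upwards [h.isOpen.mem_nhds hx] with y hy using h.world_eq y hy

theorem analytic_world (h : Normalized F ξ N R H G) : AnalyticOnNhd ℝ (F.world ξ N) N :=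
  fun x hx => (h.conv.analyticOnNhd ξ x (h.subset hx)).congr (h.world_eventuallyEq hx).symm

theorem eikonal_world (h : Normalized F ξ N R H G) : ∀ x ∈ N,
    ∑ i, ∑ j, F.a x i j * pd i (F.world ξ N) x * pd j (F.world ξ N) x = 4 * F.world ξ N x :=
  fun x hx => by
    have := h.eikonal x hx
    rw [h.world_eq x hx, ← this]
    simp only [pd_congr (h.world_eventuallyEq hx)]

theorem D_eq (h : Normalized F ξ N R H G) {x : Fin n → ℝ} (hx : x ∈ N) :
    F.D ξ N x = F.dens (fn ξ G) x := LinOp.dens_congr (h.world_eventuallyEq hx)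

/-- The transport equations along geodesics as partial differential equations. -/
theorem transport_iff (h : Normalized F ξ N R H G) {u f : (Fin n → ℝ) → ℝ}
    (hu : AnalyticOnNhd ℝ u N) (k : ℝ) :
    F.Transport ξ N k u f ↔ ∀ x ∈ N, F.transp (fn ξ G) k u x = f x := by
  constructor
  · intro ht x hx
    -- Every point of N is the endpoint s = 1 of a geodesic, so the equation at s = 1 alone gives
    -- the partial differential equation.
    obtain ⟨γ, p, hg, rfl⟩ := h.exists_geodesic x hx
    have h1 : (1 : ℝ) ∈ Icc (0 : ℝ) 1 := ⟨zero_le_one, le_rfl⟩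
    have h2 := ht γ p hg 1 h1
    rwa [h.deriv_geodesic γ p hg 1 h1 u (hu _ hx).differentiableAt, h.D_eq hx] at h2
  · intro ht γ p hg s hs
    have hx := hg.mem s hs
    rw [h.deriv_geodesic γ p hg s hs u (hu _ hx).differentiableAt, h.D_eq hx]
    exact ht _ hx

theorem analytic_fn (h : Normalized F ξ N R H G) {u : PS n} (hu : Conv R u) :
    AnalyticOnNhd ℝ (fn ξ u) N := fun x hx => hu.analyticOnNhd ξ x (h.subset hx)

theorem transport_fn (h : Normalized F ξ N R H G) {u f : PS n} (hu : Conv R u) {k : ℝ}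
    (ht : H.T G k u = f) {f' : (Fin n → ℝ) → ℝ} (hf : ∀ x ∈ N, f' x = fn ξ f x) :
    F.Transport ξ N k (fn ξ u) f' :=
  (h.transport_iff (h.analytic_fn hu) k).2 fun x hx => by
    rw [h.transp_fn h.conv hu k (h.subset hx), ht, hf x hx]

/-- Real-analytic solutions of a transport equation are determined by it, and by their value at the
pole if the indicial exponent vanishes. -/
theorem transport_unique (h : Normalized F ξ N R H G) {κ : ℝ} {d : ℕ} (hd : d ≤ 1) (h1 : 0 < d + κ)
    {u u' f : (Fin n → ℝ) → ℝ} (hu : AnalyticOnNhd ℝ u N) (hu' : AnalyticOnNhd ℝ u' N)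
    (hξ : d = 1 → u ξ = u' ξ) (ht : F.Transport ξ N (κ - n / 2) u f)
    (ht' : F.Transport ξ N (κ - n / 2) u' f) : EqOn u u' N := by
  rw [h.transport_iff hu] at ht
  rw [h.transport_iff hu'] at ht'
  refine hu.eqOn_of_preconnected_of_eventuallyEq hu' h.preconn h.mem ?_
  obtain ⟨c, hc⟩ := Rep.of_analyticAt (hu ξ h.mem)
  obtain ⟨c', hc'⟩ := Rep.of_analyticAt (hu' ξ h.mem)
  have hrep : ∀ {u : (Fin n → ℝ) → ℝ} {c : PS n}, Rep ξ u c →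
      Rep ξ (F.transp (fn ξ G) (κ - n / 2) u) (H.T G (κ - n / 2) c) := by
    intro u c hc
    have hev := hc.eventuallyEq
    obtain ⟨ρ, hρ, hcρ, -⟩ := hc
    refine (Rep.of_conv (lt_min hρ h.pos) ((h.mono (min_le_right ρ R)).conv_T
      (h.conv.mono (min_le_right ρ R)) (hcρ.mono (min_le_left ρ R)) _)).congr ?_
    filter_upwards [hev.eventuallyEq_nhds, ball_mem_nhds ξ (lt_min hρ h.pos)] with x h1 h2
    rw [LinOp.transp_congr _ h1, (h.mono (min_le_right ρ R)).transp_fn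
      (h.conv.mono (min_le_right ρ R)) (hcρ.mono (min_le_left ρ R)) _ h2]
  have e1 : c - c' = 0 := by
    refine h.normal.transport_unique h1 ?_ ?_
    · interval_cases d
      · exact OrdGE.zero_left _
      · rw [OrdGE.one_iff, map_sub, sub_eq_zero, ← fn_self ξ c, ← fn_self ξ c',
          ← hc.eventuallyEq.eq_of_nhds, ← hc'.eventuallyEq.eq_of_nhds, hξ rfl]
    · rw [FormalOp.T_sub]
      refine ((hrep hc).sub (hrep hc')).zero_iff.2 ?_
      filter_upwards [h.isOpen.mem_nhds h.mem] with x hx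
      rw [ht x hx, ht' x hx, sub_self]
  rw [sub_eq_zero] at e1
  filter_upwards [hc.eventuallyEq, hc'.eventuallyEq] with x h1 h2
  rw [h1, h2, e1]

/-- The action of the operator on `U Γ ^ (-m) + V log Γ + W`. -/
theorem world_mul_app_split (h : Normalized F ξ N R H G) {U V W : (Fin n → ℝ) → ℝ} {x : Fin n → ℝ}
    (hx : x ∈ N) (h0 : fn ξ G x ≠ 0) (hU : AnalyticAt ℝ U x) (hV : AnalyticAt ℝ V x)
    (hW : AnalyticAt ℝ W x) :
    (fn ξ G x : ℂ) * F.app (F.split ξ N U V W) x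
      = ((fn ξ G x * F.app U x - 4 * expo n * F.transp (fn ξ G) (-expo n - 1) U x : ℝ) : ℂ)
          * (fn ξ G x : ℂ) ^ (-(expo n : ℂ))
        + ((fn ξ G x * F.app V x : ℝ) : ℂ) * Complex.log (fn ξ G x : ℂ)
        + ((fn ξ G x * F.app W x + 4 * F.transp (fn ξ G) (-1) V x : ℝ) : ℂ) := by
  have hev := h.world_eventuallyEq hx
  have hw := h.world_eq x hx
  have h0' : F.world ξ N x ≠ 0 := by rwa [hw]
  rw [LinOp.split_eq_comb, (powLog (h.analytic_world x hx) h0' (-expo n)).app_comb (h.a_symm x hx)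
    (h.eikonal_world x hx) hU hV hW, LinOp.transp_congr' _ _ hev, LinOp.transp_congr' _ _ hev, hw]
  have h0c : (fn ξ G x : ℂ) ≠ 0 := by exact_mod_cast h0
  simp only [Complex.real_smul]
  push_cast
  field_simp
  ring

end Normalized

/-! ### Existence of the fundamental solutions -/

theorem Growth.mono {ρ ρ' : ℝ} {u : ℕ → PS n} (h : Growth ρ u) (hρ : ρ' ≤ ρ) : Growth ρ' u := by
  obtain ⟨M, Q, hQ, hM⟩ := h
  exact ⟨M, Q, hQ, fun l r hr hrρ => hM l r hr (by linarith)⟩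

theorem OrdGE.pow_mul {G : PS n} (hG : OrdGE 2 G) (u : PS n) (l : ℕ) : OrdGE l (G ^ l * u) :=
  ((hG.pow l).mul (OrdGE.zero_left _)).mono (by omega)

/-- The terms of positive degree in `G` of a power series in `G`. -/
theorem fsum_pow_succ {G : PS n} (hG : OrdGE 2 G) (v : ℕ → PS n) :
    fsum (fun l => G ^ l * v l) = v 0 + G * fsum fun l => G ^ l * v (l + 1) := by
  rw [← sub_eq_zero]
  refine OrdGE.eq_zero fun L => ?_
  have h1 := fsum_sub_range (u := fun l => G ^ l * v l) (fun l => hG.pow_mul _ l) (L + 1)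
  have h2 := fsum_sub_range (u := fun l => G ^ l * v (l + 1)) (fun l => hG.pow_mul _ l) L
  have h3 := (h1.mono (Nat.le_succ L)).sub (h2.mul_left G)
  rw [Finset.sum_range_succ'] at h3
  convert h3 using 1
  rw [mul_sub, Finset.mul_sum]
  have : ∀ l, G * (G ^ l * v (l + 1)) = G ^ (l + 1) * v (l + 1) := fun l => by ring
  simp only [this]
  ring

namespace FormalOp

variable {F : FormalOp n} {G : PS n}

/-- A zero world function would have zero gradient field, while the field starts with the
coordinates. Formal series form a domain, so powers of G may then be cancelled. -/
theorem Normal.ne_zero {R : ℝ} (h : F.Normal G R) (hn : 0 < n) : G ≠ 0 := by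
  rintro rfl
  have h1 := h.field_order ⟨0, hn⟩ (Finsupp.single ⟨0, hn⟩ 1) (by simp)
  simp [field] at h1

end FormalOp

theorem expo_ne_of_odd (hn : Odd n) (l : ℕ) : (((l + 1 : ℕ) : ℝ) - expo n) ≠ 0 := by
  obtain ⟨k, rfl⟩ := hn
  rw [expo]
  intro h
  have h1 : ((2 * (l + 1) + 1 : ℕ) : ℝ) = ((2 * k : ℕ) : ℝ) := by
    push_cast at h ⊢; linarith
  have h2 : 2 * (l + 1) + 1 = 2 * k := by exact_mod_cast h1
  omega

theorem expo_of_even (hn : Even n) (h4 : 4 ≤ n) : expo n = ((n / 2 - 1 : ℕ) : ℝ) := by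
  obtain ⟨k, rfl⟩ := hn
  have : (k + k) / 2 = k := by omega
  rw [this, Nat.cast_sub (by omega), expo]
  push_cast; ring

namespace Normalized

variable {F : LinOp n} {ξ : Fin n → ℝ} {N : Set (Fin n → ℝ)} {R : ℝ} {H : FormalOp n} {G : PS n}

/-- Convergence of the series in powers of the world function. -/
theorem exists_series (h : Normalized F ξ N R H G) {u : ℕ → PS n} (hg : Growth R u)
    (hu : ∀ l, Conv R (u l)) : ∃ r₀ > 0, r₀ ≤ R ∧ ∀ r, 0 < r → r ≤ r₀ →
      Conv r (fsum fun l => G ^ l * u l) ∧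
      F.SeriesOn ξ N (N ∩ ball ξ r) (fun l => fn ξ (u l)) (fn ξ (fsum fun l => G ^ l * u l)) := by
  obtain ⟨M, Q, hQ, hM⟩ := hg
  obtain ⟨r₀, hr₀, hr₀R, hmaj⟩ := exists_series_radius h.pos h.conv h.normal.order hQ
    hM
  refine ⟨r₀, hr₀, by linarith, fun r hr hrr => ?_⟩
  have ho : ∀ l, OrdGE l (G ^ l * u l) := fun l => h.normal.order.pow_mul _ l
  have hs := summable_const_mul_half M
  have hterm : ∀ l, ∀ x ∈ N, fn ξ (u l) x * F.world ξ N x ^ l = fn ξ (G ^ l * u l) x := by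
    intro l x hx
    have hx' := h.subset hx
    rw [(h.conv.pow l).fn_mul (hu l) hx', h.conv.fn_pow l hx', h.world_eq x hx, mul_comm]
  refine ⟨Conv.of_maj (Maj.fsum hr.le (hmaj r hr hrr) hs), fun x hx => ?_, ?_⟩
  · refine Summable.of_nonneg_of_le (fun _ => abs_nonneg _) (fun l => ?_) hs
    rw [hterm l x hx.1]
    exact (hmaj r hr hrr l).abs_ev_le (mem_ball_iff_norm.1 hx.2).le
  · refine ((tendstoUniformlyOn_fn_fsum ho (hmaj r hr hrr) hs ξ).mono inter_subset_right).congr ?_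
    exact Eventually.of_forall fun L x hx => Finset.sum_congr rfl fun l _ => (hterm l x hx.1).symm

theorem transport_succ (h : Normalized F ξ N R H G) {u u' : PS n} (hu : Conv R u)
    (hu' : Conv R u') {k c : ℝ} (ht : H.T G k u' = -c • H.app u) :
    F.Transport ξ N k (fn ξ u') (fun x => -c * F.app (fn ξ u) x) :=
  h.transport_fn hu' ht fun x hx => by rw [fn_smul, h.app_fn hu (h.subset hx)]

theorem eqU (h : Normalized F ξ N R H G) {u : ℕ → PS n} (hu : ∀ l, Conv R (u l))
    (h0 : H.T G (-expo n - 1) (u 0) = 0)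
    (hs : ∀ l : ℕ, H.T G (((l + 1 : ℕ) : ℝ) - expo n - 1) (u (l + 1))
        = -(1 / (4 * (((l + 1 : ℕ) : ℝ) - expo n))) • H.app (u l)) :
    ∀ l, F.EqU ξ N (fun l => fn ξ (u l)) l
  | 0 => h.transport_fn (hu 0) h0 fun _ _ => (fn_zero _ _).symm
  | l + 1 => h.transport_succ (hu l) (hu (l + 1)) (hs l)

/-- The indicial constant is l: zero for U₀, whose value at the pole is therefore needed, and
positive afterwards. The bound L serves both the infinite recursion and the one stopped before the
resonance. -/
theorem eqU_unique (h : Normalized F ξ N R H G) {U U' : ℕ → (Fin n → ℝ) → ℝ} {L : ℕ}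
    (hU : ∀ l < L, AnalyticOnNhd ℝ (U l) N) (hU' : ∀ l < L, AnalyticOnNhd ℝ (U' l) N)
    (h0 : U' 0 ξ = U 0 ξ) (ht : ∀ l < L, F.EqU ξ N U l) (ht' : ∀ l < L, F.EqU ξ N U' l) :
    ∀ l < L, EqOn (U' l) (U l) N := by
  intro l
  induction l with
  | zero =>
    intro hl
    have e : -expo n - 1 = 0 - (n : ℝ) / 2 := by rw [expo]; ring
    have h1 := ht 0 hl
    have h2 := ht' 0 hl
    simp only [LinOp.EqU, e] at h1 h2
    exact h.transport_unique (d := 1) le_rfl (by norm_num) (hU' 0 hl) (hU 0 hl) (fun _ => h0) h2 h1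
  | succ l ih =>
    intro hl
    have hl' : l < L := by omega
    have e : ((l + 1 : ℕ) : ℝ) - expo n - 1 = ((l + 1 : ℕ) : ℝ) - (n : ℝ) / 2 := by rw [expo]; ring
    have h1 := ht (l + 1) hl
    have h2 := ht' (l + 1) hl
    simp only [LinOp.EqU, e] at h1 h2
    refine h.transport_unique (d := 0) zero_le_one (by push_cast; positivity) (hU' _ hl) (hU _ hl)
      (by simp) h2 fun γ p hg s hs => (h1 γ p hg s hs).trans ?_
    simp only
    rw [LinOp.app_congr ((ih hl').symm.eventuallyEq_of_mem (h.isOpen.mem_nhds (hg.mem s hs)))]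

theorem eqV (h : Normalized F ξ N R H G) {u : PS n} {v : ℕ → PS n} (hu : Conv R u)
    (hv : ∀ l, Conv R (v l)) (h0 : H.T G (-1) (v 0) = -(1 / 4 : ℝ) • H.app u)
    (hs : ∀ l : ℕ, H.T G (((l + 1 : ℕ) : ℝ) - 1) (v (l + 1))
        = -(1 / (4 * ((l + 1 : ℕ) : ℝ))) • H.app (v l)) :
    ∀ l, F.EqV ξ N (fn ξ u) (fun l => fn ξ (v l)) l
  | 0 => h.transport_succ hu (hv 0) h0
  | l + 1 => h.transport_succ (hv l) (hv (l + 1)) (hs l)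

/-- The indicial constants are m + l > 0, so no value at the pole has to be prescribed. -/
theorem eqV_unique (h : Normalized F ξ N R H G) (hn : 2 < n) {u : (Fin n → ℝ) → ℝ}
    {V V' : ℕ → (Fin n → ℝ) → ℝ} (hV : ∀ l, AnalyticOnNhd ℝ (V l) N)
    (hV' : ∀ l, AnalyticOnNhd ℝ (V' l) N) (ht : ∀ l, F.EqV ξ N u V l)
    (ht' : ∀ l, F.EqV ξ N u V' l) : ∀ l, EqOn (V' l) (V l) N := by
  have hm : 0 < expo n := by
    have : (2 : ℝ) < n := by exact_mod_cast hn
    rw [expo]; linarith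
  intro l
  induction l with
  | zero =>
    have e : (-1 : ℝ) = expo n - (n : ℝ) / 2 := by rw [expo]; ring
    have h1 := ht 0
    have h2 := ht' 0
    simp only [LinOp.EqV] at h1 h2
    rw [e] at h1 h2
    exact h.transport_unique (d := 0) zero_le_one (by simpa using hm) (hV' 0) (hV 0) (by simp) h2 h1
  | succ l ih =>
    have e : ((l + 1 : ℕ) : ℝ) - 1 = (((l + 1 : ℕ) : ℝ) + expo n) - (n : ℝ) / 2 := by
      rw [expo]; ring
    have h1 := ht (l + 1)
    have h2 := ht' (l + 1)
    simp only [LinOp.EqV, e] at h1 h2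
    refine h.transport_unique (d := 0) zero_le_one (by push_cast; positivity) (hV' _) (hV _)
      (by simp) h2 fun γ p hg s hs => (h1 γ p hg s hs).trans ?_
    simp only
    rw [LinOp.app_congr (ih.symm.eventuallyEq_of_mem (h.isOpen.mem_nhds (hg.mem s hs)))]

/-- A formal criterion for `S Γ ^ (-m) + V log Γ + W` to be a fundamental solution. -/
theorem isFundSol (h : Normalized F ξ N R H G) {r : ℝ} (hr : 0 < r) (hrR : r ≤ R) {S V W : PS n}
    (hS : Conv r S) (hV : Conv r V) (hW : Conv r W) {U : (Fin n → ℝ) → ℝ}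
    (hU : ∀ x ∈ N ∩ ball ξ r, U x = fn ξ S x) (h0 : constantCoeff S ≠ 0) (hVz : H.app V = 0)
    {q : PS n} (hq : Conv r q) {m : ℕ} (hm : q = 0 ∨ expo n = m)
    (e1 : G * H.app S - C (4 * expo n) * H.T G (-expo n - 1) S = G ^ m * q)
    (e2 : q + 4 * H.T G (-1) V + G * H.app W = 0) :
    F.IsFundSol ξ N (N ∩ ball ξ r) U (fn ξ V) (fn ξ W) := by
  have hMr : Models F ξ r H := h.toModels.mono hrR
  have hGr : Conv r G := h.conv.mono hrR
  have hopen : IsOpen (N ∩ ball ξ r) := h.isOpen.inter isOpen_ball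
  have hUe : ∀ x ∈ N ∩ ball ξ r, U =ᶠ[𝓝 x] fn ξ S := fun x hx => by
    filter_upwards [hopen.mem_nhds hx] with y hy using hU y hy
  refine ⟨hopen, ⟨h.mem, mem_ball_self hr⟩, inter_subset_left, fun x hx =>
    (hS.analyticOnNhd ξ x hx.2).congr (hUe x hx).symm, fun x hx => hV.analyticOnNhd ξ x hx.2,
    fun x hx => hW.analyticOnNhd ξ x hx.2, ?_, fun x hx hx0 => ?_⟩
  · rwa [hU ξ ⟨h.mem, mem_ball_self hr⟩, fn_self]
  rw [h.world_eq x hx.1] at hx0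
  have hx0c : (fn ξ G x : ℂ) ≠ 0 := by exact_mod_cast hx0
  have hUa : AnalyticAt ℝ U x := (hS.analyticOnNhd ξ x hx.2).congr (hUe x hx).symm
  have key := h.world_mul_app_split hx.1 hx0 hUa (hV.analyticOnNhd ξ x hx.2)
    (hW.analyticOnNhd ξ x hx.2)
  have c1 : Conv r (H.app S) := hMr.conv_app hS
  have c2 := hMr.conv_T hGr hS (-expo n - 1)
  have c3 := hMr.conv_T hGr hV (-1)
  have c4 : Conv r (H.app W) := hMr.conv_app hW
  have f1 : fn ξ G x * fn ξ (H.app S) x - 4 * expo n * fn ξ (H.T G (-expo n - 1) S) x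
      = fn ξ G x ^ m * fn ξ q x := by
    have := congrArg (fun c => fn ξ c x) e1
    simp only [← smul_eq_C_mul] at this
    rwa [(hGr.mul c1).fn_sub (c2.smul _) hx.2, hGr.fn_mul c1 hx.2, fn_smul,
      (hGr.pow m).fn_mul hq hx.2, hGr.fn_pow m hx.2] at this
  have f2 : fn ξ q x + 4 * fn ξ (H.T G (-1) V) x + fn ξ G x * fn ξ (H.app W) x = 0 := by
    have := congrArg (fun c => fn ξ c x) e2
    rw [← map_ofNat (MvPowerSeries.C (σ := Fin n) (R := ℝ)) 4, ← smul_eq_C_mul] at this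
    change fn ξ _ x = fn ξ _ x at this
    rwa [(hq.add (c3.smul _)).fn_add (hGr.mul c4) hx.2, hq.fn_add (c3.smul _) hx.2,
      hGr.fn_mul c4 hx.2, fn_smul, fn_zero] at this
  -- When the exponent is an integer, the remainder Γ^m q of the singular part meets Γ^(-m) and
  -- becomes the regular function q, to be balanced by V and W; otherwise q = 0.
  have f3 : ((fn ξ G x ^ m * fn ξ q x : ℝ) : ℂ) * (fn ξ G x : ℂ) ^ (-(expo n : ℂ)) = fn ξ q x := by
    rcases hm with hm | hm
    · rw [hm, fn_zero]; simp
    · rw [hm, Complex.cpow_neg]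
      push_cast
      rw [Complex.cpow_natCast]
      field_simp
  rw [LinOp.app_congr (hUe x hx), LinOp.transp_congr _ (hUe x hx), hMr.app_fn hS hx.2,
    hMr.app_fn hV hx.2, hMr.app_fn hW hx.2, hMr.transp_fn hGr hS _ hx.2,
    hMr.transp_fn hGr hV _ hx.2, f1, f3, hVz, fn_zero] at key
  have f4 : (fn ξ G x : ℂ) * F.app (F.split ξ N U (fn ξ V) (fn ξ W)) x = 0 := by
    rw [key, mul_zero, Complex.ofReal_zero, zero_mul, add_zero, ← Complex.ofReal_add,
      ← Complex.ofReal_zero]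
    congr 1
    linarith
  exact (mul_eq_zero.1 f4).resolve_left hx0c

/-- Hadamard's theorem for an odd number of variables. -/
theorem odd_part (h : Normalized F ξ N R H G) (hR : R ≤ 1 / 2) {A : ℝ} (hB : H.Bdd (2 * R) A)
    (hN : H.Normal G (2 * R)) (hn : Odd n) {P : ℝ} (hP : P ≠ 0) :
    ∃ U : ℕ → (Fin n → ℝ) → ℝ,
      (∀ l, AnalyticOnNhd ℝ (U l) N) ∧ U 0 ξ = P ∧ (∀ l, F.EqU ξ N U l) ∧
      (∀ U' : ℕ → (Fin n → ℝ) → ℝ, (∀ l, AnalyticOnNhd ℝ (U' l) N) → U' 0 ξ = P →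
        (∀ l, F.EqU ξ N U' l) → ∀ l, EqOn (U' l) (U l) N) ∧
      ∃ (N₀ : Set (Fin n → ℝ)) (S : (Fin n → ℝ) → ℝ),
        F.SeriesOn ξ N N₀ U S ∧
        F.IsFundSol ξ N N₀ S (fun _ => 0) (fun _ => 0) ∧
        ∀ x ∈ N₀, F.world ξ N x ≠ 0 →
          HasSum (fun l : ℕ => (U l x : ℂ) * (F.world ξ N x : ℂ) ^ ((l : ℂ) - (expo n : ℂ)))
            (F.split ξ N S (fun _ => 0) (fun _ => 0) x) := by
  have hR0 := h.pos
  obtain ⟨u, hu0, ht0, hts, huc, hug⟩ := hN.exists_U (by linarith) (by linarith) hB P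
  have huR : ∀ l, Conv R (u l) := fun l => (huc l).mono (by linarith)
  have hEq := h.eqU huR ht0 hts
  have h0 : fn ξ (u 0) ξ = P := by rw [fn_self, hu0]
  obtain ⟨r, hr, hrR, hser⟩ := h.exists_series (hug.mono (by linarith)) huR
  obtain ⟨hSc, hS⟩ := hser r hr le_rfl
  set S := fsum fun l => G ^ l * u l with hSdef
  have hz : (fun _ : Fin n → ℝ => (0 : ℝ)) = fn ξ 0 := by ext x; exact (fn_zero ξ x).symm
  refine ⟨fun l => fn ξ (u l), fun l => h.analytic_fn (huR l), h0, hEq,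
    fun U' hU' hU'0 hU'E l => h.eqU_unique (L := l + 1) (fun l _ => h.analytic_fn (huR l))
      (fun l _ => hU' l) (hU'0.trans h0.symm) (fun l _ => hEq l) (fun l _ => hU'E l) l
      (Nat.lt_succ_self l), N ∩ ball ξ r, fn ξ S, hS, ?_, fun x hx hx0 => ?_⟩
  · rw [hz]
    refine h.isFundSol hr hrR hSc Conv.zero Conv.zero (fun _ _ => rfl) ?_ FormalOp.app_zero
      (q := 0) Conv.zero (m := 0) (Or.inl rfl) ?_ ?_
    · have e : constantCoeff S = P := by
        rw [hSdef, fsum_pow_succ h.normal.order, map_add, map_mul,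
          OrdGE.one_iff.1 (h.normal.order.mono (by norm_num)), zero_mul, add_zero, hu0]
      rwa [e]
    · rw [mul_zero]
      refine FormalOp.frobenius_sum h.normal (expo n) (Or.inr ht0) fun l => ?_
      rw [hts l, neg_smul, mul_neg]
      congr 1
      exact C_mul_C_inv (mul_ne_zero four_ne_zero (expo_ne_of_odd hn l)) _
    · simp [FormalOp.T, FormalOp.L, FormalOp.app_zero]
  · have h1 : HasSum (fun l => fn ξ (u l) x * F.world ξ N x ^ l) (fn ξ S x) := by
      have h2 := (hS.1 x hx).of_abs.hasSum
      rwa [tendsto_nhds_unique h2.tendsto_sum_nat (hS.2.tendsto_at hx)] at h2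
    have h3 : HasSum (fun l => ((fn ξ (u l) x * F.world ξ N x ^ l : ℝ) : ℂ)) (fn ξ S x : ℂ) :=
      Complex.hasSum_ofReal.2 h1
    have h4 := h3.mul_right ((F.world ξ N x : ℂ) ^ (-(expo n : ℂ)))
    have hx0c : (F.world ξ N x : ℂ) ≠ 0 := by exact_mod_cast hx0
    have e1 : ∀ l : ℕ, ((fn ξ (u l) x * F.world ξ N x ^ l : ℝ) : ℂ)
        * (F.world ξ N x : ℂ) ^ (-(expo n : ℂ)) = (fn ξ (u l) x : ℂ)
          * (F.world ξ N x : ℂ) ^ ((l : ℂ) - (expo n : ℂ)) := fun l => by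
      rw [sub_eq_add_neg, Complex.cpow_add _ _ hx0c, Complex.cpow_natCast]
      push_cast; ring
    have e2 : F.split ξ N (fn ξ S) (fun _ => 0) (fun _ => 0) x
        = (fn ξ S x : ℂ) * (F.world ξ N x : ℂ) ^ (-(expo n : ℂ)) := by simp [LinOp.split]
    simp only [e1] at h4
    rwa [e2]

/-- The formal data of Hadamard's theorem for an even number of variables. -/
theorem even_core (h : Normalized F ξ N R H G) (hR : R ≤ 1 / 2) {A : ℝ} (hB : H.Bdd (2 * R) A)
    (hN : H.Normal G (2 * R)) (hn : Even n) (h4 : 4 ≤ n) (P : ℝ) :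
    ∃ u v w : ℕ → PS n, constantCoeff (u 0) = P ∧ H.T G (-expo n - 1) (u 0) = 0 ∧
      (∀ l : ℕ, H.T G (((l + 1 : ℕ) : ℝ) - expo n - 1) (u (l + 1))
        = -(1 / (4 * (((l + 1 : ℕ) : ℝ) - expo n))) • H.app (u l)) ∧
      H.T G (-1) (v 0) = -(1 / 4 : ℝ) • H.app (u (n / 2 - 2)) ∧
      (∀ l : ℕ, H.T G (((l + 1 : ℕ) : ℝ) - 1) (v (l + 1))
        = -(1 / (4 * ((l + 1 : ℕ) : ℝ))) • H.app (v l)) ∧ w 0 = 0 ∧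
      (∀ l, Conv R (u l)) ∧ (∀ l, Conv R (v l)) ∧ (∀ l, Conv R (w l)) ∧
      Growth R v ∧ Growth R w ∧
      G * H.app (∑ l ∈ Finset.range (n / 2 - 1), G ^ l * u l) - C (4 * expo n) *
        H.T G (-expo n - 1) (∑ l ∈ Finset.range (n / 2 - 1), G ^ l * u l)
        = G ^ (n / 2 - 1) * H.app (u (n / 2 - 2)) ∧
      H.app (fsum fun l => G ^ l * v l) = 0 ∧
      H.app (u (n / 2 - 2)) + 4 * H.T G (-1) (fsum fun l => G ^ l * v l)
        + G * H.app (fsum fun l => G ^ l * w l) = 0 := by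
  have hR0 := h.pos
  -- This sequence continues past the resonance l = m, where the coefficient 1/(4(l - m)) takes the
  -- default value 0. Only the terms with l < m enter the sum.
  obtain ⟨u, hu0, ht0, hts, huc, -⟩ := hN.exists_U (by linarith) (by linarith) hB P
  -- The last index is n/2 - 2 = m - 1. Working on the doubled radius gives F[U_(m-1)] a finite norm
  -- on the closed polydisc of radius R, as the recursion for V requires.
  obtain ⟨N₀, hN₀⟩ := hB.conv_app (huc (n / 2 - 2)) R hR0.le (by linarith)
  obtain ⟨v, w, hv0, hvs, hw0, hws, hvc, hwc, hvg, hwg⟩ := h.normal.exists_V_W hR0 (by linarith)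
    (hB.mono hR0.le (by linarith)) h4 hN₀
  have hm := expo_of_even hn h4
  refine ⟨u, v, w, hu0, ht0, hts, hv0, hvs, hw0, fun l => (huc l).mono (by linarith), hvc, hwc, hvg,
    hwg, ?_, ?_, ?_⟩
  · have e1 := FormalOp.frobenius_partial h.normal.toEikonal (expo n) (Or.inr ht0) (n / 2 - 2)
      fun l hl => by
        rw [hts l, neg_smul, mul_neg]
        congr 1
        refine C_mul_C_inv (mul_ne_zero four_ne_zero (sub_ne_zero.2 ?_)) _
        rw [hm]
        have : l + 1 ≠ n / 2 - 1 := by omega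
        exact_mod_cast this
    rwa [show n / 2 - 2 + 1 = n / 2 - 1 by omega] at e1
  -- The V_l obey the recursion of exponent μ = 0, so the sum satisfies Γ F[V] = 0, and G cancels
  -- because formal series form a domain.
  · have e1 := FormalOp.frobenius_sum h.normal 0 (Or.inl rfl) (u := v) fun l => by
      have hl : (4 : ℝ) * (((l + 1 : ℕ) : ℝ)) ≠ 0 := by positivity
      rw [sub_zero, hvs l, neg_smul, mul_neg]
      congr 1
      exact C_mul_C_inv hl _
    rw [mul_zero, map_zero, zero_mul, sub_zero] at e1
    exact (mul_eq_zero.1 e1).resolve_left (h.normal.ne_zero (by omega))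
  · refine FormalOp.log_sum h.normal hw0 ?_ hws
    rw [hv0, neg_smul, mul_neg, FormalOp.four_smul_quarter]

end Normalized

/-! ### Divisibility by Γ and formal uniqueness -/

namespace FormalOp

variable {F : FormalOp n} {G : PS n}

/-- The extra factor G keeps G^(j-1) from appearing, so the case j = 0 needs no separate treatment
in the descents below. -/
theorem world_mul_app_pow_mul (h : F.Eikonal G) (j : ℕ) (u : PS n) :
    G * F.app (G ^ j * u) = G ^ j * (G * F.app u + C (4 * j : ℝ) * F.T G (j - 1) u) := by
  rcases j with _ | j
  · simp
  · have e1 := F.app_world_pow_mul h j u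
    have e2 : (C (4 * ((j + 1 : ℕ) : ℝ)) : PS n) = 4 * ((j : PS n) + 1) := by
      rw [map_mul, map_ofNat, Nat.cast_succ, map_add, map_one, map_natCast]
    have e3 : (((j + 1 : ℕ) : ℝ) - 1) = j := by push_cast; ring
    rw [e1, e2, e3, T, map_natCast]
    ring

/-- A formal solution divisible by the world function vanishes. -/
theorem Normal.eq_zero_of_dvd {R : ℝ} (h : F.Normal G R) (hn : 0 < n) {d : PS n}
    (hd : F.app d = 0) (hG : G ∣ d) : d = 0 := by
  have hn' : (1 : ℝ) ≤ n := by exact_mod_cast hn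
  -- If d = G^(j+1) u, cancelling that power in G F[d] = 0 shows that T_j u is divisible by G; hence
  -- so is u. Divisibility by all powers gives infinite order.
  have key : ∀ j : ℕ, G ^ (j + 1) ∣ d := by
    intro j
    induction j with
    | zero => simpa using hG
    | succ j ih =>
      obtain ⟨u, hu⟩ := ih
      have e1 := F.world_mul_app_pow_mul h.toEikonal (j + 1) u
      rw [← hu, hd, mul_zero, eq_comm, mul_eq_zero,
        or_iff_right (pow_ne_zero _ (h.ne_zero hn))] at e1
      have hj : (4 * ((j + 1 : ℕ) : ℝ)) ≠ 0 := by positivity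
      have e2 : F.T G (((j : ℝ) + n / 2) - n / 2) u
          = G * (-(1 / (4 * ((j + 1 : ℕ) : ℝ))) • F.app u) := by
        rw [add_sub_cancel_right]
        have e3 := C_mul_C_inv hj (F.app u)
        have e4 : (C (4 * ((j + 1 : ℕ) : ℝ)) : PS n) ≠ 0 := by
          rw [Ne, map_eq_zero_iff _ (MvPowerSeries.C_injective)]; exact hj
        refine mul_left_cancel₀ e4 ?_
        rw [show (((j + 1 : ℕ) : ℝ) - 1) = j by push_cast; ring] at e1
        rw [neg_smul]
        linear_combination e1 + G * e3
      obtain ⟨u', hu'⟩ := h.dvd_of_transport (d := 0) (by positivity) (by norm_num)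
        (by push_cast; positivity) (OrdGE.zero_left u) e2
      exact ⟨u', by rw [hu, hu']; ring⟩
  refine OrdGE.eq_zero fun k => ?_
  obtain ⟨u, hu⟩ := key k
  rw [hu]
  exact ((h.order.pow_mul u (k + 1))).mono (Nat.le_succ k)

/-- The logarithmic term of a formal fundamental solution with `U(ξ) = 0` vanishes. -/
theorem Normal.log_eq_zero {R : ℝ} (h : F.Normal G R) {m : ℕ} (hm : 1 ≤ m) (hmn : expo n = m)
    {u v w : PS n} (hu : constantCoeff u = 0) (hv : F.app v = 0)
    (he : G * F.app u - C (4 * expo n) * F.T G (-expo n - 1) u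
      + G ^ m * (G * F.app w + 4 * F.T G (-1) v) = 0) : v = 0 := by
  have hn : (n : ℝ) / 2 = m + 1 := by rw [expo_add_one, hmn]
  have hn0 : 0 < n := by
    rcases Nat.eq_zero_or_pos n with h0 | h0
    · subst h0
      have : (0 : ℝ) ≤ m := m.cast_nonneg
      norm_num at hn; linarith
    · exact h0
  have hG := h.ne_zero hn0
  -- After extracting G^j from u, the transport operator of u' has indicial constant j and
  -- coefficient 4 (j - m), nonzero for j < m. The terms with v and w still carry G^(m-j), so u' is
  -- again divisible by G.
  have hstep : ∀ (j : ℕ) (u' : PS n), u = G ^ j * u' → j ≤ m →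
      G * F.app u' + C (4 * (j - m) : ℝ) * F.T G (j - n / 2) u'
        + G ^ (m - j) * (G * F.app w + 4 * F.T G (-1) v) = 0 := by
    intro j u' hu' hj
    have e1 := F.world_mul_app_pow_mul h.toEikonal j u'
    have e2 := F.T_world_pow_mul h.toEikonal (-expo n - 1) j u'
    have e3 : G ^ m = G ^ j * G ^ (m - j) := by rw [← pow_add, Nat.add_sub_cancel' hj]
    rw [hu', e1, e2, e3] at he
    have e4 : C (4 * j : ℝ) * F.T G (j - 1) u'
        - C (4 * expo n) * F.T G (-expo n - 1 + 2 * j) u'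
        = C (4 * (j - m) : ℝ) * F.T G (j - n / 2) u' := by
      rw [hmn, hn]
      simp only [T, map_mul, map_sub, map_add, map_neg, map_one, map_natCast, map_ofNat]
      ring
    refine (mul_eq_zero.1 (?_ : G ^ j * _ = 0)).resolve_left (pow_ne_zero j hG)
    rw [← e4]
    linear_combination he
  have key : ∀ j ≤ m, ∃ u', u = G ^ j * u' := by
    intro j
    induction j with
    | zero => exact fun _ => ⟨u, by simp⟩
    | succ j ih =>
      intro hj
      obtain ⟨u', hu'⟩ := ih (by omega)
      have e1 := hstep j u' hu' (by omega)
      have hjm : (j : ℝ) + 1 ≤ m := by exact_mod_cast hj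
      have hc : (4 * ((j : ℝ) - m)) ≠ 0 := by
        refine mul_ne_zero four_ne_zero (sub_ne_zero.2 ?_)
        linarith
      have e2 : F.T G (j - n / 2) u' = G * (-(1 / (4 * ((j : ℝ) - m))) •
          (F.app u' + G ^ (m - j - 1) * (G * F.app w + 4 * F.T G (-1) v))) := by
        have e3 := C_mul_C_inv hc
          (F.app u' + G ^ (m - j - 1) * (G * F.app w + 4 * F.T G (-1) v))
        have e4 : (C (4 * ((j : ℝ) - m)) : PS n) ≠ 0 := by
          rw [Ne, map_eq_zero_iff _ (MvPowerSeries.C_injective)]; exact hc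
        have e5 : G ^ (m - j) = G * G ^ (m - j - 1) := by
          rw [← pow_succ']; congr 1; omega
        rw [e5] at e1
        refine mul_left_cancel₀ e4 ?_
        rw [neg_smul]
        linear_combination e1 + G * e3
      obtain ⟨u'', hu''⟩ : ∃ u'', u' = G * u'' := by
        rcases Nat.eq_zero_or_pos j with rfl | hj0
        -- For j = 0 the indicial constant is 0, and the step uses that u vanishes at the pole.
        · rw [pow_zero, one_mul] at hu'
          exact h.dvd_of_transport (d := 1) (by simp) (by norm_num) (by norm_num)
            (OrdGE.one_iff.2 (by rw [← hu', hu])) e2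
        · exact h.dvd_of_transport (d := 0) (by positivity) (by norm_num)
            (by push_cast; positivity) (OrdGE.zero_left _) e2
      exact ⟨u'', by rw [hu', hu'']; ring⟩
  -- At j = m the coefficient vanishes and the equation says that T_(-1) v is divisible by G. Its
  -- indicial constant is m > 0, so v is divisible by G, and F[v] = 0 then forces v = 0.
  obtain ⟨u', hu'⟩ := key m le_rfl
  have e1 := hstep m u' hu' le_rfl
  rw [sub_self, mul_zero, map_zero, zero_mul, add_zero, Nat.sub_self, pow_zero, one_mul] at e1
  have e2 : F.T G ((m : ℝ) - n / 2) v = G * (-(1 / 4 : ℝ) • (F.app u' + F.app w)) := by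
    have e3 := four_smul_quarter (F.app u' + F.app w)
    rw [hn, show (m : ℝ) - (m + 1) = -1 by ring, neg_smul]
    refine two_mul_cancel (two_mul_cancel ?_)
    linear_combination e1 + G * e3
  have hm0 : (0 : ℝ) < m := by exact_mod_cast hm
  obtain ⟨v', hv'⟩ := h.dvd_of_transport (d := 0) hm0.le (by norm_num) (by simpa using hm0)
    (OrdGE.zero_left v) e2
  exact h.eq_zero_of_dvd hn0 hv ⟨v', hv'⟩

end FormalOp

/-! ### Independence of the logarithm from analytic functions -/

/-- The logarithm is not a quotient of functions analytic at `0`. -/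
theorem no_log_relation {f b : ℝ → ℝ} (k : ℕ) (hf : AnalyticAt ℝ f 0) (hb : AnalyticAt ℝ b 0)
    (hb0 : b 0 ≠ 0) (h : ∀ᶠ s in 𝓝[>] (0 : ℝ), f s + s ^ k * b s * Real.log s = 0) : False := by
  induction k generalizing f with
  | zero =>
    have h1 : Tendsto (fun s => -(f s / b s)) (𝓝[>] 0) (𝓝 (-(f 0 / b 0))) :=
      ((hf.continuousAt.div hb.continuousAt hb0).neg.tendsto).mono_left nhdsWithin_le_nhds
    have h2 : ∀ᶠ s in 𝓝[>] (0 : ℝ), -(f s / b s) = Real.log s := by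
      filter_upwards [h, (hb.continuousAt.eventually_ne hb0).filter_mono nhdsWithin_le_nhds]
        with s h3 h4
      field_simp
      linarith
    exact not_tendsto_nhds_of_tendsto_atBot Real.tendsto_log_nhdsGT_zero _ (h1.congr' h2)
  | succ k ih =>
    -- Since s log s tends to 0, f(0) = 0 and one factor s can be divided out. At exponent zero the
    -- logarithm would have a finite limit.
    have hlog : Tendsto (fun s : ℝ => s * Real.log s) (𝓝[>] 0) (𝓝 0) := by
      have := Real.continuous_mul_log.tendsto 0
      simp only [zero_mul] at this
      exact this.mono_left nhdsWithin_le_nhds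
    have hf0 : f 0 = 0 := by
      have h1 : Tendsto f (𝓝[>] 0) (𝓝 (f 0)) :=
        hf.continuousAt.tendsto.mono_left nhdsWithin_le_nhds
      have h2 : Tendsto (fun s => -(s ^ k * b s * (s * Real.log s))) (𝓝[>] 0)
          (𝓝 (-(0 ^ k * b 0 * 0))) := by
        refine (Tendsto.mul ?_ hlog).neg
        exact (((continuous_pow k).continuousAt.mul hb.continuousAt).tendsto).mono_left
          nhdsWithin_le_nhds
      rw [mul_zero, neg_zero] at h2
      refine tendsto_nhds_unique h1 (h2.congr' ?_)
      filter_upwards [h] with s hs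
      rw [pow_succ] at hs; linarith
    have hd : AnalyticAt ℝ (dslope f 0) 0 := by
      obtain ⟨p, hp⟩ := hf
      exact ⟨_, hp.has_fpower_series_dslope_fslope⟩
    refine ih hd ?_
    filter_upwards [h, self_mem_nhdsWithin] with s hs hs0
    have hs0' : s ≠ 0 := (mem_Ioi.1 hs0).ne'
    have e1 : f s = s * dslope f 0 s := by
      have := sub_smul_dslope f 0 s
      rw [hf0] at this; simpa using this.symm
    rw [pow_succ] at hs
    refine mul_left_cancel₀ hs0' ?_
    linear_combination hs - e1

/-- Factor g = s^p g' and b = s^k b' with g', b' nonzero at 0. Then log |g| is p log s plus an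
analytic function, and p ≠ 0 because g(0) = 0, so the relation becomes one excluded by
`no_log_relation`. -/
theorem eventually_eq_zero_of_log_relation {f b g : ℝ → ℝ} (hf : AnalyticAt ℝ f 0)
    (hb : AnalyticAt ℝ b 0) (hg : AnalyticAt ℝ g 0) (hg0 : g 0 = 0)
    (hgne : ¬ ∀ᶠ s in 𝓝 (0 : ℝ), g s = 0)
    (h : ∀ᶠ s in 𝓝[>] (0 : ℝ), g s ≠ 0 → f s + b s * Real.log (g s) = 0) :
    ∀ᶠ s in 𝓝 (0 : ℝ), b s = 0 := by
  by_contra hbne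
  obtain ⟨p, g', hg', hg'0, hgg⟩ := hg.exists_eventuallyEq_pow_smul_nonzero_iff.2 hgne
  obtain ⟨k, b', hb', hb'0, hbb⟩ := hb.exists_eventuallyEq_pow_smul_nonzero_iff.2 hbne
  have hp : (p : ℝ) ≠ 0 := by
    rintro hp
    have hp' : p = 0 := by exact_mod_cast hp
    have := hgg.self_of_nhds
    rw [hp', pow_zero, one_smul, hg0] at this
    exact hg'0 this.symm
  -- An analytic form of log |g'| that does not depend on the sign of g'.
  have hl : AnalyticAt ℝ (fun s => 1 / 2 * Real.log (g' s ^ 2)) 0 :=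
    analyticAt_const.mul ((hg'.pow 2).log (by simpa using sq_pos_of_ne_zero hg'0))
  refine no_log_relation k (f := fun s => f s + b s * (1 / 2 * Real.log (g' s ^ 2)))
    (b := fun s => b' s * p) (hf.add (hb.mul hl)) (hb'.mul analyticAt_const)
    (mul_ne_zero hb'0 hp) ?_
  filter_upwards [h, self_mem_nhdsWithin, hgg.filter_mono nhdsWithin_le_nhds,
    hbb.filter_mono nhdsWithin_le_nhds,
    (hg'.continuousAt.eventually_ne hg'0).filter_mono nhdsWithin_le_nhds] with s h1 h2 h3 h4 h5
  have hs : s ≠ 0 := (mem_Ioi.1 h2).ne'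
  rw [sub_zero, smul_eq_mul] at h3 h4
  have h6 := h1 (by rw [h3]; exact mul_ne_zero (pow_ne_zero _ hs) h5)
  rw [h3, Real.log_mul (pow_ne_zero _ hs) h5, Real.log_pow] at h6
  rw [Real.log_pow]
  push_cast
  rw [← h6, h4]
  ring

/-- A logarithmic relation between convergent series, off the zeros of `G`, is trivial. -/
theorem eq_zero_of_log_relation {ξ : Fin n → ℝ} {r : ℝ} (hr : 0 < r) {f b G : PS n}
    (hf : Conv r f) (hb : Conv r b) (hG : Conv r G) (hG0 : constantCoeff G = 0) (hGne : G ≠ 0)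
    (h : ∀ x ∈ ball ξ r, fn ξ G x ≠ 0 → fn ξ f x + fn ξ b x * Real.log (fn ξ G x) = 0) :
    f = 0 ∧ b = 0 := by
  have hcurve : ∀ {c : PS n}, Conv r c → ∀ v : Fin n → ℝ,
      AnalyticOnNhd ℝ (fun s : ℝ => fn ξ c (ξ + s • v)) {s | ‖s • v‖ < r} := by
    intro c hc v s hs
    have h1 : AnalyticAt ℝ (fun s : ℝ => ξ + s • v) s :=
      analyticAt_const.add (analyticAt_id.smul analyticAt_const)
    exact (hc.analyticOnNhd ξ (ξ + s • v) (by simpa [mem_ball_iff_norm] using hs)).fun_comp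
      (f := fun s : ℝ => ξ + s • v) h1
  have hpre : ∀ v : Fin n → ℝ, IsPreconnected {s : ℝ | ‖s • v‖ < r} := fun v => by
    have : {s : ℝ | ‖s • v‖ < r} = (LinearMap.toSpanSingleton ℝ (Fin n → ℝ) v) ⁻¹' ball 0 r := by
      ext s; simp
    rw [this]
    exact ((convex_ball (0 : Fin n → ℝ) r).linear_preimage _).isPreconnected
  have hmem0 : ∀ v : Fin n → ℝ, (0 : ℝ) ∈ {s : ℝ | ‖s • v‖ < r} := fun v => by simpa using hr
  have hb' : ∀ x ∈ ball ξ r, fn ξ G x ≠ 0 → fn ξ b x = 0 := by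
    intro x hx hx0
    -- The relation is restricted to the line through ξ and x. If Γ(x) ≠ 0 then Γ is not identically
    -- zero on it near ξ, and the one-variable result followed by the identity theorem gives b(x) =
    -- 0.
    set v := x - ξ with hv
    have h1m : (1 : ℝ) ∈ {s : ℝ | ‖s • v‖ < r} := by simpa [hv] using mem_ball_iff_norm.1 hx
    have hx1 : ξ + (1 : ℝ) • v = x := by simp [hv]
    have hid : ∀ {c : PS n}, Conv r c → (∀ᶠ s in 𝓝 (0 : ℝ), fn ξ c (ξ + s • v) = 0) →
        fn ξ c x = 0 := by
      intro c hc hz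
      have := (hcurve hc v).eqOn_zero_of_preconnected_of_eventuallyEq_zero (hpre v) (hmem0 v) hz h1m
      simp only [hx1] at this
      simpa using this
    refine hid hb (eventually_eq_zero_of_log_relation (hcurve hf v 0 (hmem0 v))
      (hcurve hb v 0 (hmem0 v)) (hcurve hG v 0 (hmem0 v)) ?_ (fun hz => hx0 (hid hG hz)) ?_)
    · simp [fn_self, hG0]
    · have hev : ∀ᶠ s : ℝ in 𝓝 0, ‖s • v‖ < r :=
        ContinuousAt.eventually_lt (by fun_prop) continuousAt_const (by simpa using hr)
      filter_upwards [hev.filter_mono nhdsWithin_le_nhds] with s hs hs0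
      exact h _ (by simpa [mem_ball_iff_norm] using hs) hs0
  have hz : ∀ {c : PS n}, Conv r c → (∀ x ∈ ball ξ r, fn ξ G x ≠ 0 → fn ξ c x = 0) → c = 0 := by
    intro c hc hx
    -- The product with G vanishes also on the exceptional set Γ = 0, so it is zero as a series.
    have h1 : G * c = 0 := by
      refine (hG.mul hc).eq_zero hr (ξ := ξ) ?_
      filter_upwards [ball_mem_nhds ξ hr] with x hxb
      rw [hG.fn_mul hc hxb]
      by_cases h0 : fn ξ G x = 0
      · rw [h0, zero_mul]
      · rw [hx x hxb h0, mul_zero]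
    exact (mul_eq_zero.1 h1).resolve_left hGne
  refine ⟨hz hf fun x hx hx0 => ?_, hz hb hb'⟩
  have := h x hx hx0
  rwa [hb' x hx hx0, zero_mul, add_zero] at this

/-! ### Indefinite forms: polynomials and solutions vanishing on the real null cone -/

/-- The quadratic form with matrix `A`, as a polynomial. -/
def quadPoly (A : Matrix (Fin n) (Fin n) ℝ) : MvPolynomial (Fin n) ℝ :=
  ∑ i, ∑ j, MvPolynomial.C (A i j) * MvPolynomial.X i * MvPolynomial.X j

theorem eval_quadPoly (A : Matrix (Fin n) (Fin n) ℝ) (v : Fin n → ℝ) :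
    MvPolynomial.eval v (quadPoly A) = ∑ i, ∑ j, A i j * v i * v j := by
  simp [quadPoly]

theorem coe_quadPoly (A : Matrix (Fin n) (Fin n) ℝ) : (quadPoly A : PS n) = quad A := by
  rw [← MvPolynomial.coeToMvPowerSeries.ringHom_apply]
  simp [quadPoly, quad]

theorem polynomial_eq_zero_of_isOpen {p : MvPolynomial (Fin n) ℝ} {O : Set (Fin n → ℝ)}
    (hO : IsOpen O) {v : Fin n → ℝ} (hv : v ∈ O) (h : ∀ z ∈ O, MvPolynomial.eval z p = 0) :
    p = 0 := by
  obtain ⟨ε, hε, hb⟩ := Metric.isOpen_iff.1 hO v hv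
  refine MvPolynomial.funext_set (fun i => ball (v i) ε) (fun i => ?_) fun z hz => ?_
  · rw [Real.ball_eq_Ioo]
    exact Ioo_infinite (by linarith)
  · rw [map_zero]
    refine h z (hb ?_)
    rwa [ball_pi v hε]

/-- A polynomial vanishing on the real zeros of an indefinite quadratic form is divisible by it. -/
theorem quadPoly_dvd {A : Matrix (Fin n) (Fin n) ℝ} {w v : Fin n → ℝ}
    (hw : MvPolynomial.eval w (quadPoly A) < 0) (hv : 0 < MvPolynomial.eval v (quadPoly A))
    {p : MvPolynomial (Fin n) ℝ}
    (hp : ∀ z, MvPolynomial.eval z (quadPoly A) = 0 → MvPolynomial.eval z p = 0) :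
    quadPoly A ∣ p := by
  set q := quadPoly A with hq
  set c := MvPolynomial.eval w q with hc
  -- The substitution z + T w, with T a new variable. Because q(w) ≠ 0, q becomes quadratic in T
  -- with constant leading coefficient, so division by its monic multiple M is possible over the
  -- polynomials in z.
  set φ : MvPolynomial (Fin n) ℝ →+* Polynomial (MvPolynomial (Fin n) ℝ) :=
    MvPolynomial.eval₂Hom (Polynomial.C.comp MvPolynomial.C)
      (fun i => Polynomial.C (MvPolynomial.X i) + Polynomial.C (MvPolynomial.C (w i)) * Polynomial.X)
    with hφ
  have hφC : ∀ t, φ (MvPolynomial.C t) = Polynomial.C (MvPolynomial.C t) := fun t => by simp [hφ]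
  have hφX : ∀ i, φ (MvPolynomial.X i) = Polynomial.C (MvPolynomial.X i)
      + Polynomial.C (MvPolynomial.C (w i)) * Polynomial.X := fun i => by simp [hφ]
  have hψ : ∀ (z : Fin n → ℝ) (t : ℝ) (p : MvPolynomial (Fin n) ℝ),
      Polynomial.eval₂ (MvPolynomial.eval z) t (φ p) = MvPolynomial.eval (z + t • w) p := by
    intro z t p
    have : (Polynomial.eval₂RingHom (MvPolynomial.eval z) t).comp φ
        = MvPolynomial.eval (z + t • w) := by
      refine MvPolynomial.ringHom_ext (fun s => ?_) fun i => ?_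
      · simp [hφC]
      · simp [hφX]; ring
    exact DFunLike.congr_fun this p
  have hψ0 : ∀ p : MvPolynomial (Fin n) ℝ, Polynomial.eval 0 (φ p) = p := by
    intro p
    have : (Polynomial.evalRingHom 0).comp φ = RingHom.id _ := by
      refine MvPolynomial.ringHom_ext (fun s => ?_) fun i => ?_
      · simp [hφC]
      · simp [hφX]
    exact DFunLike.congr_fun this p
  set b : MvPolynomial (Fin n) ℝ := ∑ i, ∑ j, MvPolynomial.C (A i j)
    * (MvPolynomial.X i * MvPolynomial.C (w j) + MvPolynomial.C (w i) * MvPolynomial.X j) with hb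
  have hcc : (MvPolynomial.C c⁻¹ : MvPolynomial (Fin n) ℝ) * MvPolynomial.C c = 1 := by
    rw [← map_mul, inv_mul_cancel₀ hw.ne, map_one]
  have hφq : φ q = Polynomial.C (MvPolynomial.C c) * Polynomial.X ^ 2
      + Polynomial.C b * Polynomial.X + Polynomial.C q := by
    rw [hc, hq, eval_quadPoly, hb]
    simp only [quadPoly, map_sum, map_mul, map_add, hφC, hφX, Finset.sum_mul,
      ← Finset.sum_add_distrib]
    exact Finset.sum_congr rfl fun i _ => Finset.sum_congr rfl fun j _ => by ring
  set M : Polynomial (MvPolynomial (Fin n) ℝ) := Polynomial.X ^ 2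
    + Polynomial.C (MvPolynomial.C c⁻¹ * b) * Polynomial.X
    + Polynomial.C (MvPolynomial.C c⁻¹ * q) with hM
  have hφM : φ q = Polynomial.C (MvPolynomial.C c) * M := by
    have h1 : (Polynomial.C (MvPolynomial.C c⁻¹) : Polynomial (MvPolynomial (Fin n) ℝ))
        * Polynomial.C (MvPolynomial.C c) = 1 := by rw [← map_mul, hcc, map_one]
    rw [hφq, hM, Polynomial.C_mul, Polynomial.C_mul]
    linear_combination -(Polynomial.C b * Polynomial.X + Polynomial.C q) * h1
  have hMdeg : M.natDegree = 2 := by rw [hM]; compute_degree!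
  have hMm : M.Monic := by rw [hM]; monicity!
  have hrem : (φ p %ₘ M).natDegree ≤ 1 := by
    have := Polynomial.natDegree_modByMonic_lt (φ p) hMm (by
      intro h; rw [h, Polynomial.natDegree_one] at hMdeg; omega)
    omega
  obtain ⟨r₁, r₀, hr⟩ := Polynomial.exists_eq_X_add_C_of_natDegree_le_one hrem
  have hdiv := Polynomial.modByMonic_add_div (φ p) M
  have hO : IsOpen {z : Fin n → ℝ | 0 < MvPolynomial.eval z q} :=
    isOpen_lt continuous_const (MvPolynomial.continuous_eval q)
  -- For q(z) > 0 > q(w) the quadratic in T has two distinct real roots. Both give null points,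
  -- where p vanishes, so the remainder of degree at most one has two zeros and is zero at z.
  have hr0 : ∀ z ∈ {z : Fin n → ℝ | 0 < MvPolynomial.eval z q}, MvPolynomial.eval z r₀ = 0 := by
    intro z hz
    set β := c⁻¹ * MvPolynomial.eval z b with hβ
    set κ := c⁻¹ * MvPolynomial.eval z q with hκ
    have hκ0 : κ < 0 := mul_neg_of_neg_of_pos (inv_lt_zero.2 hw) hz
    have hroot : ∀ t : ℝ, t ^ 2 + β * t + κ = 0 →
        MvPolynomial.eval z r₁ * t + MvPolynomial.eval z r₀ = 0 := by
      intro t ht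
      have e1 : Polynomial.eval₂ (MvPolynomial.eval z) t M = 0 := by
        simp only [hM, Polynomial.eval₂_add, Polynomial.eval₂_mul, Polynomial.eval₂_C,
          Polynomial.eval₂_X, Polynomial.eval₂_pow, map_mul, MvPolynomial.eval_C]
        exact ht
      have e2 : MvPolynomial.eval (z + t • w) q = 0 := by
        rw [← hψ, hφM, Polynomial.eval₂_mul, e1, mul_zero]
      have e3 := hp _ e2
      rw [← hψ, ← hdiv, Polynomial.eval₂_add, Polynomial.eval₂_mul, e1, zero_mul, add_zero, hr] at e3
      simpa using e3
    set δ := Real.sqrt (β ^ 2 - 4 * κ) with hδ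
    have hδ0 : 0 < δ := Real.sqrt_pos.2 (by nlinarith [sq_nonneg β])
    have hδ2 : δ ^ 2 = β ^ 2 - 4 * κ := Real.sq_sqrt (by nlinarith [sq_nonneg β])
    have h1 := hroot ((-β + δ) / 2) (by linear_combination hδ2 / 4)
    have h2 := hroot ((-β - δ) / 2) (by linear_combination hδ2 / 4)
    have h3 : MvPolynomial.eval z r₁ = 0 := by
      have : MvPolynomial.eval z r₁ * δ = 0 := by linear_combination h1 - h2
      exact (mul_eq_zero.1 this).resolve_right hδ0.ne'
    rw [h3, zero_mul, zero_add] at h1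
    exact h1
  have hr0' := polynomial_eq_zero_of_isOpen hO hv hr0
  refine ⟨MvPolynomial.C c⁻¹ * Polynomial.eval 0 (φ p /ₘ M), ?_⟩
  -- Setting T = 0 discards the linear remainder term, and M becomes a constant multiple of q.
  nth_rewrite 1 [← hψ0 p, ← hdiv, hr, hr0']
  simp [hM]
  ring

/-- The Taylor polynomial of degree `k` of a series of order `k`. -/
def leading (k : ℕ) (d : PS n) : MvPolynomial (Fin n) ℝ := truncTotal (k + 1) d

theorem coeff_leading {k : ℕ} {d : PS n} (ho : OrdGE k d) {α : Fin n →₀ ℕ} (hα : α.degree ≠ k) :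
    (leading k d).coeff α = 0 := by
  rw [leading, coeff_truncTotal_eq_ite]
  split_ifs with h
  · exact ho α (by omega)
  · rfl

theorem OrdGE.sub_leading (k : ℕ) (d : PS n) : OrdGE (k + 1) (d - (leading k d : PS n)) :=
  fun α hα => by
    rw [map_sub, MvPolynomial.coeff_coe, leading, coeff_truncTotal _ hα, sub_self]

theorem ev_coe (p : MvPolynomial (Fin n) ℝ) (z : Fin n → ℝ) :
    ev (p : PS n) z = MvPolynomial.eval z p := by
  rw [MvPolynomial.eval_eq', ev, tsum_eq_sum (s := p.support)]
  · rfl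
  · intro α hα
    rw [MvPolynomial.coeff_coe, MvPolynomial.notMem_support_iff.1 hα, zero_mul]

theorem conv_coe (ρ : ℝ) (p : MvPolynomial (Fin n) ℝ) : Conv ρ (p : PS n) := by
  induction p using MvPolynomial.induction_on with
  | C t => rw [MvPolynomial.coe_C]; exact Conv.const t
  | add p q hp hq => rw [MvPolynomial.coe_add]; exact hp.add hq
  | mul_X p i hp => rw [MvPolynomial.coe_mul, MvPolynomial.coe_X]; exact hp.mul (Conv.X i)

theorem eval_smul_leading {k : ℕ} {d : PS n} (ho : OrdGE k d) (s : ℝ) (y : Fin n → ℝ) :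
    MvPolynomial.eval (s • y) (leading k d) = s ^ k * MvPolynomial.eval y (leading k d) := by
  rw [MvPolynomial.eval_eq', MvPolynomial.eval_eq', Finset.mul_sum]
  refine Finset.sum_congr rfl fun α hα => ?_
  have h1 : α.degree = k := by
    by_contra h
    exact MvPolynomial.mem_support_iff.1 hα (coeff_leading ho h)
  simp only [Pi.smul_apply, smul_eq_mul, mul_pow, Finset.prod_mul_distrib,
    Finset.prod_pow_eq_pow_sum, ← Finsupp.degree_eq_sum, h1]
  ring

/-- If a series vanishes along a curve, its leading form vanishes at the initial velocity. -/
theorem eval_leading_eq_zero {r : ℝ} (hr : 0 < r) {d : PS n} (hc : Conv r d) {k : ℕ}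
    (ho : OrdGE k d) {ξ v : Fin n → ℝ} {γ : ℝ → Fin n → ℝ} (h0 : γ 0 = ξ)
    (hγ : HasDerivWithinAt γ v (Icc 0 1) 0) (hz : ∀ᶠ s in 𝓝[>] (0 : ℝ), fn ξ d (γ s) = 0) :
    MvPolynomial.eval v (leading k d) = 0 := by
  set e := d - (leading k d : PS n) with he
  have hec : Conv r e := hc.sub (conv_coe r _)
  obtain ⟨M, hM0, hM⟩ := hec.exists_maj_pow hr (OrdGE.sub_leading k d)
  -- The difference quotient tends to v. Dividing the expansion 0 = s^k · (leading form at y) +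
  -- O(s^(k+1)) by s^k and letting s → 0 gives the claim.
  set y : ℝ → Fin n → ℝ := fun s => s⁻¹ • (γ s - ξ) with hy
  have hyt : Tendsto y (𝓝[>] 0) (𝓝 v) := by
    have h1 := hasDerivWithinAt_iff_tendsto_slope.1 hγ
    have h2 : 𝓝[>] (0 : ℝ) ≤ 𝓝[Icc 0 1 \ {0}] 0 := by
      rw [Icc_sdiff_left]
      exact (nhdsWithin_Ioc_eq_nhdsGT zero_lt_one).ge
    refine (h1.mono_left h2).congr fun s => ?_
    simp only [slope, hy, vsub_eq_sub, sub_zero, h0]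
  have hs0 : Tendsto (fun s : ℝ => s) (𝓝[>] 0) (𝓝 0) := tendsto_id.mono_left nhdsWithin_le_nhds
  have hsm : Tendsto (fun s => s * (‖y s‖ + 1)) (𝓝[>] 0) (𝓝 0) := by
    simpa using hs0.mul (hyt.norm.add_const 1)
  have hbd : Tendsto (fun s => M * s * (‖y s‖ + 1) ^ (k + 1)) (𝓝[>] 0) (𝓝 0) := by
    simpa using (hs0.const_mul M).mul ((hyt.norm.add_const 1).pow (k + 1))
  have hev : Tendsto (fun s => |MvPolynomial.eval (y s) (leading k d)|) (𝓝[>] 0)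
      (𝓝 |MvPolynomial.eval v (leading k d)|) :=
    ((MvPolynomial.continuous_eval (leading k d)).tendsto v |>.comp hyt).abs
  have hle := le_of_tendsto_of_tendsto hev hbd ?_
  · exact abs_eq_zero.1 (le_antisymm hle (abs_nonneg _))
  · filter_upwards [hz, self_mem_nhdsWithin,
      hsm.eventually_le_const (show (0 : ℝ) < r / 2 by positivity)] with s h1 h2 h3
    have hs : (0 : ℝ) < s := h2
    have e1 : γ s - ξ = s • y s := by rw [hy]; simp [smul_smul, hs.ne']
    have e2 : ‖s • y s‖ ≤ s * (‖y s‖ + 1) := by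
      rw [norm_smul, Real.norm_of_nonneg hs.le]; nlinarith
    have e3 := (hM _ (by positivity) h3).abs_ev_le e2
    have e4 : ev e (s • y s) = -(s ^ k * MvPolynomial.eval (y s) (leading k d)) := by
      have h4 : s • y s + ξ ∈ ball ξ r := by
        rw [mem_ball_iff_norm, add_sub_cancel_right]; linarith
      have h5 := hc.fn_sub (conv_coe r (leading k d)) h4
      simp only [fn, add_sub_cancel_right] at h5
      rw [fn, e1] at h1
      rw [he, h5, h1, ev_coe, eval_smul_leading ho, zero_sub]
    rw [e4, abs_neg, abs_mul, abs_of_pos (pow_pos hs k), mul_pow] at e3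
    refine le_of_mul_le_mul_left (e3.trans (le_of_eq ?_)) (pow_pos hs k)
    ring

namespace FormalOp

variable {F : FormalOp n}

/-- The principal part at the origin. -/
def frozen (F : FormalOp n) : FormalOp n := ⟨fun i j => C (F.a₀ i j), 0, 0⟩

theorem frozen_app (u : PS n) :
    F.frozen.app u = ∑ i, ∑ k, C (F.a₀ i k) * pderiv ℝ i (pderiv ℝ k u) := by
  simp [app, frozen]

/-- The difference loses one order only: either the variable part of a contributes a factor
vanishing at the pole, or at most one derivative is taken. -/
theorem frozen_app_sub (k : ℕ) {u : PS n} (hu : OrdGE k u) :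
    OrdGE (k - 1) (F.frozen.app u - F.app u) := by
  have e : F.frozen.app u - F.app u = -(∑ i, ∑ k, (F.a i k - C (F.a₀ i k))
      * pderiv ℝ i (pderiv ℝ k u) + ∑ i, F.b i * pderiv ℝ i u + F.c * u) := by
    rw [frozen_app, app]
    simp only [sub_mul, Finset.sum_sub_distrib]
    ring
  rw [e]
  refine OrdGE.neg (OrdGE.add (OrdGE.add ?_ ?_) ?_)
  · exact OrdGE.sum _ fun i _ => OrdGE.sum _ fun j _ =>
      ((OrdGE.sub_const (F.a i j)).mul ((hu.pderiv_sub_one j).pderiv_sub_one i)).mono (by omega)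
  · exact OrdGE.sum _ fun i _ => OrdGE.mul_left _ (hu.pderiv_sub_one i)
  · exact OrdGE.mul_left _ (hu.mono (by omega))

/-- For constant principal coefficients the quadratic form itself solves the eikonal equation, with
correction E = 0. The divisibility results thus apply to the frozen operator. -/
theorem frozen_normal (hs : ∀ i j, F.a i j = F.a j i) {A : Matrix (Fin n) (Fin n) ℝ}
    (hA : A.IsSymm) (hAA : F.a₀ * A = 1) : ∃ R > 0, F.frozen.Normal (quad A) R := by
  have h0 : F.frozen.a₀ = F.a₀ := by
    ext i j; simp [a₀, frozen]
  have hs0 : ∀ i j, F.frozen.a i j = F.frozen.a j i := fun i j => by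
    simp only [frozen, a₀, hs i j]
  have hE : F.frozen.Eikonal (quad A + 0) := by
    refine eikonal_of_fixedPoint hs0 hA (by rw [h0, hAA]) ?_
    rw [eikonalRHS, h0]
    simp [frozen]
  obtain ⟨R, hR, -, hN⟩ := exists_normal one_pos (fun i j => Conv.const _) (fun i => Conv.zero)
    hA (by rw [h0, hAA]) OrdGE.zero Conv.zero hE
  exact ⟨R, hR, by rwa [add_zero] at hN⟩

/-- A formal solution whose leading forms vanish on an indefinite null cone is zero. -/
theorem eq_zero_of_leading (hs : ∀ i j, F.a i j = F.a j i) {A : Matrix (Fin n) (Fin n) ℝ}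
    (hA : A.IsSymm) (hAA : F.a₀ * A = 1) {w v : Fin n → ℝ}
    (hw : MvPolynomial.eval w (quadPoly A) < 0) (hv : 0 < MvPolynomial.eval v (quadPoly A))
    {d : PS n} (hd : F.app d = 0)
    (hz : ∀ k, OrdGE k d → ∀ z, MvPolynomial.eval z (quadPoly A) = 0 →
      MvPolynomial.eval z (leading k d) = 0) : d = 0 := by
  obtain ⟨R, -, hN⟩ := F.frozen_normal hs hA hAA
  have hn : 0 < n := by
    rcases Nat.eq_zero_or_pos n with rfl | h
    · simp [quadPoly] at hv
    · exact h
  refine OrdGE.eq_zero fun k => ?_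
  induction k with
  | zero => exact OrdGE.zero_left d
  | succ k ih =>
    set p := leading k d with hp
    obtain ⟨q, hq⟩ := quadPoly_dvd hw hv (hz k ih)
    have hdvd : quad A ∣ (p : PS n) := ⟨(q : PS n), by rw [hp, hq, MvPolynomial.coe_mul, coe_quadPoly]⟩
    -- The image of the leading form under the frozen operator is homogeneous of degree k - 2 and is
    -- the lowest part of F[d] = 0. Being also divisible by the quadratic form, p vanishes, and the
    -- order of d rises by one.
    have happ : F.frozen.app (p : PS n) = 0 := by
      ext α
      rw [map_zero]
      by_cases hα : α.degree < k - 1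
      · have e1 : F.frozen.app (p : PS n)
            = (F.frozen.app d - F.app d) - F.frozen.app (d - (p : PS n)) := by
          rw [hd, app_sub]; ring
        have e2 : OrdGE (k - 1) (F.frozen.app (p : PS n)) := by
          rw [e1]
          refine (F.frozen_app_sub k ih).sub ?_
          have h1 : OrdGE (k - 1 + 2) (d - (p : PS n)) := by
            rcases k with _ | k
            · simp at hα
            · exact (OrdGE.sub_leading _ d).mono (by omega)
          exact app_sub_order _ h1
        exact e2 α hα
      · rw [frozen_app, map_sum]
        refine Finset.sum_eq_zero fun i _ => ?_
        rw [map_sum]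
        refine Finset.sum_eq_zero fun j _ => ?_
        rw [coeff_C_mul, coeff_pderiv, coeff_pderiv, MvPolynomial.coeff_coe, coeff_leading ih]
        · simp
        · rw [map_add, map_add, Finsupp.degree_single, Finsupp.degree_single]
          omega
    have h0 := hN.eq_zero_of_dvd hn happ hdvd
    have h1 := OrdGE.sub_leading k d
    rwa [← hp, h0, sub_zero] at h1

end FormalOp

/-! ### Uniqueness of the characteristic problem and of the logarithmic term -/

namespace Normalized

variable {F : LinOp n} {ξ : Fin n → ℝ} {N : Set (Fin n → ℝ)} {R : ℝ} {H : FormalOp n} {G : PS n}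

theorem rep_app (h : Normalized F ξ N R H G) {u : (Fin n → ℝ) → ℝ} {c : PS n} (hc : Rep ξ u c) :
    Rep ξ (F.app u) (H.app c) := by
  have hev := hc.eventuallyEq
  obtain ⟨ρ, hρ, hcρ, -⟩ := hc
  have hM := h.toModels.mono (min_le_right ρ R)
  have hc' := hcρ.mono (min_le_left ρ R)
  refine (Rep.of_conv (lt_min hρ h.pos) (hM.conv_app hc')).congr ?_
  filter_upwards [hev.eventuallyEq_nhds, ball_mem_nhds ξ (lt_min hρ h.pos)] with x h1 h2
  rw [LinOp.app_congr h1, hM.app_fn hc' h2]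

/-- The difference of two solutions, as a formal solution. -/
theorem exists_rep_sub (h : Normalized F ξ N R H G) {v v' : (Fin n → ℝ) → ℝ}
    (hv : AnalyticAt ℝ v ξ) (hv' : AnalyticAt ℝ v' ξ) (hz : ∀ᶠ x in 𝓝 ξ, F.app v x = 0)
    (hz' : ∀ᶠ x in 𝓝 ξ, F.app v' x = 0) :
    ∃ d, Rep ξ (fun x => v' x - v x) d ∧ H.app d = 0 := by
  obtain ⟨c, hc⟩ := Rep.of_analyticAt hv
  obtain ⟨c', hc'⟩ := Rep.of_analyticAt hv'
  refine ⟨c' - c, hc'.sub hc, ?_⟩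
  rw [FormalOp.app_sub, (h.rep_app hc).zero_iff.2 hz, (h.rep_app hc').zero_iff.2 hz', sub_zero]

/-- Uniqueness in the characteristic initial-value problem. -/
theorem eventuallyEq_of_eqOnConoid (h : Normalized F ξ N R H G) (hn : 0 < n)
    {v v' v₀ : (Fin n → ℝ) → ℝ} (hv : AnalyticAt ℝ v ξ) (hv' : AnalyticAt ℝ v' ξ)
    (hz : ∀ᶠ x in 𝓝 ξ, F.app v x = 0) (hz' : ∀ᶠ x in 𝓝 ξ, F.app v' x = 0)
    (hc : F.EqOnConoid ξ N v v₀) (hc' : F.EqOnConoid ξ N v' v₀) : ∀ᶠ x in 𝓝 ξ, v' x = v x := by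
  obtain ⟨d, hd, hd0⟩ := h.exists_rep_sub hv hv' hz hz'
  obtain ⟨E, hE, he⟩ := hc
  obtain ⟨E', hE', he'⟩ := hc'
  obtain ⟨e, hre⟩ := Rep.of_analyticAt hE
  obtain ⟨e', hre'⟩ := Rep.of_analyticAt hE'
  have hdvd : d = G * (e' - e) := by
    refine hd.unique (((Rep.of_conv h.pos h.conv).mul (hre'.sub hre)).congr ?_)
    filter_upwards [he, he', h.world_eventuallyEq h.mem] with x h1 h2 h3
    rw [h1, h2, h3]; ring
  filter_upwards [hd.zero_iff.1 (h.normal.eq_zero_of_dvd hn hd0 ⟨_, hdvd⟩)] with x hx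
  exact sub_eq_zero.1 hx

/-- In the indefinite case, solutions are determined by their values on the real conoid. -/
theorem eventuallyEq_of_indefinite (h : Normalized F ξ N R H G) (hdet : (F.a ξ).det ≠ 0)
    (hI : F.Indefinite ξ) {v v' : (Fin n → ℝ) → ℝ} (hv : AnalyticAt ℝ v ξ)
    (hv' : AnalyticAt ℝ v' ξ) (hz : ∀ᶠ x in 𝓝 ξ, F.app v x = 0)
    (hz' : ∀ᶠ x in 𝓝 ξ, F.app v' x = 0) (hc : ∀ᶠ x in 𝓝 ξ, F.world ξ N x = 0 → v' x = v x) :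
    ∀ᶠ x in 𝓝 ξ, v' x = v x := by
  obtain ⟨d, hd, hd0⟩ := h.exists_rep_sub hv hv' hz hz'
  set A := (F.a ξ)⁻¹ with hA
  have hu : IsUnit (F.a ξ).det := isUnit_iff_ne_zero.2 hdet
  have hAs : A.IsSymm := Matrix.IsSymm.inv (Matrix.IsSymm.ext fun i j => h.a_symm ξ h.mem j i)
  have hAA : H.a₀ * A = 1 := by rw [h.a₀_eq h.pos, hA, Matrix.mul_nonsing_inv _ hu]
  -- Indefiniteness is stated on momenta; lowering and raising indices by a(ξ) transfers it to the
  -- form A on velocities.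
  have hq : ∀ p : Fin n → ℝ, MvPolynomial.eval ((F.a ξ).mulVec p) (quadPoly A) = 4 * F.H ξ p := by
    intro p
    have e1 : A.mulVec ((F.a ξ).mulVec p) = p := by
      rw [Matrix.mulVec_mulVec, hA, Matrix.nonsing_inv_mul _ hu, Matrix.one_mulVec]
    have e2 : ∀ i, ∑ j, A i j * (F.a ξ).mulVec p j = p i := fun i => congrFun e1 i
    rw [eval_quadPoly, LinOp.H, ← mul_assoc]
    norm_num
    calc _ = ∑ i, (F.a ξ).mulVec p i * ∑ j, A i j * (F.a ξ).mulVec p j := by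
          simp only [Finset.mul_sum]
          exact Finset.sum_congr rfl fun i _ => Finset.sum_congr rfl fun j _ => by ring
      _ = _ := by
          simp only [e2]
          simp only [Matrix.mulVec, dotProduct, Finset.sum_mul]
          exact Finset.sum_congr rfl fun i _ => Finset.sum_congr rfl fun j _ => by ring
  obtain ⟨⟨p, hp⟩, ⟨p', hp'⟩⟩ := hI
  obtain ⟨ε, hε, hcurve⟩ := h.curve
  have hfin : d = 0 := by
    refine H.eq_zero_of_leading h.normal.symm hAs hAA (w := (F.a ξ).mulVec p)
      (v := (F.a ξ).mulVec p') (by rw [hq]; linarith) (by rw [hq]; linarith) hd0 fun k ho z hzQ => ?_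
    -- A null vector is rescaled so that the geodesic with that velocity stays in N. Γ vanishes
    -- along it, so the difference d does too; homogeneity of the leading form removes the scale
    -- afterwards.
    set t : ℝ := ε / (2 * (‖z‖ + 1)) with ht
    have ht0 : 0 < t := by positivity
    have hlt : ‖t • z‖ < ε := by
      rw [norm_smul, Real.norm_of_nonneg ht0.le, ht, div_mul_eq_mul_div, div_lt_iff₀ (by positivity)]
      nlinarith [norm_nonneg z]
    obtain ⟨γ, h0, hγ, hγN⟩ := hcurve (t • z) hlt
    have hzz : ∑ i, ∑ j, A i j * (t • z) i * (t • z) j = 0 := by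
      rw [eval_quadPoly] at hzQ
      calc _ = t ^ 2 * ∑ i, ∑ j, A i j * z i * z j := by
            simp only [Finset.mul_sum, Pi.smul_apply, smul_eq_mul]
            exact Finset.sum_congr rfl fun i _ => Finset.sum_congr rfl fun j _ => by ring
        _ = 0 := by rw [hzQ, mul_zero]
    obtain ⟨ρ, hρ, hdρ, hdeq⟩ := hd
    have hIcc : ∀ᶠ s in 𝓝[>] (0 : ℝ), s ∈ Icc (0 : ℝ) 1 := by
      filter_upwards [Ioc_mem_nhdsGT (zero_lt_one' ℝ)] with s hs using ⟨hs.1.le, hs.2⟩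
    have hlim : Tendsto γ (𝓝[>] 0) (𝓝 ξ) := by
      have h1 := hγ.continuousWithinAt.tendsto
      rw [h0] at h1
      refine h1.mono_left ?_
      rw [nhdsWithin_le_iff]
      exact hIcc
    have hev := eval_leading_eq_zero hρ hdρ ho h0 hγ (by
      filter_upwards [hIcc, hlim.eventually hc, hlim.eventually (ball_mem_nhds ξ hρ)] with s h1 h2 h3
      rw [← hdeq _ h3, sub_eq_zero]
      refine h2 ?_
      rw [h.world_eq _ (hγN s h1).1, (hγN s h1).2, hzz, mul_zero])
    rw [eval_smul_leading ho] at hev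
    exact (mul_eq_zero.1 hev).resolve_left (pow_ne_zero k ht0.ne')
  filter_upwards [Rep.zero_iff hd |>.1 hfin] with x hx
  exact sub_eq_zero.1 hx

/-- The formal equations satisfied by the coefficients of a fundamental solution. -/
theorem formal_of_isFundSol (h : Normalized F ξ N R H G) (hn : 0 < n) {m : ℕ} (hm : expo n = m)
    {N₁ : Set (Fin n → ℝ)} {U V W : (Fin n → ℝ) → ℝ} (hF : F.IsFundSol ξ N N₁ U V W)
    {u v w : PS n} (hu : Rep ξ U u) (hv : Rep ξ V v) (hw : Rep ξ W w) :
    H.app v = 0 ∧ G * H.app u - C (4 * expo n) * H.T G (-expo n - 1) u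
      + G ^ m * (G * H.app w + 4 * H.T G (-1) v) = 0 := by
  obtain ⟨ρ₁, hρ₁, hu1, hu2⟩ := hu
  obtain ⟨ρ₂, hρ₂, hv1, hv2⟩ := hv
  obtain ⟨ρ₃, hρ₃, hw1, hw2⟩ := hw
  obtain ⟨ρ₄, hρ₄, hball⟩ := Metric.isOpen_iff.1 hF.isOpen ξ hF.mem
  set r := min (min ρ₁ ρ₂) (min (min ρ₃ ρ₄) R) with hr
  have hr0 : 0 < r := lt_min (lt_min hρ₁ hρ₂) (lt_min (lt_min hρ₃ hρ₄) h.pos)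
  have hr1 : r ≤ ρ₁ := (min_le_left _ _).trans (min_le_left _ _)
  have hr2 : r ≤ ρ₂ := (min_le_left _ _).trans (min_le_right _ _)
  have hr3 : r ≤ ρ₃ := (min_le_right _ _).trans ((min_le_left _ _).trans (min_le_left _ _))
  have hr4 : r ≤ ρ₄ := (min_le_right _ _).trans ((min_le_left _ _).trans (min_le_right _ _))
  have hrR : r ≤ R := (min_le_right _ _).trans (min_le_right _ _)
  have hM : Models F ξ r H := h.toModels.mono hrR
  have hG : Conv r G := h.conv.mono hrR
  have hur := hu1.mono hr1
  have hvr := hv1.mono hr2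
  have hwr := hw1.mono hr3
  have ca := hM.conv_app hur
  have cb := hM.conv_T hG hur (-expo n - 1)
  have cc := hM.conv_T hG hvr (-1)
  have cd := hM.conv_app hwr
  have ce := hM.conv_app hvr
  have cA : Conv r (G * H.app u - (4 * expo n) • H.T G (-expo n - 1) u) :=
    (hG.mul ca).sub (cb.smul _)
  have cB : Conv r (G * H.app w + (4 : ℝ) • H.T G (-1) v) := (hG.mul cd).add (cc.smul _)
  have key := eq_zero_of_log_relation (ξ := ξ) hr0 (cA.add ((hG.pow m).mul cB))
    ((hG.pow (m + 1)).mul ce) hG (OrdGE.one_iff.1 (h.normal.order.mono (by norm_num)))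
    (h.normal.ne_zero hn) (fun x hx hx0 => ?_)
  · refine ⟨(mul_eq_zero.1 key.2).resolve_left (pow_ne_zero _ (h.normal.ne_zero hn)), ?_⟩
    have h1 := key.1
    rwa [smul_eq_C_mul, smul_eq_C_mul, map_ofNat] at h1
  have hxN₁ : x ∈ N₁ := hball (ball_subset_ball hr4 hx)
  have hxN := hF.subset hxN₁
  have hUe : U =ᶠ[𝓝 x] fn ξ u := by
    filter_upwards [isOpen_ball.mem_nhds hx] with y hy using hu2 y (ball_subset_ball hr1 hy)
  have hVe : V =ᶠ[𝓝 x] fn ξ v := by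
    filter_upwards [isOpen_ball.mem_nhds hx] with y hy using hv2 y (ball_subset_ball hr2 hy)
  have hWe : W =ᶠ[𝓝 x] fn ξ w := by
    filter_upwards [isOpen_ball.mem_nhds hx] with y hy using hw2 y (ball_subset_ball hr3 hy)
  have e1 := h.world_mul_app_split hxN hx0 (hF.analytic_U x hxN₁) (hF.analytic_V x hxN₁)
    (hF.analytic_W x hxN₁)
  rw [hF.solves x hxN₁ (by rwa [h.world_eq x hxN]), mul_zero, LinOp.app_congr hUe,
    LinOp.app_congr hVe, LinOp.app_congr hWe, LinOp.transp_congr _ hUe, LinOp.transp_congr _ hVe,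
    hM.app_fn hur hx, hM.app_fn hvr hx, hM.app_fn hwr hx, hM.transp_fn hG hur _ hx,
    hM.transp_fn hG hvr _ hx, hm, Complex.cpow_neg] at e1
  push_cast at e1
  rw [Complex.cpow_natCast] at e1
  have hx0c : (fn ξ G x : ℂ) ≠ 0 := by exact_mod_cast hx0
  -- Multiplication by Γ^m clears the pole. Taking real parts below replaces the principal logarithm
  -- by log |Γ|, for either sign of Γ, and the relation splits into its analytic and logarithmic
  -- parts.
  have e2 : (((fn ξ G x * fn ξ (H.app u) x - 4 * m * fn ξ (H.T G (-m - 1) u) x)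
        + fn ξ G x ^ m * (fn ξ G x * fn ξ (H.app w) x + 4 * fn ξ (H.T G (-1) v) x) : ℝ) : ℂ)
      + ((fn ξ G x ^ (m + 1) * fn ξ (H.app v) x : ℝ) : ℂ) * Complex.log (fn ξ G x : ℂ) = 0 := by
    push_cast
    have e3 := congrArg (fun t => (fn ξ G x : ℂ) ^ m * t) e1
    simp only [mul_zero] at e3
    rw [e3]
    field_simp
    ring
  have e4 := congrArg Complex.re e2
  rw [Complex.add_re, Complex.re_ofReal_mul, Complex.log_ofReal_re, Complex.ofReal_re,
    Complex.zero_re] at e4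
  rw [cA.fn_add ((hG.pow m).mul cB) hx, (hG.mul ca).fn_sub (cb.smul _) hx, hG.fn_mul ca hx,
    (hG.pow m).fn_mul cB hx, hG.fn_pow m hx, (hG.mul cd).fn_add (cc.smul _) hx, hG.fn_mul cd hx,
    fn_smul, fn_smul, (hG.pow (m + 1)).fn_mul ce hx, hG.fn_pow (m + 1) hx, hm]
  exact e4

/-- The logarithmic coefficient of a fundamental solution is determined up to a factor. -/
theorem log_forced (h : Normalized F ξ N R H G) {m : ℕ} (hm1 : 1 ≤ m) (hm : expo n = m)
    {P : ℝ} (hP : P ≠ 0) {u v w : PS n} (hu : constantCoeff u = P) (hv : H.app v = 0)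
    (he : G * H.app u - C (4 * expo n) * H.T G (-expo n - 1) u
      + G ^ m * (G * H.app w + 4 * H.T G (-1) v) = 0)
    {N₁ : Set (Fin n → ℝ)} {U' V' W' : (Fin n → ℝ) → ℝ} (hF : F.IsFundSol ξ N N₁ U' V' W') :
    ∀ᶠ x in 𝓝 ξ, V' x = U' ξ / P * fn ξ v x := by
  have hn : 0 < n := by
    rcases Nat.eq_zero_or_pos n with h0 | h0
    · have h1 : (0 : ℝ) ≤ m := m.cast_nonneg
      rw [← hm, expo, h0] at h1
      norm_num at h1
    · exact h0
  obtain ⟨u', hu'⟩ := Rep.of_analyticAt (hF.analytic_U ξ hF.mem)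
  obtain ⟨v', hv'⟩ := Rep.of_analyticAt (hF.analytic_V ξ hF.mem)
  obtain ⟨w', hw'⟩ := Rep.of_analyticAt (hF.analytic_W ξ hF.mem)
  obtain ⟨h1, h2⟩ := h.formal_of_isFundSol hn hm hF hu' hv' hw'
  -- Subtracting c times the constructed solution makes the coefficient of Γ^(-m) vanish at the
  -- pole, so the difference carries no logarithm.
  set c := U' ξ / P with hc
  have h3 : v' - c • v = 0 := by
    refine h.normal.log_eq_zero hm1 hm (u := u' - c • u) (w := w' - c • w) ?_ ?_ ?_
    · rw [map_sub, constantCoeff_smul, hu, ← fn_self ξ u', ← hu'.eventuallyEq.eq_of_nhds, hc]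
      simp [hP]
    · rw [FormalOp.app_sub, FormalOp.app_smul, h1, hv, smul_zero, sub_zero]
    · rw [FormalOp.app_sub, FormalOp.app_smul, FormalOp.app_sub, FormalOp.app_smul,
        FormalOp.T_sub, FormalOp.T_smul, FormalOp.T_sub, FormalOp.T_smul]
      simp only [smul_eq_C_mul]
      linear_combination h2 - C c * he
  rw [sub_eq_zero] at h3
  filter_upwards [hv'.eventuallyEq] with x hx
  rw [hx, h3, fn_smul]

end Normalized

/-! ### Assembly of the even-dimensional statement -/

namespace Normalized

variable {F : LinOp n} {ξ : Fin n → ℝ} {N : Set (Fin n → ℝ)} {R : ℝ} {H : FormalOp n} {G : PS n}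

/-- Hadamard's theorem for an even number of variables. -/
theorem even_part (h : Normalized F ξ N R H G) (hR : R ≤ 1 / 2) {A : ℝ} (hB : H.Bdd (2 * R) A)
    (hN : H.Normal G (2 * R)) (hdet : (F.a ξ).det ≠ 0) (hn : Even n) (h4 : 4 ≤ n) {P : ℝ}
    (hP : P ≠ 0) :
    ∃ U V W : ℕ → (Fin n → ℝ) → ℝ,
      (∀ l < n / 2 - 1, AnalyticOnNhd ℝ (U l) N) ∧ U 0 ξ = P ∧
      (∀ l < n / 2 - 1, F.EqU ξ N U l) ∧
      (∀ U' : ℕ → (Fin n → ℝ) → ℝ, (∀ l < n / 2 - 1, AnalyticOnNhd ℝ (U' l) N) →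
        U' 0 ξ = P → (∀ l < n / 2 - 1, F.EqU ξ N U' l) →
        ∀ l < n / 2 - 1, EqOn (U' l) (U l) N) ∧
      (∀ l, AnalyticOnNhd ℝ (V l) N) ∧ (∀ l, F.EqV ξ N (U (n / 2 - 2)) V l) ∧
      (∀ V' : ℕ → (Fin n → ℝ) → ℝ, (∀ l, AnalyticOnNhd ℝ (V' l) N) →
        (∀ l, F.EqV ξ N (U (n / 2 - 2)) V' l) → ∀ l, EqOn (V' l) (V l) N) ∧
      (∀ l, AnalyticOnNhd ℝ (W l) N) ∧ (∀ x, W 0 x = 0) ∧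
      ∃ (N₀ : Set (Fin n → ℝ)) (v w : (Fin n → ℝ) → ℝ),
        F.SeriesOn ξ N N₀ V v ∧ F.SeriesOn ξ N N₀ W w ∧
        F.IsFundSol ξ N N₀
          (fun x => ∑ l ∈ Finset.range (n / 2 - 1), U l x * F.world ξ N x ^ l) v w ∧
        (∀ x ∈ N₀, F.app v x = 0) ∧
        (∀ x ∈ N₀, F.world ξ N x = 0 → v x = V 0 x) ∧ F.EqOnConoid ξ N v (V 0) ∧
        (∀ v' : (Fin n → ℝ) → ℝ, AnalyticAt ℝ v' ξ → (∀ᶠ x in 𝓝 ξ, F.app v' x = 0) →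
          (F.EqOnConoid ξ N v' (V 0) ∨
            (F.Indefinite ξ ∧ ∀ᶠ x in 𝓝 ξ, F.world ξ N x = 0 → v' x = V 0 x)) →
          ∀ᶠ x in 𝓝 ξ, v' x = v x) ∧
        (∀ (N₁ : Set (Fin n → ℝ)) (U' V' W' : (Fin n → ℝ) → ℝ),
          F.IsFundSol ξ N N₁ U' V' W' →
          ∀ᶠ x in 𝓝 ξ, V' x = U' ξ / P * v x) := by
  obtain ⟨u, v, w, hu0, ht0, hts, hv0, hvs, hw0, huc, hvc, hwc, hvg, hwg, e1, e2, e3⟩ :=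
    h.even_core hR hB hN hn h4 P
  have hn0 : 0 < n := by omega
  have hm := expo_of_even hn h4
  have hEqU := h.eqU huc ht0 hts
  have hEqV := h.eqV (huc (n / 2 - 2)) hvc hv0 hvs
  have hU0 : fn ξ (u 0) ξ = P := by rw [fn_self, hu0]
  obtain ⟨r₁, hr₁, hr₁R, hser₁⟩ := h.exists_series hvg hvc
  obtain ⟨r₂, hr₂, hr₂R, hser₂⟩ := h.exists_series hwg hwc
  -- The shifted series ∑ Γ^l V_(l+1) is the analytic cofactor in V - V₀ = Γ E.
  obtain ⟨r₃, hr₃, hr₃R, hser₃⟩ := h.exists_series (u := fun l => v (l + 1)) hvg.succ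
    fun l => hvc (l + 1)
  set r := min r₁ (min r₂ r₃) with hr
  have hr0 : 0 < r := lt_min hr₁ (lt_min hr₂ hr₃)
  obtain ⟨hVc, hV⟩ := hser₁ r hr0 (min_le_left _ _)
  obtain ⟨hWc, hW⟩ := hser₂ r hr0 ((min_le_right _ _).trans (min_le_left _ _))
  obtain ⟨hEc, -⟩ := hser₃ r hr0 ((min_le_right _ _).trans (min_le_right _ _))
  have hrR : r ≤ R := (min_le_left _ _).trans hr₁R
  have hM : Models F ξ r H := h.toModels.mono hrR
  have hsplit := fsum_pow_succ h.normal.order v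
  set S := ∑ l ∈ Finset.range (n / 2 - 1), G ^ l * u l with hS
  set Sv := fsum fun l => G ^ l * v l with hSv
  set Sw := fsum fun l => G ^ l * w l with hSw
  set Se := fsum fun l => G ^ l * v (l + 1) with hSe
  have hSR : Conv R S := Conv.sum _ fun l _ => (h.conv.pow l).mul (huc l)
  have hSc : constantCoeff S = P := by
    rw [hS, map_sum, Finset.sum_eq_single 0]
    · simp [hu0]
    · intro l _ hl
      rw [map_mul, map_pow, OrdGE.one_iff.1 (h.normal.order.mono (by norm_num)), zero_pow hl,
        zero_mul]
    · intro h0; simp at h0; omega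
  have hSfn : ∀ x ∈ N, ∑ l ∈ Finset.range (n / 2 - 1), fn ξ (u l) x * F.world ξ N x ^ l
      = fn ξ S x := fun x hx => by
    have hx' := h.subset hx
    rw [hS, Conv.fn_sum (ρ := R) _ (fun l _ => (h.conv.pow l).mul (huc l)) hx']
    refine Finset.sum_congr rfl fun l _ => ?_
    rw [(h.conv.pow l).fn_mul (huc l) hx', h.conv.fn_pow l hx', h.world_eq x hx, mul_comm]
  have hvE : ∀ x ∈ N ∩ ball ξ r, fn ξ Sv x = fn ξ (v 0) x + F.world ξ N x * fn ξ Se x :=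
    fun x hx => by
      rw [hsplit, ((hvc 0).mono hrR).fn_add ((h.conv.mono hrR).mul hEc) hx.2,
        (h.conv.mono hrR).fn_mul hEc hx.2, h.world_eq x hx.1]
  have hmem : N ∩ ball ξ r ∈ 𝓝 ξ := inter_mem (h.isOpen.mem_nhds h.mem) (ball_mem_nhds ξ hr0)
  have hcon : F.EqOnConoid ξ N (fn ξ Sv) (fn ξ (v 0)) :=
    ⟨fn ξ Se, hEc.analyticOnNhd ξ ξ (mem_ball_self hr0), by filter_upwards [hmem] with x hx using hvE x hx⟩
  have hz : ∀ x ∈ N ∩ ball ξ r, F.app (fn ξ Sv) x = 0 := fun x hx => by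
    rw [hM.app_fn hVc hx.2, e2, fn_zero]
  have hz' : ∀ᶠ x in 𝓝 ξ, F.app (fn ξ Sv) x = 0 := by filter_upwards [hmem] with x hx using hz x hx
  have hva := hVc.analyticOnNhd ξ ξ (mem_ball_self hr0)
  refine ⟨fun l => fn ξ (u l), fun l => fn ξ (v l), fun l => fn ξ (w l),
    fun l _ => h.analytic_fn (huc l), hU0, fun l _ => hEqU l,
    fun U' hU' hU'0 hU'E => h.eqU_unique (fun l _ => h.analytic_fn (huc l)) hU'
      (hU'0.trans hU0.symm) (fun l _ => hEqU l) hU'E,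
    fun l => h.analytic_fn (hvc l), hEqV,
    fun V' hV' hV'E => h.eqV_unique (by omega) (fun l => h.analytic_fn (hvc l)) hV' hEqV hV'E,
    fun l => h.analytic_fn (hwc l), fun x => by simp only [hw0, fn_zero],
    N ∩ ball ξ r, fn ξ Sv, fn ξ Sw, hV, hW, ?_, hz, fun x hx hx0 => ?_, hcon,
    fun v' hv' hv'z hor => ?_, fun N₁ U' V' W' hF => ?_⟩
  · exact h.isFundSol hr0 hrR (hSR.mono hrR) hVc hWc (fun x hx => hSfn x hx.1)
      (by rwa [hSc]) e2 (hM.conv_app ((huc (n / 2 - 2)).mono hrR)) (Or.inr hm) e1 e3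
  · rw [hvE x hx, hx0, zero_mul, add_zero]
  · rcases hor with hc | ⟨hI, hc⟩
    · exact h.eventuallyEq_of_eqOnConoid hn0 hva hv' hz' hv'z hcon hc
    · refine h.eventuallyEq_of_indefinite hdet hI hva hv' hz' hv'z ?_
      filter_upwards [hc, hmem] with x h1 h2 h3
      rw [h1 h3, hvE x h2, h3, zero_mul, add_zero]
  · refine h.log_forced (by omega) hm hP hSc e2 ?_ hF (w := Sw)
    linear_combination e1 + G ^ (n / 2 - 1) * e3

end Normalized

end HadamardFS

end

theorem mainTheorem7 (n : ℕ) (F : LinOp n) (Ω : Set (Fin n → ℝ)) (hΩ : IsOpen Ω)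
    (hF : F.IsAnalyticOn Ω) (ξ : Fin n → ℝ) (hξ : ξ ∈ Ω) :
    ∃ N : Set (Fin n → ℝ), N ⊆ Ω ∧ F.IsNormalNhd ξ N ∧
      -- the world function is analytic and solves `∑ aⁱʲ ∂ᵢΓ ∂ⱼΓ = 4 Γ`
      AnalyticOnNhd ℝ (F.world ξ N) N ∧
      (∀ x ∈ N, ∑ i, ∑ j, F.a x i j * pd i (F.world ξ N) x * pd j (F.world ξ N) x
        = 4 * F.world ξ N x) ∧
      ∀ P : ℝ, P ≠ 0 →
      -- odd number of variables
      (Odd n → ∃ U : ℕ → (Fin n → ℝ) → ℝ,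
        (∀ l, AnalyticOnNhd ℝ (U l) N) ∧ U 0 ξ = P ∧ (∀ l, F.EqU ξ N U l) ∧
        (∀ U' : ℕ → (Fin n → ℝ) → ℝ, (∀ l, AnalyticOnNhd ℝ (U' l) N) → U' 0 ξ = P →
          (∀ l, F.EqU ξ N U' l) → ∀ l, EqOn (U' l) (U l) N) ∧
        ∃ (N₀ : Set (Fin n → ℝ)) (S : (Fin n → ℝ) → ℝ),
          F.SeriesOn ξ N N₀ U S ∧
          F.IsFundSol ξ N N₀ S (fun _ => 0) (fun _ => 0) ∧
          ∀ x ∈ N₀, F.world ξ N x ≠ 0 →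
            HasSum (fun l : ℕ => (U l x : ℂ) * (F.world ξ N x : ℂ) ^ ((l : ℂ) - (expo n : ℂ)))
              (F.split ξ N S (fun _ => 0) (fun _ => 0) x)) ∧
      -- even number of variables, `m = n / 2 - 1 ≥ 1`
      (Even n → 4 ≤ n → ∃ U V W : ℕ → (Fin n → ℝ) → ℝ,
        (∀ l < n / 2 - 1, AnalyticOnNhd ℝ (U l) N) ∧ U 0 ξ = P ∧
        (∀ l < n / 2 - 1, F.EqU ξ N U l) ∧
        (∀ U' : ℕ → (Fin n → ℝ) → ℝ, (∀ l < n / 2 - 1, AnalyticOnNhd ℝ (U' l) N) →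
          U' 0 ξ = P → (∀ l < n / 2 - 1, F.EqU ξ N U' l) →
          ∀ l < n / 2 - 1, EqOn (U' l) (U l) N) ∧
        (∀ l, AnalyticOnNhd ℝ (V l) N) ∧ (∀ l, F.EqV ξ N (U (n / 2 - 2)) V l) ∧
        (∀ V' : ℕ → (Fin n → ℝ) → ℝ, (∀ l, AnalyticOnNhd ℝ (V' l) N) →
          (∀ l, F.EqV ξ N (U (n / 2 - 2)) V' l) → ∀ l, EqOn (V' l) (V l) N) ∧
        (∀ l, AnalyticOnNhd ℝ (W l) N) ∧ (∀ x, W 0 x = 0) ∧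
        ∃ (N₀ : Set (Fin n → ℝ)) (v w : (Fin n → ℝ) → ℝ),
          F.SeriesOn ξ N N₀ V v ∧ F.SeriesOn ξ N N₀ W w ∧
          F.IsFundSol ξ N N₀
            (fun x => ∑ l ∈ Finset.range (n / 2 - 1), U l x * F.world ξ N x ^ l) v w ∧
          -- `v` solves the characteristic initial-value problem
          (∀ x ∈ N₀, F.app v x = 0) ∧
          (∀ x ∈ N₀, F.world ξ N x = 0 → v x = V 0 x) ∧ F.EqOnConoid ξ N v (V 0) ∧
          -- and is its only analytic solution near `ξ`
          (∀ v' : (Fin n → ℝ) → ℝ, AnalyticAt ℝ v' ξ → (∀ᶠ x in 𝓝 ξ, F.app v' x = 0) →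
            (F.EqOnConoid ξ N v' (V 0) ∨
              (F.Indefinite ξ ∧ ∀ᶠ x in 𝓝 ξ, F.world ξ N x = 0 → v' x = V 0 x)) →
            ∀ᶠ x in 𝓝 ξ, v' x = v x) ∧
          -- the logarithmic coefficient of every fundamental solution is a multiple of `v`
          (∀ (N₁ : Set (Fin n → ℝ)) (U' V' W' : (Fin n → ℝ) → ℝ),
            F.IsFundSol ξ N N₁ U' V' W' →
            ∀ᶠ x in 𝓝 ξ, V' x = U' ξ / P * v x)) := by
  obtain ⟨R, H, A, E, N, hR, hNΩ, -, -, hB, hN, -, h⟩ := hF.exists_normalized hΩ hξ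
  exact ⟨N, hNΩ, h.toIsNormalNhd, h.analytic_world, h.eikonal_world, fun P hP =>
    ⟨fun hn => h.odd_part hR hB hN hn hP, fun hn h4 =>
      h.even_part hR hB hN (hF.nondegenerate ξ hξ) hn h4 hP⟩⟩
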